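/- Let $m\ge 2$, $d\ge 1$ and $k$ be integers with $k>(m-1)d+1$. Let $\Sigma\subset\mathbb{R}^{md}$ be a nonempty compact smooth (embedded) hypersurface without boundary such that at every point of $\Sigma$ at least $k$ of the $md-1$ principal curvatures, counted with multiplicity, are nonzero, and let $\sigma$ be the normalized surface measure on $\Sigma$. For functions $f_1,\dots,f_m:\mathbb{R}^d\to\mathbb{C}$ define the multilinear local maximal function $$ \mathrm{M}^{loc}_\sigma(f_1,\dots,f_m)(x)=\sup_{1<t<2}\Big|\int_\Sigma\prod_{i=1}^m f_i(x-ty_i)\,d\sigma(y)\Big|,\qquad x\in\mathbb{R}^d,\quad y=(y_1,\dots,y_m)\in(\mathbb{R}^d)^m . $$ Then, for every $p$ with $$ \frac{k-(m-1)d+1}{k-(m-1)d}<p\le\infty , $$ $\mathrm{M}^{loc}_\sigma$ maps $L^p(\mathbb{R}^d)\times\cdots\times L^p(\mathbb{R}^d)$ to $L^{p/m}(\mathbb{R}^d)$: there is a constant $C<\infty$, depending only on $m,d,k,\Sigma,p$, such that for all $f_1,\dots,f_m\in L^p(\mathbb{R}^d)$ the integrals defining $\mathrm{M}^{loc}_\sigma(f_1,\dots,f_m)(x)$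 converge absolutely for almost every $x$ and all $1<t<2$, the function $\mathrm{M}^{loc}_\sigma(f_1,\dots,f_m)$ is measurable (Lebesgue), and $$ \|\mathrm{M}^{loc}_\sigma(f_1,\dots,f_m)\|_{L^{p/m}(\mathbb{R}^d)}\le C\prod_{i=1}^m\|f_i\|_{L^p(\mathbb{R}^d)} . $$ Here $\infty/m=\infty$, and for $p<m$ the expression $\|\cdot\|_{L^{p/m}}$ is the usual quasi-norm. -/

import Mathlib

open MeasureTheory ProbabilityTheory
open scoped ENNReal NNReal ContDiff InnerProductSpace

noncomputable section

namespace MultilinearMaximal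

section Hypersurface

variable {E : Type*} [NormedAddCommGroup E] [InnerProductSpace ℝ E] [FiniteDimensional ℝ E]

/-- `ρ` is a smooth defining function of the set `S` on the open set `U`: its gradient has no zero
on `U`, and `S ∩ U` is the zero set of `ρ` in `U`. -/
structure IsLocalDefiningFunction (S U : Set E) (ρ : E → ℝ) : Prop where
  isOpen : IsOpen U
  contDiffOn : ContDiffOn ℝ ∞ ρ U
  gradient_ne_zero : ∀ q ∈ U, gradient ρ q ≠ 0
  mem_iff : ∀ q ∈ U, (q ∈ S ↔ ρ q = 0)

/-- A smooth embedded hypersurface (without boundary, not necessarily connected) of the Euclidean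
space `E`: near each of its points it has a smooth defining function. -/
def IsSmoothHypersurface (S : Set E) : Prop :=
  ∀ p ∈ S, ∃ (U : Set E) (ρ : E → ℝ), p ∈ U ∧ IsLocalDefiningFunction S U ρ

/-- The unit normal field `∇ρ / |∇ρ|` to the level sets of `ρ`. -/
def unitNormal (ρ : E → ℝ) (q : E) : E := ‖gradient ρ q‖⁻¹ • gradient ρ q

/-- The tangent space at `p` of the level set of `ρ` through `p`. -/
abbrev tangentSpace (ρ : E → ℝ) (p : E) : Submodule ℝ E := (ℝ ∙ unitNormal ρ p)ᗮ

/-- The shape operator (Weingarten map) `v ↦ - D_v ν` on the tangent space, `ν` the unit normal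
field. Since `ν` has constant length, `D_v ν` is already tangent, and the orthogonal projection
serves only to give the map the right codomain. -/
def shapeOperator (ρ : E → ℝ) (p : E) : tangentSpace ρ p →ₗ[ℝ] tangentSpace ρ p :=
  -((tangentSpace ρ p).orthogonalProjectionOnto.toLinearMap ∘ₗ
      (fderiv ℝ (unitNormal ρ) p).toLinearMap ∘ₗ (tangentSpace ρ p).subtype)

/-- The principal curvatures at `p` of the level set of `ρ` through `p`: the eigenvalues of the
shape operator, with multiplicity. -/
def principalCurvatures (ρ : E → ℝ) (p : E) : Multiset ℝ := (shapeOperator ρ p).charpoly.roots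

open Classical in
/-- At each point of the hypersurface `S`, at least `k` principal curvatures (counted with
multiplicity) are nonzero. Another defining function changes the principal curvatures at most by a
common sign, so the condition does not depend on the choice of it. -/
def HasNonvanishingPrincipalCurvatures (S : Set E) (k : ℕ) : Prop :=
  ∀ p ∈ S, ∀ (U : Set E) (ρ : E → ℝ), p ∈ U → IsLocalDefiningFunction S U ρ →
    k ≤ ((principalCurvatures ρ p).filter (fun κ => κ ≠ 0)).card

end Hypersurface

/-- `ℝ^{md}` with its Euclidean structure, its points written `y = (y_1, …, y_m)` with
`y_i ∈ ℝ^d`. -/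
abbrev BlockSpace (m d : ℕ) : Type := PiLp 2 (fun _ : Fin m => EuclideanSpace ℝ (Fin d))

/-- The normalized surface measure of `S ⊆ ℝ^{md}`: the `(md - 1)`-dimensional Hausdorff measure
on `S`, divided by its total mass. -/
def normalizedSurfaceMeasure {m d : ℕ} (S : Set (BlockSpace m d)) : Measure (BlockSpace m d) :=
  (μHE[m * d - 1] S)⁻¹ • (μHE[m * d - 1]).restrict S

/-- The multilinear average `∫ ∏ f_i(x - t y_i) dσ(y)`. -/
def average {m d : ℕ} (σ : Measure (BlockSpace m d))
    (f : Fin m → EuclideanSpace ℝ (Fin d) → ℂ) (x : EuclideanSpace ℝ (Fin d)) (t : ℝ) : ℂ :=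
  ∫ y, ∏ i, f i (x - t • y i) ∂σ

/-- The multilinear local maximal function, the supremum of the absolute values of the averages
over `1 < t < 2`, with values in `[0, ∞]`. -/
def localMaximal {m d : ℕ} (σ : Measure (BlockSpace m d))
    (f : Fin m → EuclideanSpace ℝ (Fin d) → ℂ) (x : EuclideanSpace ℝ (Fin d)) : ℝ≥0∞ :=
  ⨆ t ∈ Set.Ioo (1 : ℝ) 2, ‖average σ f x t‖ₑ

end MultilinearMaximal

end

open MultilinearMaximal

set_option linter.unusedSectionVars false

namespace MultilinearMaximal

/-! Put `V = (ℝ^d)^m`, let `Δ` be the diagonal embedding of `W = ℝ^d` in `V`, and let `F(v) = ∏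
f_i(v_i)`. The multilinear average at `x` is `∫ F(Δx - ty) dσ(y)`: an ordinary average of `F` over a
dilated surface, observed only on the diagonal, which has codimension `D = (m-1)d`. So the problem
concerns a linear local maximal operator on `V`, restricted to a subspace. Write `k = D + 1 + b`;
then `b ≥ 1`, and the range of exponents is `p > (b+2)/(b+1)`, that is `(b+1)(p-1) > 1`.

Split the frequencies into shells `|ξ| ~ 2^j`. In L², the curvature gives `|σ̂(ξ)| ≲ |ξ|^(-k/2)`, a
gain of `2^(-jk/2)`; the supremum over `t` costs `2^(j/2)` and the restriction to the diagonal costs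
`2^(jD/2)`. What remains is `2^(-jb/2)` (`exists_lintegral_iSup_dyadicPiece_le`). From L¹ to L^∞ the
loss is `2^j`, since `σ` smoothed at scale `2^(-j)` has density `O(2^j)`
(`exists_enorm_dyadicPiece_le`). Cutting a function at a height that depends on `j` interpolates
between the two bounds, and the pieces are summable when `1 < r < 2` and `(b+1)(r-1) > 1`
(`exists_lintegral_maximal_le_of_continuous`). The outcome is a bound from `L^r(V)` to L¹ of unit
balls of `W`, uniform in the ball.

This local bound suffices. Since `t` and the surface are bounded, only a ball of fixed radius in `V`
matters for each unit ball of `W`. As `r ≤ 2 ≤ m`, the L¹ norm on a unit ball controls the `L^(r/m)`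
quasi-norm there, and integrating over the centres of the balls, with Hölder's inequality for `m`
equal exponents, gives the global estimate at `r` (`exists_lintegral_localMaximal_rpow_le`). Larger
finite `p` follow from Jensen's inequality for `σ`, and `p = ∞` is direct. Since `σ` is singular,
null sets need care: the maximal bound itself shows that for almost every `x` no dilate charges a
given null set, and that maximal functions of approximations converge almost everywhere
(`ae_integrable_and_aemeasurable`).

For the decay of `σ̂`, write the surface near a point as the graph of `φ` over the tangent space.
The Hessian of `φ` there is the shape operator (`fderiv_graph`), which is bounded below on a
subspace `P` of dimension at least `k`. A van der Corput inequality bounds the square of the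
oscillatory integral by its autocorrelations at shifts `h ∈ P`. These have the phase `s(φ(x+h) -
φ(x))`, which is never stationary, so they decay rapidly in `|s||h|`, and integration over `P` gives
`|s|^(-dim P)` (`exists_norm_integral_graph_phase_le`). The area formula for graphs and a partition
of unity carry this over to the surface measure. -/

theorem sq_lintegral_le {α : Type*} [MeasurableSpace α] (μ : Measure α) {f : α → ℝ≥0∞}
    (hf : AEMeasurable f μ) : (∫⁻ x, f x ∂μ) ^ 2 ≤ μ Set.univ * ∫⁻ x, f x ^ 2 ∂μ := by
  have h := ENNReal.lintegral_mul_le_Lp_mul_Lq μ (p := 2) (q := 2)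
    (Real.holderConjugate_iff.2 ⟨by norm_num, by norm_num⟩) (f := fun _ => 1) aemeasurable_const hf
  simp only [Pi.mul_apply, one_mul, ENNReal.one_rpow, lintegral_const] at h
  calc (∫⁻ x, f x ∂μ) ^ 2 ≤ ((μ Set.univ) ^ (1 / 2 : ℝ) *
        (∫⁻ x, f x ^ (2 : ℝ) ∂μ) ^ (1 / 2 : ℝ)) ^ 2 := by gcongr
    _ = μ Set.univ * ∫⁻ x, f x ^ 2 ∂μ := by
        rw [mul_pow, ← ENNReal.rpow_natCast, ← ENNReal.rpow_natCast, ← ENNReal.rpow_mul,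
          ← ENNReal.rpow_mul]
        norm_num

/-! ### Plancherel's theorem for Fourier integrals -/

section Plancherel

open FourierTransform SchwartzMap

variable {E : Type*} [NormedAddCommGroup E] [InnerProductSpace ℝ E] [FiniteDimensional ℝ E]
  [MeasurableSpace E] [BorelSpace E]

/-- Plancherel's theorem for integrable square integrable functions. -/
theorem lintegral_enorm_fourier_sq {f : E → ℂ} (hf : Integrable f) (hf2 : MemLp f 2) :
    ∫⁻ ξ, ‖𝓕 f ξ‖ₑ ^ 2 = ∫⁻ x, ‖f x‖ₑ ^ 2 := by
  set F : Lp ℂ 2 (volume : Measure E) := hf2.toLp f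
  have hFf : F =ᵐ[volume] f := hf2.coeFn_toLp
  have hcont : Continuous (𝓕 f) := 
    VectorFourier.fourierIntegral_continuous Real.continuous_fourierChar
      (by simpa using continuous_inner) hf
  -- The L² Fourier transform of the class of `f` agrees with the Fourier integral of `f`: tested
  -- against smooth compactly supported functions, both are given by the multiplication formula.
  have key : (𝓕 F : Lp ℂ 2 (volume : Measure E)) =ᵐ[volume] 𝓕 f := by
    apply ae_eq_of_integral_contDiff_smul_eq
    · exact (Lp.memLp (𝓕 F)).locallyIntegrable (by norm_num)
    · exact hcont.locallyIntegrable
    intro g hg hgc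
    have hgc' : HasCompactSupport (fun x => (g x : ℂ)) :=
      hgc.comp_left (g := fun t : ℝ => (t : ℂ)) (by simp)
    have hg' : ContDiff ℝ ∞ (fun x => (g x : ℂ)) := Complex.ofRealCLM.contDiff.comp hg
    set G : 𝓢(E, ℂ) := hgc'.toSchwartzMap hg'
    have hG : ∀ x, G x = (g x : ℂ) := fun x => rfl
    have h1 := congrArg (fun u => u G) (Lp.fourier_toTemperedDistribution_eq F)
    simp only [TemperedDistribution.fourier_apply, Lp.toTemperedDistribution_apply] at h1
    have h2 : ∫ x, (𝓕 G) x • F x = ∫ x, (𝓕 G) x • f x := by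
      apply integral_congr_ae
      filter_upwards [hFf] with x hx
      rw [hx]
    have h3 : ∫ x, (𝓕 G) x • f x = ∫ x, G x • 𝓕 f x := by
      rw [SchwartzMap.fourier_coe]
      simpa using! (VectorFourier.integral_fourierIntegral_smul_eq_flip (L := innerₗ E)
        Real.continuous_fourierChar (by simpa using continuous_inner) G.integrable hf)
    rw [h2, h3] at h1
    simpa [hG] using h1.symm
  have h4 : eLpNorm (𝓕 f) 2 volume = eLpNorm f 2 volume := by
    rw [← eLpNorm_congr_ae key, ← eLpNorm_congr_ae hFf, ← Lp.enorm_def, ← Lp.enorm_def,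
      ← ofReal_norm, ← ofReal_norm, Lp.norm_fourier_eq]
  have h5 := congrArg (fun a : ℝ≥0∞ => a ^ 2) h4
  simpa [eLpNorm_eq_lintegral_rpow_enorm_toReal (p := 2) (by norm_num) (by norm_num),
    ← ENNReal.rpow_mul_natCast] using h5

theorem lintegral_enorm_fourierInv_sq {f : E → ℂ} (hf : Integrable f) (hf2 : MemLp f 2) :
    ∫⁻ ξ, ‖𝓕⁻ f ξ‖ₑ ^ 2 = ∫⁻ x, ‖f x‖ₑ ^ 2 := by
  rw [← lintegral_enorm_fourier_sq hf hf2, ← lintegral_neg_eq_self (fun x => ‖𝓕 f x‖ₑ ^ 2)]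
  simp [Real.fourierInv_eq_fourier_neg]

end Plancherel

/-! ### Restriction of band-limited functions to a subspace -/

section Restriction

open FourierTransform

variable {V W : Type*} [NormedAddCommGroup V] [InnerProductSpace ℝ V] [FiniteDimensional ℝ V]
  [MeasurableSpace V] [BorelSpace V] [NormedAddCommGroup W] [InnerProductSpace ℝ W]
  [FiniteDimensional ℝ W] [MeasurableSpace W] [BorelSpace W]

omit [MeasurableSpace V] [BorelSpace V] [MeasurableSpace W] [BorelSpace W] in
-- The character `⟪Δ x, ξ⟫ = ⟪x, Δ* ξ⟫` sees only `Δ* ξ`. As `Δ` is injective, `Δ*` is surjective,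
-- and a linear right inverse of it splits `V` as `W × ker Δ*`.
theorem exists_coordinates_adjoint (Δ : W →L[ℝ] V) (hΔ : Function.Injective Δ) {D : ℕ}
    (hD : Module.finrank ℝ W + D = Module.finrank ℝ V) :
    ∃ (U : Submodule ℝ V) (e : V ≃L[ℝ] W × U),
      (∀ q, ContinuousLinearMap.adjoint Δ (e.symm q) = q.1) ∧ Module.finrank ℝ U = D := by
  set s : V →L[ℝ] W := ContinuousLinearMap.adjoint Δ with hs
  have hs_surj : Function.Surjective s := by
    have h1 : (s : V →ₗ[ℝ] W).range = ⊤ := by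
      have := ContinuousLinearMap.orthogonal_range Δ.adjoint
      rw [ContinuousLinearMap.adjoint_adjoint] at this
      rw [LinearMap.ker_eq_bot.2 hΔ] at this
      rw [← Submodule.orthogonal_eq_bot_iff]
      exact this
    exact LinearMap.range_eq_top.1 h1
  obtain ⟨r, hr⟩ := LinearMap.exists_rightInverse_of_surjective (s : V →ₗ[ℝ] W)
    (LinearMap.range_eq_top.2 hs_surj)
  have hr' : Function.RightInverse r.toContinuousLinearMap s := fun w => by
    simpa using LinearMap.congr_fun hr w
  refine ⟨(s : V →ₗ[ℝ] W).ker,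
    ContinuousLinearEquiv.equivOfRightInverse s r.toContinuousLinearMap hr', fun q => ?_, ?_⟩
  · rw [← ContinuousLinearEquiv.fst_equivOfRightInverse s r.toContinuousLinearMap hr']
    rw [ContinuousLinearEquiv.apply_symm_apply]
  · have h1 := LinearMap.finrank_range_add_finrank_ker (s : V →ₗ[ℝ] W)
    rw [LinearMap.range_eq_top.2 hs_surj, finrank_top] at h1
    exact Nat.add_left_cancel (h1.trans hD.symm)

/-- The restriction to a subspace of a function with frequencies in a ball of radius `ρ`: the
`L²` norm increases at most by a power of `ρ`, the exponent being half the codimension. -/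
theorem exists_lintegral_restrict_le (Δ : W →L[ℝ] V) (hΔ : Function.Injective Δ) {D : ℕ}
    (hD : Module.finrank ℝ W + D = Module.finrank ℝ V) :
    ∃ C : ℝ≥0, ∀ (ρ : ℝ≥0) (h : V → ℂ), Integrable h → MemLp h 2 →
      (∀ ξ, ρ < ‖ξ‖ → h ξ = 0) →
      ∫⁻ x, ‖∫ ξ, Real.fourierChar ⟪Δ x, ξ⟫_ℝ • h ξ‖ₑ ^ 2 ≤ C * ρ ^ D * ∫⁻ ξ, ‖h ξ‖ₑ ^ 2 := by
  obtain ⟨U, e, hse, hUD⟩ := exists_coordinates_adjoint Δ hΔ hD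
  obtain ⟨c, hc0, hc⟩ : ∃ c : ℝ≥0, c ≠ 0 ∧ Measure.map e (volume : Measure V) =
      c • ((volume : Measure W).prod (volume : Measure U)) := by
    have : (Measure.map e (volume : Measure V)).IsAddHaarMeasure :=
      ContinuousLinearEquiv.isAddHaarMeasure_map e volume
    exact ⟨_, (Measure.addHaarScalarFactor_pos_of_isAddHaarMeasure _ _).ne',
      Measure.isAddLeftInvariant_eq_smul _ _⟩
  set em : V ≃ᵐ W × U := e.toHomeomorph.toMeasurableEquiv
  have hem : ∀ v, em v = e v := fun v => rfl
  set b : ℝ≥0∞ := volume (Metric.ball (0 : U) 1)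
  have hb : b < ⊤ := measure_ball_lt_top
  set K : ℝ≥0 := ‖(e : V →L[ℝ] W × U)‖₊
  refine ⟨c * (K ^ D * b.toNNReal), fun ρ h hh hh2 hρ => ?_⟩
  set g : W × U → ℂ := fun q => h (e.symm q) with hg
  have hmap : ∀ q : V → ℂ, ∫ ξ, q ξ = c • ∫ z : W × U, q (e.symm z) := by
    intro q
    have h1 : ∫ ξ, q ξ = ∫ z, q (e.symm z) ∂(Measure.map em (volume : Measure V)) := by
      rw [integral_map_equiv]
      simp [hem]
    rw [h1]
    change ∫ z, q (e.symm z) ∂(Measure.map e (volume : Measure V)) = _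
    rw [hc, integral_smul_nnreal_measure]
    rfl
  have hlmap : ∀ q : V → ℝ≥0∞, ∫⁻ ξ, q ξ = c * ∫⁻ z : W × U, q (e.symm z) := by
    intro q
    have h1 : ∫⁻ ξ, q ξ = ∫⁻ z, q (e.symm z) ∂(Measure.map em (volume : Measure V)) := by
      rw [lintegral_map_equiv]
      simp [hem]
    rw [h1]
    change ∫⁻ z, q (e.symm z) ∂(Measure.map e (volume : Measure V)) = _
    rw [hc, lintegral_smul_measure]
    rfl
  have hgi : Integrable g := by
    have h1 : Integrable g (Measure.map em (volume : Measure V)) := by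
      rw [integrable_map_equiv]
      simpa [hg, hem, Function.comp_def] using hh
    change Integrable g (Measure.map e (volume : Measure V)) at h1
    rw [hc] at h1
    exact (integrable_smul_measure (c := (c : ℝ≥0∞)) (by simpa using hc0) (by simp)).1 h1
  -- Integrating the frequency side over the fibres of `Δ*` corresponds to restricting to the range
  -- of `Δ`.
  set H : W → ℂ := fun w => ∫ u, g (w, u) with hH
  have hHi : Integrable H := by
    have : Integrable g ((volume : Measure W).prod (volume : Measure U)) := hgi
    exact this.integral_prod_left
  have hball : ∀ w u, g (w, u) ≠ 0 → u ∈ Metric.closedBall (0 : U) (K * ρ) := by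
    intro w u hne
    have h1 : ‖e.symm (w, u)‖ ≤ ρ := by
      by_contra hcon
      exact hne (hρ _ (not_le.1 hcon))
    have h2 : ‖e (e.symm (w, u))‖ ≤ K * ‖e.symm (w, u)‖ :=
      (e : V →L[ℝ] W × U).le_opNorm _
    rw [e.apply_symm_apply] at h2
    rw [mem_closedBall_zero_iff]
    exact (norm_snd_le (w, u)).trans (h2.trans (by gcongr))
  have hgm : AEStronglyMeasurable g ((volume : Measure W).prod (volume : Measure U)) :=
    hgi.aestronglyMeasurable
  -- Cauchy–Schwarz on a fibre: there the function lives in a ball of radius `K ρ` in dimension `D`,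
  -- whose volume produces the factor `ρ ^ D`.
  have hHle : ∀ᵐ w, ‖H w‖ₑ ^ 2 ≤ (K * ρ) ^ D * b * ∫⁻ u, ‖g (w, u)‖ₑ ^ 2 := by
    filter_upwards [hgm.prodMk_left] with w hw
    calc ‖H w‖ₑ ^ 2 ≤ (∫⁻ u, ‖g (w, u)‖ₑ) ^ 2 := by
          gcongr; exact enorm_integral_le_lintegral_enorm _
      _ = (∫⁻ u in Metric.closedBall (0 : U) (K * ρ), ‖g (w, u)‖ₑ) ^ 2 := by
          rw [setLIntegral_eq_of_support_subset]
          intro u hu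
          exact hball w u (by simpa using hu)
      _ ≤ volume (Metric.closedBall (0 : U) (K * ρ)) *
            ∫⁻ u in Metric.closedBall (0 : U) (K * ρ), ‖g (w, u)‖ₑ ^ 2 := by
          have := sq_lintegral_le (volume.restrict (Metric.closedBall (0 : U) (K * ρ)))
            hw.enorm.restrict
          simpa using this
      _ ≤ (K * ρ) ^ D * b * ∫⁻ u, ‖g (w, u)‖ₑ ^ 2 := by
          gcongr
          · rw [Measure.addHaar_closedBall _ _ (by positivity), hUD]
            gcongr
            rw [← NNReal.coe_mul, ← NNReal.coe_pow, ENNReal.ofReal_coe_nnreal]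
            push_cast
            rfl
          · exact Measure.restrict_le_self
  have hHint : ∫⁻ w, ‖H w‖ₑ ^ 2 ≤ (K * ρ) ^ D * b * ∫⁻ z, ‖g z‖ₑ ^ 2 := by
    calc ∫⁻ w, ‖H w‖ₑ ^ 2 ≤ ∫⁻ w, (K * ρ) ^ D * b * ∫⁻ u, ‖g (w, u)‖ₑ ^ 2 :=
          lintegral_mono_ae hHle
      _ = (K * ρ) ^ D * b * ∫⁻ w, ∫⁻ u, ‖g (w, u)‖ₑ ^ 2 := by
          rw [lintegral_const_mul' _ _
            (ENNReal.mul_ne_top (ENNReal.pow_ne_top (by finiteness)) hb.ne)]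
      _ = (K * ρ) ^ D * b * ∫⁻ z, ‖g z‖ₑ ^ 2 := by
          congr 1
          exact (lintegral_prod (μ := (volume : Measure W)) (ν := (volume : Measure U))
            (fun z => ‖g z‖ₑ ^ 2) (hgm.enorm.pow_const 2)).symm
  have hsq : ∫⁻ ξ, ‖h ξ‖ₑ ^ 2 = c * ∫⁻ z, ‖g z‖ₑ ^ 2 := hlmap _
  have hfin : ∫⁻ ξ, ‖h ξ‖ₑ ^ 2 < ⊤ := by
    have := (eLpNorm_lt_top_iff_lintegral_rpow_enorm_lt_top (p := 2) (by norm_num)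
      (by norm_num)).1 hh2.2
    simpa using this
  have hgfin : ∫⁻ z, ‖g z‖ₑ ^ 2 ≠ ⊤ := by
    intro hcon
    rw [hsq, hcon, ENNReal.mul_top (by simpa using hc0)] at hfin
    exact lt_irrefl _ hfin
  have hH2 : MemLp H 2 := by
    refine ⟨hHi.aestronglyMeasurable, ?_⟩
    rw [eLpNorm_lt_top_iff_lintegral_rpow_enorm_lt_top (by norm_num) (by norm_num)]
    have : ∫⁻ w, ‖H w‖ₑ ^ 2 < ⊤ := hHint.trans_lt (ENNReal.mul_lt_top
      (ENNReal.mul_lt_top (ENNReal.pow_lt_top (by finiteness)) hb) hgfin.lt_top)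
    simpa using this
  have hG : ∀ x, ∫ ξ, Real.fourierChar ⟪Δ x, ξ⟫_ℝ • h ξ = c • 𝓕⁻ H x := by
    intro x
    rw [hmap]
    congr 1
    have hint : Integrable (fun z : W × U => Real.fourierChar ⟪Δ x, e.symm z⟫_ℝ • g z)
        ((volume : Measure W).prod (volume : Measure U)) := by
      refine (Integrable.norm hgi).mono' ?_ ?_
      · refine AEStronglyMeasurable.smul ?_ hgm
        exact (Continuous.aestronglyMeasurable (by
          have := Real.continuous_fourierChar
          fun_prop))
      · exact Filter.Eventually.of_forall fun z => by simp [Circle.norm_smul]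
    change ∫ z, Real.fourierChar ⟪Δ x, e.symm z⟫_ℝ • g z
      ∂((volume : Measure W).prod (volume : Measure U)) = _
    rw [integral_prod _ hint, Real.fourierInv_eq]
    congr 1
    ext w
    have h1 : ∀ u, ⟪Δ x, e.symm (w, u)⟫_ℝ = ⟪w, x⟫_ℝ := fun u => by
      rw [← ContinuousLinearMap.adjoint_inner_right, hse, real_inner_comm]
    simp_rw [h1, Circle.smul_def]
    rw [integral_smul]
  calc ∫⁻ x, ‖∫ ξ, Real.fourierChar ⟪Δ x, ξ⟫_ℝ • h ξ‖ₑ ^ 2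
      = ∫⁻ x, (c : ℝ≥0∞) ^ 2 * ‖𝓕⁻ H x‖ₑ ^ 2 := by
        congr 1; ext x
        rw [hG, NNReal.smul_def, enorm_smul, mul_pow]
        simp
    _ = (c : ℝ≥0∞) ^ 2 * ∫⁻ x, ‖H x‖ₑ ^ 2 := by
        rw [lintegral_const_mul' _ _ (by simp), lintegral_enorm_fourierInv_sq hHi hH2]
    _ ≤ (c : ℝ≥0∞) ^ 2 * ((K * ρ) ^ D * b * ∫⁻ z, ‖g z‖ₑ ^ 2) := by gcongr
    _ = (c * (K ^ D * b.toNNReal) : ℝ≥0) * ρ ^ D * ∫⁻ ξ, ‖h ξ‖ₑ ^ 2 := by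
        rw [hsq]
        push_cast
        rw [ENNReal.coe_toNNReal hb.ne]
        ring

end Restriction

/-! ### Sobolev inequality in the dilation parameter -/

section SupremumOverDilations

/-- The derivative of `‖G‖²` is `2⟪G, G'⟫`, at most `N‖G‖² + N⁻¹‖G'‖²`; integrate it from `1` to
`t`. The weight `N` is free, to be chosen as the size of the frequency. -/
theorem iSup_enorm_sq_le_lintegral {G G' : ℝ → ℂ} (hG : ∀ t, HasDerivAt G (G' t) t)
    (hG' : Continuous G') {N : ℝ} (hN : 0 < N) :
    ⨆ t ∈ Set.Icc (1 : ℝ) 2, ‖G t‖ₑ ^ 2 ≤ ‖G 1‖ₑ ^ 2 +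
      ∫⁻ t in Set.Icc (1 : ℝ) 2, (ENNReal.ofReal N * ‖G t‖ₑ ^ 2 +
        ENNReal.ofReal N⁻¹ * ‖G' t‖ₑ ^ 2) := by
  have hGc : Continuous G := continuous_iff_continuousAt.2 fun t => (hG t).continuousAt
  refine iSup₂_le fun t ht => ?_
  have hd : ∀ s, HasDerivAt (fun s => ‖G s‖ ^ 2) (2 * ⟪G s, G' s⟫_ℝ) s := fun s =>
    (hG s).norm_sq
  have hcont : Continuous fun s => 2 * ⟪G s, G' s⟫_ℝ := by fun_prop
  have hftc := intervalIntegral.integral_eq_sub_of_hasDerivAt (a := 1) (b := t)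
    (fun s _ => hd s) (hcont.intervalIntegrable _ _)
  have hcont2 : Continuous fun s => N * ‖G s‖ ^ 2 + N⁻¹ * ‖G' s‖ ^ 2 := by fun_prop
  have hpt : ∀ s, 2 * ⟪G s, G' s⟫_ℝ ≤ N * ‖G s‖ ^ 2 + N⁻¹ * ‖G' s‖ ^ 2 := fun s => by
    have h1 : ⟪G s, G' s⟫_ℝ ≤ ‖G s‖ * ‖G' s‖ := real_inner_le_norm _ _
    have h2 : 0 ≤ N⁻¹ * (N * ‖G s‖ - ‖G' s‖) ^ 2 := by positivity
    have h3 : N⁻¹ * (N * ‖G s‖ - ‖G' s‖) ^ 2 =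
        N * ‖G s‖ ^ 2 + N⁻¹ * ‖G' s‖ ^ 2 - 2 * (‖G s‖ * ‖G' s‖) := by
      field_simp; ring
    linarith
  have hle : ‖G t‖ ^ 2 ≤ ‖G 1‖ ^ 2 +
      ∫ s in Set.Icc (1 : ℝ) 2, (N * ‖G s‖ ^ 2 + N⁻¹ * ‖G' s‖ ^ 2) := by
    have h1 : ∫ s in (1 : ℝ)..t, 2 * ⟪G s, G' s⟫_ℝ ≤
        ∫ s in (1 : ℝ)..t, (N * ‖G s‖ ^ 2 + N⁻¹ * ‖G' s‖ ^ 2) :=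
      intervalIntegral.integral_mono_on ht.1 (hcont.intervalIntegrable _ _)
        (hcont2.intervalIntegrable _ _) fun s _ => hpt s
    have h2 : ∫ s in (1 : ℝ)..t, (N * ‖G s‖ ^ 2 + N⁻¹ * ‖G' s‖ ^ 2) ≤
        ∫ s in Set.Icc (1 : ℝ) 2, (N * ‖G s‖ ^ 2 + N⁻¹ * ‖G' s‖ ^ 2) := by
      rw [intervalIntegral.integral_of_le ht.1]
      refine setIntegral_mono_set (hcont2.integrableOn_Icc) ?_ ?_
      · exact Filter.Eventually.of_forall fun s => by positivity
      · exact (Set.Ioc_subset_Icc_self.trans (Set.Icc_subset_Icc_right ht.2)).eventuallyLE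
    linarith
  have h1 : ‖G t‖ₑ ^ 2 = ENNReal.ofReal (‖G t‖ ^ 2) := by
    rw [ENNReal.ofReal_pow (norm_nonneg _), ofReal_norm]
  have h2 : ∀ z : ℂ, ENNReal.ofReal (‖z‖ ^ 2) = ‖z‖ₑ ^ 2 := fun z => by
    rw [ENNReal.ofReal_pow (norm_nonneg _), ofReal_norm]
  rw [h1]
  refine (ENNReal.ofReal_le_ofReal hle).trans ?_
  rw [ENNReal.ofReal_add (by positivity) (integral_nonneg fun s => by positivity), h2,
    ofReal_integral_eq_lintegral_ofReal hcont2.integrableOn_Icc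
      (Filter.Eventually.of_forall fun s => by positivity)]
  gcongr with s
  rw [ENNReal.ofReal_add (by positivity) (by positivity), ENNReal.ofReal_mul hN.le,
    ENNReal.ofReal_mul (by positivity), h2, h2]

/-- If a `t`-derivative costs a factor `N` in norm, the supremum costs only `N ^ (1/2)`: the weight
`N` balances the two terms of the preceding inequality. -/
theorem lintegral_iSup_enorm_sq_le {α : Type*} [TopologicalSpace α] [MeasurableSpace α]
    [BorelSpace α] [SecondCountableTopology α] {μ : Measure α} [SFinite μ] {G G' : α → ℝ → ℂ}
    (hGc : Continuous fun q : α × ℝ => G q.1 q.2) (hGc' : Continuous fun q : α × ℝ => G' q.1 q.2)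
    (hG : ∀ x t, HasDerivAt (G x) (G' x t) t) {N : ℝ≥0} {A : ℝ≥0∞} (hN : 1 ≤ N)
    (h0 : ∀ t ∈ Set.Icc (1 : ℝ) 2, ∫⁻ x, ‖G x t‖ₑ ^ 2 ∂μ ≤ A)
    (h1 : ∀ t ∈ Set.Icc (1 : ℝ) 2, ∫⁻ x, ‖G' x t‖ₑ ^ 2 ∂μ ≤ N ^ 2 * A) :
    ∫⁻ x, ⨆ t ∈ Set.Icc (1 : ℝ) 2, ‖G x t‖ₑ ^ 2 ∂μ ≤ 3 * N * A := by
  have hN0 : (0 : ℝ) < N := lt_of_lt_of_le one_pos hN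
  have hNne : (N : ℝ≥0∞) ≠ 0 := by simpa using (lt_of_lt_of_le one_pos hN).ne'
  have e1 : ENNReal.ofReal (N : ℝ) = N := by simp
  have e2 : ENNReal.ofReal (N : ℝ)⁻¹ = (N : ℝ≥0∞)⁻¹ := by
    rw [ENNReal.ofReal_inv_of_pos hN0, e1]
  have hinv : (N : ℝ≥0∞)⁻¹ ≠ ⊤ := by simpa using hNne
  have hm0 : ∀ t, Measurable fun x => ‖G x t‖ₑ ^ 2 := fun t =>
    (hGc.comp (by fun_prop : Continuous fun x : α => (x, t))).measurable.enorm.pow_const 2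
  calc ∫⁻ x, ⨆ t ∈ Set.Icc (1 : ℝ) 2, ‖G x t‖ₑ ^ 2 ∂μ
      ≤ ∫⁻ x, (‖G x 1‖ₑ ^ 2 + ∫⁻ t in Set.Icc (1 : ℝ) 2,
          ((N : ℝ≥0∞) * ‖G x t‖ₑ ^ 2 + (N : ℝ≥0∞)⁻¹ * ‖G' x t‖ₑ ^ 2)) ∂μ := by
        refine lintegral_mono fun x => ?_
        rw [← e2]
        have := iSup_enorm_sq_le_lintegral (hG x)
          (hGc'.comp (by fun_prop : Continuous fun t : ℝ => (x, t))) hN0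
        rwa [e1] at this
    _ = (∫⁻ x, ‖G x 1‖ₑ ^ 2 ∂μ) + ∫⁻ x, (∫⁻ t in Set.Icc (1 : ℝ) 2,
          ((N : ℝ≥0∞) * ‖G x t‖ₑ ^ 2 + (N : ℝ≥0∞)⁻¹ * ‖G' x t‖ₑ ^ 2)) ∂μ :=
        lintegral_add_left (hm0 1) _
    _ = (∫⁻ x, ‖G x 1‖ₑ ^ 2 ∂μ) + ∫⁻ t in Set.Icc (1 : ℝ) 2, ∫⁻ x,
          ((N : ℝ≥0∞) * ‖G x t‖ₑ ^ 2 + (N : ℝ≥0∞)⁻¹ * ‖G' x t‖ₑ ^ 2) ∂μ := by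
        congr 1
        refine lintegral_lintegral_swap (Measurable.aemeasurable ?_)
        exact ((hGc.measurable.enorm.pow_const 2).const_mul _).add
          ((hGc'.measurable.enorm.pow_const 2).const_mul _)
    _ ≤ A + ∫⁻ t in Set.Icc (1 : ℝ) 2, (2 * (N * A)) := by
        refine add_le_add (h0 1 (by norm_num)) (setLIntegral_mono' measurableSet_Icc fun t ht => ?_)
        rw [lintegral_add_left ((hm0 t).const_mul _), lintegral_const_mul' _ _ (by simp),
          lintegral_const_mul' _ _ hinv, two_mul]
        refine add_le_add (mul_le_mul_right (h0 t ht) _) ?_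
        calc (N : ℝ≥0∞)⁻¹ * ∫⁻ x, ‖G' x t‖ₑ ^ 2 ∂μ ≤ (N : ℝ≥0∞)⁻¹ * (N ^ 2 * A) :=
              mul_le_mul_right (h1 t ht) _
          _ = ((N : ℝ≥0∞)⁻¹ * N) * (N * A) := by ring
          _ = N * A := by rw [ENNReal.inv_mul_cancel hNne (by simp), one_mul]
    _ ≤ N * A + 2 * (N * A) := by
        refine add_le_add ?_ ?_
        · have : (1 : ℝ≥0∞) ≤ N := by exact_mod_cast hN
          calc A = 1 * A := (one_mul _).symm
            _ ≤ N * A := mul_le_mul_left this _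
        · rw [setLIntegral_const, Real.volume_Icc]
          norm_num
    _ = 3 * N * A := by ring

end SupremumOverDilations

/-! ### The Fourier transform of a measure along dilations -/

section DilatedTransform

variable {V : Type*} [NormedAddCommGroup V] [InnerProductSpace ℝ V]
  [MeasurableSpace V]

/-- The Fourier transform of the measure `σ` at the point `t • ξ`. -/
noncomputable def dilatedTransform (σ : Measure V) (t : ℝ) (ξ : V) : ℂ :=
  ∫ y, ((Real.fourierChar (-(t * ⟪y, ξ⟫_ℝ)) : Circle) : ℂ) ∂σ

/-- The derivative in `t` of `dilatedTransform σ t ξ`. -/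
noncomputable def dilatedTransformDeriv (σ : Measure V) (t : ℝ) (ξ : V) : ℂ :=
  ∫ y, (-(2 * Real.pi * ⟪y, ξ⟫_ℝ : ℝ) * Complex.I) *
    ((Real.fourierChar (-(t * ⟪y, ξ⟫_ℝ)) : Circle) : ℂ) ∂σ

variable (σ : Measure V) [IsFiniteMeasure σ]

theorem norm_dilatedTransform_le (t : ℝ) (ξ : V) : ‖dilatedTransform σ t ξ‖ ≤ σ.real Set.univ := by
  refine (norm_integral_le_of_norm_le_const (C := 1)
    (Filter.Eventually.of_forall fun y => (Circle.norm_coe _).le)).trans (by simp)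

variable [BorelSpace V] [FiniteDimensional ℝ V]

theorem continuous_dilatedTransform :
    Continuous fun q : ℝ × V => dilatedTransform σ q.1 q.2 := by
  unfold dilatedTransform
  have hc := Real.continuous_fourierChar
  refine continuous_of_dominated (bound := fun _ => 1) ?_ ?_ (integrable_const _) ?_
  · intro q
    exact Continuous.aestronglyMeasurable (by fun_prop)
  · intro q
    exact Filter.Eventually.of_forall fun y => (Circle.norm_coe _).le
  · exact Filter.Eventually.of_forall fun y => by fun_prop

variable {σ} {R : ℝ} (hR : ∀ᵐ y ∂σ, ‖y‖ ≤ R)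
include hR

omit [BorelSpace V] [FiniteDimensional ℝ V] [IsFiniteMeasure σ] in
theorem ae_norm_dilatedTransformDeriv_integrand_le (t : ℝ) (ξ : V) :
    ∀ᵐ y ∂σ, ‖(-(2 * Real.pi * ⟪y, ξ⟫_ℝ : ℝ) * Complex.I) *
      ((Real.fourierChar (-(t * ⟪y, ξ⟫_ℝ)) : Circle) : ℂ)‖ ≤ 2 * Real.pi * (R * ‖ξ‖) := by
  filter_upwards [hR] with y hy
  simp only [norm_mul, norm_neg, Complex.norm_real, Complex.norm_I, mul_one, Circle.norm_coe,
    Real.norm_eq_abs, abs_of_pos Real.pi_pos, abs_two]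
  gcongr
  exact (abs_real_inner_le_norm _ _).trans (by gcongr)

omit [BorelSpace V] [FiniteDimensional ℝ V] in
theorem norm_dilatedTransformDeriv_le (t : ℝ) (ξ : V) :
    ‖dilatedTransformDeriv σ t ξ‖ ≤ 2 * Real.pi * (R * ‖ξ‖) * σ.real Set.univ :=
  norm_integral_le_of_norm_le_const (ae_norm_dilatedTransformDeriv_integrand_le hR t ξ)

theorem continuous_dilatedTransformDeriv :
    Continuous fun q : ℝ × V => dilatedTransformDeriv σ q.1 q.2 := by
  unfold dilatedTransformDeriv
  have hc := Real.continuous_fourierChar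
  rw [continuous_iff_continuousAt]
  intro q
  refine continuousAt_of_dominated (bound := fun _ => 2 * Real.pi * (R * (‖q.2‖ + 1))) ?_ ?_
    (integrable_const _) ?_
  · refine Filter.Eventually.of_forall fun q => ?_
    exact Continuous.aestronglyMeasurable (by fun_prop)
  · have h1 : ∀ᶠ q' : ℝ × V in nhds q, ‖q'.2‖ < ‖q.2‖ + 1 :=
      (continuous_snd.norm.continuousAt).eventually_lt continuousAt_const (by simp)
    filter_upwards [h1] with q' hq'
    filter_upwards [ae_norm_dilatedTransformDeriv_integrand_le hR q'.1 q'.2, hR] with y hy hyR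
    refine hy.trans ?_
    have : 0 ≤ R := (norm_nonneg _).trans hyR
    gcongr
  · exact Filter.Eventually.of_forall fun y => by fun_prop

theorem hasDerivAt_dilatedTransform (t : ℝ) (ξ : V) :
    HasDerivAt (fun t => dilatedTransform σ t ξ) (dilatedTransformDeriv σ t ξ) t := by
  unfold dilatedTransform dilatedTransformDeriv
  have hc := Real.continuous_fourierChar
  refine (hasDerivAt_integral_of_dominated_loc_of_deriv_le
    (F := fun t (y : V) => ((Real.fourierChar (-(t * ⟪y, ξ⟫_ℝ)) : Circle) : ℂ))
    (F' := fun t (y : V) => (-(2 * Real.pi * ⟪y, ξ⟫_ℝ : ℝ) * Complex.I) *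
      ((Real.fourierChar (-(t * ⟪y, ξ⟫_ℝ)) : Circle) : ℂ)) (bound := fun _ => 2 * Real.pi * (R * ‖ξ‖))
    (s := Set.univ) Filter.univ_mem ?_ ?_ ?_ ?_ (integrable_const _) ?_).2
  · exact Filter.Eventually.of_forall fun t => Continuous.aestronglyMeasurable (by fun_prop)
  · refine (integrable_const (1 : ℝ)).mono' (Continuous.aestronglyMeasurable (by fun_prop)) ?_
    exact Filter.Eventually.of_forall fun y => (Circle.norm_coe _).le
  · exact Continuous.aestronglyMeasurable (by fun_prop)
  · have : ∀ᵐ y ∂σ, ‖y‖ ≤ R := hR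
    filter_upwards [hR] with y hy t _
    simp only [norm_mul, norm_neg, Complex.norm_real, Complex.norm_I, mul_one, Circle.norm_coe,
      Real.norm_eq_abs, abs_of_pos Real.pi_pos, abs_two]
    gcongr
    exact (abs_real_inner_le_norm _ _).trans (by gcongr)
  · refine Filter.Eventually.of_forall fun y t _ => ?_
    simp_rw [Real.fourierChar_apply]
    have h1 : HasDerivAt (fun t : ℝ => ((2 * Real.pi * (-(t * ⟪y, ξ⟫_ℝ)) : ℝ) : ℂ) * Complex.I)
        (-(2 * Real.pi * ⟪y, ξ⟫_ℝ : ℝ) * Complex.I) t := by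
      have h2 : HasDerivAt (fun t : ℝ => 2 * Real.pi * (-(t * ⟪y, ξ⟫_ℝ)))
          (-(2 * Real.pi * ⟪y, ξ⟫_ℝ)) t := by
        have := (((hasDerivAt_id t).mul_const ⟪y, ξ⟫_ℝ).neg).const_mul (2 * Real.pi)
        simpa [mul_comm, mul_left_comm] using this
      simpa using h2.ofReal_comp.mul_const Complex.I
    simpa [mul_comm] using h1.cexp

end DilatedTransform

/-! ### L² maximal estimate for a frequency-localized multiplier -/

section MaximalPiece

variable {V W : Type*} [NormedAddCommGroup V] [InnerProductSpace ℝ V] [FiniteDimensional ℝ V]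
  [MeasurableSpace V] [BorelSpace V] [NormedAddCommGroup W] [InnerProductSpace ℝ W]
  [FiniteDimensional ℝ W] [MeasurableSpace W] [BorelSpace W]

/-- The function on `W` with frequency side `b * a`, restricted along `Δ`. -/
noncomputable def multiplierRestrict (Δ : W →L[ℝ] V) (b a : V → ℂ) (x : W) : ℂ :=
  ∫ ξ, Real.fourierChar ⟪Δ x, ξ⟫_ℝ • (b ξ * a ξ)

theorem continuous_multiplierRestrict (Δ : W →L[ℝ] V) {b : V → ℂ} (hb : Continuous b)
    (hbc : HasCompactSupport b) {a : ℝ → V → ℂ} (ha : Continuous fun q : ℝ × V => a q.1 q.2)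
    {A : V → ℝ} (hA : Continuous A) (haA : ∀ t ξ, ‖a t ξ‖ ≤ A ξ) :
    Continuous fun q : W × ℝ => multiplierRestrict Δ b (a q.2) q.1 := by
  have hc := Real.continuous_fourierChar
  have hint : Integrable fun ξ => ‖b ξ‖ * A ξ :=
    (hb.norm.mul hA).integrable_of_hasCompactSupport (hbc.norm.mul_right)
  refine continuous_of_dominated (bound := fun ξ => ‖b ξ‖ * A ξ) ?_ ?_ hint ?_
  · intro q
    have : Continuous fun ξ => a q.2 ξ := ha.comp (by fun_prop : Continuous fun ξ => (q.2, ξ))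
    exact Continuous.aestronglyMeasurable (by fun_prop)
  · intro q
    refine Filter.Eventually.of_forall fun ξ => ?_
    rw [Circle.norm_smul, norm_mul]
    gcongr
    exact haA _ _
  · refine Filter.Eventually.of_forall fun ξ => ?_
    have : Continuous fun q : W × ℝ => a q.2 ξ :=
      ha.comp (by fun_prop : Continuous fun q : W × ℝ => (q.2, ξ))
    fun_prop

theorem hasDerivAt_multiplierRestrict (Δ : W →L[ℝ] V) {b : V → ℂ} (hb : Continuous b)
    (hbc : HasCompactSupport b) {σ : Measure V} [IsFiniteMeasure σ] {R : ℝ}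
    (hR : ∀ᵐ y ∂σ, ‖y‖ ≤ R) (x : W) (t : ℝ) :
    HasDerivAt (fun t => multiplierRestrict Δ b (dilatedTransform σ t) x)
      (multiplierRestrict Δ b (dilatedTransformDeriv σ t) x) t := by
  have hc := Real.continuous_fourierChar
  have h0 := continuous_dilatedTransform σ
  have h1 := continuous_dilatedTransformDeriv hR
  refine (hasDerivAt_integral_of_dominated_loc_of_deriv_le
    (F := fun t ξ => Real.fourierChar ⟪Δ x, ξ⟫_ℝ • (b ξ * dilatedTransform σ t ξ))
    (F' := fun t ξ => Real.fourierChar ⟪Δ x, ξ⟫_ℝ • (b ξ * dilatedTransformDeriv σ t ξ))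
    (bound := fun ξ => ‖b ξ‖ * (2 * Real.pi * (R * ‖ξ‖) * σ.real Set.univ))
    (s := Set.univ) Filter.univ_mem ?_ ?_ ?_ ?_ ?_ ?_).2
  · refine Filter.Eventually.of_forall fun t => ?_
    have : Continuous fun ξ => dilatedTransform σ t ξ :=
      h0.comp (by fun_prop : Continuous fun ξ => (t, ξ))
    exact Continuous.aestronglyMeasurable (by fun_prop)
  · have : Continuous fun ξ => dilatedTransform σ t ξ :=
      h0.comp (by fun_prop : Continuous fun ξ => (t, ξ))
    refine Continuous.integrable_of_hasCompactSupport (by fun_prop) ?_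
    exact (hbc.mul_right).smul_left
  · have : Continuous fun ξ => dilatedTransformDeriv σ t ξ :=
      h1.comp (by fun_prop : Continuous fun ξ => (t, ξ))
    exact Continuous.aestronglyMeasurable (by fun_prop)
  · refine Filter.Eventually.of_forall fun ξ t _ => ?_
    rw [Circle.norm_smul, norm_mul]
    gcongr
    exact norm_dilatedTransformDeriv_le hR t ξ
  · exact Continuous.integrable_of_hasCompactSupport (by fun_prop) hbc.norm.mul_right
  · refine Filter.Eventually.of_forall fun ξ t _ => ?_
    simp_rw [Circle.smul_def, smul_eq_mul]
    exact ((hasDerivAt_dilatedTransform hR t ξ).const_mul _).const_mul _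

/-- Each factor has its own source: `ρ ^ D` is the price of the restriction, `B ^ 2` the size of the
multiplier on the support of `b`, and `N` the price of the supremum over `t`. -/
theorem exists_lintegral_iSup_multiplierRestrict_le (Δ : W →L[ℝ] V) (hΔ : Function.Injective Δ)
    {D : ℕ} (hD : Module.finrank ℝ W + D = Module.finrank ℝ V) :
    ∃ C : ℝ≥0, ∀ (σ : Measure V) [IsFiniteMeasure σ] (R : ℝ), (∀ᵐ y ∂σ, ‖y‖ ≤ R) →
      ∀ (b : V → ℂ) (ρ N B : ℝ≥0), Continuous b → (∀ ξ, ρ < ‖ξ‖ → b ξ = 0) → 1 ≤ N →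
      (∀ ξ, b ξ ≠ 0 → ∀ t ∈ Set.Icc (1 : ℝ) 2, ‖dilatedTransform σ t ξ‖ ≤ B ∧
        ‖dilatedTransformDeriv σ t ξ‖ ≤ N * B) →
      ∫⁻ x, ⨆ t ∈ Set.Icc (1 : ℝ) 2, ‖multiplierRestrict Δ b (dilatedTransform σ t) x‖ₑ ^ 2 ≤
        C * ρ ^ D * B ^ 2 * N * ∫⁻ ξ, ‖b ξ‖ₑ ^ 2 := by
  obtain ⟨C, hC⟩ := exists_lintegral_restrict_le Δ hΔ hD
  refine ⟨3 * C, fun σ _ R hR b ρ N B hb hρ hN hB => ?_⟩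
  have hbc : HasCompactSupport b := by
    refine HasCompactSupport.intro (isCompact_closedBall (0 : V) ρ) fun ξ hξ => hρ ξ ?_
    simpa using hξ
  have h0 := continuous_dilatedTransform σ
  have h1 := continuous_dilatedTransformDeriv hR
  have hone : ∀ (a : V → ℂ) (M : ℝ≥0), Continuous a → (∀ ξ, b ξ ≠ 0 → ‖a ξ‖ ≤ M) →
      ∫⁻ x, ‖multiplierRestrict Δ b a x‖ₑ ^ 2 ≤ C * ρ ^ D * M ^ 2 * ∫⁻ ξ, ‖b ξ‖ₑ ^ 2 := by
    intro a M ha haM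
    have hcs : HasCompactSupport fun ξ => b ξ * a ξ := hbc.mul_right
    refine (hC ρ (fun ξ => b ξ * a ξ) ((hb.mul ha).integrable_of_hasCompactSupport hcs)
      ((hb.mul ha).memLp_of_hasCompactSupport hcs) fun ξ hξ => by simp [hρ ξ hξ]).trans ?_
    rw [mul_assoc _ ((M : ℝ≥0∞) ^ 2), ← lintegral_const_mul' ((M : ℝ≥0∞) ^ 2) _ (by simp)]
    refine mul_le_mul_right (lintegral_mono fun ξ => ?_) _
    rw [enorm_mul, mul_pow, mul_comm]
    by_cases hξ : b ξ = 0
    · simp [hξ]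
    · gcongr
      exact enorm_le_coe.2 (haM ξ hξ)
  have hcG := continuous_multiplierRestrict Δ hb hbc h0 (A := fun _ => σ.real Set.univ)
    continuous_const (norm_dilatedTransform_le σ)
  have hcG' := continuous_multiplierRestrict Δ hb hbc h1
    (A := fun ξ => 2 * Real.pi * (R * ‖ξ‖) * σ.real Set.univ) (by fun_prop)
    (norm_dilatedTransformDeriv_le hR)
  have hN0 : (0 : ℝ) < N := lt_of_lt_of_le one_pos hN
  set S := ∫⁻ ξ, ‖b ξ‖ₑ ^ 2
  have hc0 : ∀ t, Continuous (dilatedTransform σ t) := fun t =>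
    h0.comp (by fun_prop : Continuous fun ξ => (t, ξ))
  have hc1 : ∀ t, Continuous (dilatedTransformDeriv σ t) := fun t =>
    h1.comp (by fun_prop : Continuous fun ξ => (t, ξ))
  refine (lintegral_iSup_enorm_sq_le (N := N) (A := C * ρ ^ D * B ^ 2 * S) hcG hcG'
    (fun x t => hasDerivAt_multiplierRestrict Δ hb hbc hR x t) hN (fun t ht => ?_)
    fun t ht => ?_).trans_eq (by push_cast; ring)
  · exact hone _ B (hc0 t) fun ξ hξ => (hB ξ hξ t ht).1
  · refine (hone _ (N * B) (hc1 t) fun ξ hξ => by simpa using (hB ξ hξ t ht).2).trans_eq ?_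
    push_cast
    ring

end MaximalPiece

/-! ### Smooth frequency cutoffs and their kernels -/

section LowPass

open FourierTransform SchwartzMap

variable {V W : Type*} [NormedAddCommGroup V] [InnerProductSpace ℝ V] [FiniteDimensional ℝ V]
  [MeasurableSpace V] [BorelSpace V] [NormedAddCommGroup W] [InnerProductSpace ℝ W]
  [FiniteDimensional ℝ W] [MeasurableSpace W] [BorelSpace W]

variable (V) in
/-- A smooth bump function equal to `1` on the unit ball and supported in the ball of radius `2`. -/
noncomputable def unitBump : ContDiffBump (0 : V) := ⟨1, 2, one_pos, one_lt_two⟩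

/-- A smooth frequency cutoff to the ball of radius `2 ^ (J + 1)`. -/
noncomputable def freqCutoff (J : ℕ) (ξ : V) : ℂ := (unitBump V (((2 : ℝ) ^ J)⁻¹ • ξ) : ℝ)

theorem contDiff_freqCutoff (J : ℕ) : ContDiff ℝ ∞ (freqCutoff (V := V) J) := by
  have h : ContDiff ℝ ∞ (unitBump V) := (unitBump V).contDiff
  exact Complex.ofRealCLM.contDiff.comp (h.comp (contDiff_const_smul _))

theorem norm_freqCutoff_le (J : ℕ) (ξ : V) : ‖freqCutoff J ξ‖ ≤ 1 := by
  rw [freqCutoff, Complex.norm_real, Real.norm_of_nonneg (unitBump V).nonneg]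
  exact (unitBump V).le_one

theorem freqCutoff_eq_one {J : ℕ} {ξ : V} (h : ‖ξ‖ ≤ 2 ^ J) : freqCutoff J ξ = 1 := by
  have : unitBump V (((2 : ℝ) ^ J)⁻¹ • ξ) = 1 := by
    apply (unitBump V).one_of_mem_closedBall
    rw [mem_closedBall_zero_iff, norm_smul, norm_inv, norm_pow, Real.norm_ofNat,
      inv_mul_le_iff₀ (by positivity)]
    simpa [unitBump] using h
  simp [freqCutoff, this]

theorem freqCutoff_eq_zero {J : ℕ} {ξ : V} (h : 2 ^ (J + 1) ≤ ‖ξ‖) : freqCutoff J ξ = 0 := by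
  have : unitBump V (((2 : ℝ) ^ J)⁻¹ • ξ) = 0 := by
    apply (unitBump V).zero_of_le_dist
    rw [dist_zero_right, norm_smul, norm_inv, norm_pow, Real.norm_ofNat,
      le_inv_mul_iff₀ (by positivity)]
    simpa [unitBump, pow_succ] using h
  simp [freqCutoff, this]

theorem hasCompactSupport_freqCutoff (J : ℕ) : HasCompactSupport (freqCutoff (V := V) J) :=
  HasCompactSupport.intro (isCompact_closedBall (0 : V) (2 ^ (J + 1))) fun ξ hξ =>
    freqCutoff_eq_zero (by
      rw [mem_closedBall_zero_iff, not_le] at hξ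
      exact hξ.le)

theorem continuous_freqCutoff (J : ℕ) : Continuous (freqCutoff (V := V) J) :=
  (contDiff_freqCutoff J).continuous

variable (V) in
/-- The inverse Fourier transform of the unit frequency cutoff. -/
noncomputable def unitKernel : 𝓢(V, ℂ) :=
  𝓕⁻ ((hasCompactSupport_freqCutoff (V := V) 0).toSchwartzMap (contDiff_freqCutoff 0))

theorem unitKernel_eq (v : V) : unitKernel V v = 𝓕⁻ (freqCutoff (V := V) 0) v := by
  rw [unitKernel, SchwartzMap.fourierInv_coe]
  rfl

theorem integral_unitKernel : ∫ v, unitKernel V v = 1 := by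
  have h1 : 𝓕 (unitKernel V) = (hasCompactSupport_freqCutoff (V := V) 0).toSchwartzMap
      (contDiff_freqCutoff 0) := by
    rw [unitKernel, fourier_fourierInv_eq]
  have h2 : 𝓕 (unitKernel V) 0 = (hasCompactSupport_freqCutoff (V := V) 0).toSchwartzMap
      (contDiff_freqCutoff 0) 0 := by rw [h1]
  rw [SchwartzMap.fourier_coe, Real.fourier_eq] at h2
  have h3 : (hasCompactSupport_freqCutoff (V := V) 0).toSchwartzMap
      (contDiff_freqCutoff 0) (0 : V) = 1 := freqCutoff_eq_one (by simp)
  rw [h3] at h2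
  simpa using h2

/-- The kernel of the frequency cutoff `freqCutoff J`. -/
noncomputable def freqKernel (J : ℕ) (v : V) : ℂ := 𝓕⁻ (freqCutoff (V := V) J) v

theorem freqKernel_eq (J : ℕ) (v : V) :
    freqKernel J v = ((2 : ℝ) ^ J) ^ Module.finrank ℝ V • unitKernel V ((2 : ℝ) ^ J • v) := by
  rw [unitKernel_eq, freqKernel, Real.fourierInv_eq, Real.fourierInv_eq,
    ← Measure.integral_comp_inv_smul_of_nonneg volume _ (R := (2 : ℝ) ^ J) (by positivity)]
  congr 1
  ext ξ
  rw [inner_smul_left, inner_smul_right]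
  simp [freqCutoff]

theorem continuous_freqKernel (J : ℕ) : Continuous (freqKernel (V := V) J) := by
  have : freqKernel (V := V) J = fun v =>
    ((2 : ℝ) ^ J) ^ Module.finrank ℝ V • unitKernel V ((2 : ℝ) ^ J • v) := funext (freqKernel_eq J)
  rw [this]
  have := (unitKernel V).continuous
  fun_prop

/-- The multiplication formula moves the Fourier transform from `g` to the modulated cutoff, which
turns the frequency side into a convolution with the kernel. -/
theorem integral_fourierChar_freqCutoff_mul {g : V → ℂ} (hg : Integrable g) (J : ℕ) (u : V) :
    ∫ ξ, Real.fourierChar ⟪u, ξ⟫_ℝ • (freqCutoff J ξ * 𝓕 g ξ) = ∫ z, g z * freqKernel J (u - z) := by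
  have hc := Real.continuous_fourierChar
  have h1 : Integrable fun ξ : V => Real.fourierChar ⟪u, ξ⟫_ℝ • freqCutoff J ξ := by
    refine Continuous.integrable_of_hasCompactSupport ?_ ?_
    · have := continuous_freqCutoff (V := V) J
      fun_prop
    · exact (hasCompactSupport_freqCutoff J).smul_left
  have h2 : ∫ ξ, 𝓕 g ξ • (Real.fourierChar ⟪u, ξ⟫_ℝ • freqCutoff J ξ) =
      ∫ z, g z • 𝓕 (fun ξ : V => Real.fourierChar ⟪u, ξ⟫_ℝ • freqCutoff J ξ) z := by
    simpa using! (VectorFourier.integral_fourierIntegral_smul_eq_flip (L := innerₗ V)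
        Real.continuous_fourierChar (by simpa using continuous_inner) hg h1)
  have h3 : ∀ z, 𝓕 (fun ξ : V => Real.fourierChar ⟪u, ξ⟫_ℝ • freqCutoff J ξ) z =
      freqKernel J (u - z) := by
    intro z
    rw [freqKernel, Real.fourierInv_eq, Real.fourier_eq]
    congr 1
    ext ξ
    rw [smul_smul, ← AddChar.map_add_eq_mul, inner_sub_right, real_inner_comm u ξ]
    congr 2
    ring
  simp_rw [h3] at h2
  simp_rw [smul_eq_mul] at h2
  rw [← h2]
  congr 1
  ext ξ
  rw [Circle.smul_def, Circle.smul_def, smul_eq_mul, smul_eq_mul]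
  ring

theorem continuous_fourier {g : V → ℂ} (hg : Integrable g) : Continuous (𝓕 g) :=
  VectorFourier.fourierIntegral_continuous Real.continuous_fourierChar
      (by simpa using continuous_inner) hg

theorem multiplierRestrict_eq_integral (Δ : W →L[ℝ] V) {b : V → ℂ} (hb : Integrable b)
    (σ : Measure V) [IsFiniteMeasure σ] (t : ℝ) (x : W) :
    multiplierRestrict Δ b (dilatedTransform σ t) x =
      ∫ y, (∫ ξ, Real.fourierChar ⟪Δ x - t • y, ξ⟫_ℝ • b ξ) ∂σ := by
  have hc := Real.continuous_fourierChar
  have hint : Integrable (fun q : V × V => Real.fourierChar ⟪Δ x - t • q.1, q.2⟫_ℝ • b q.2)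
      (σ.prod volume) := by
    refine (hb.norm.comp_snd σ).mono' ?_ ?_
    · refine AEStronglyMeasurable.smul (Continuous.aestronglyMeasurable (by fun_prop)) ?_
      exact hb.aestronglyMeasurable.comp_snd
    · exact Filter.Eventually.of_forall fun q => by rw [Circle.norm_smul]
  rw [integral_integral_swap hint, multiplierRestrict]
  congr 1
  ext ξ
  rw [dilatedTransform, ← integral_const_mul, Circle.smul_def, ← integral_smul]
  congr 1
  ext y
  rw [inner_sub_left, sub_eq_add_neg, AddChar.map_add_eq_mul, real_inner_smul_left,
    Circle.smul_def, smul_eq_mul, smul_eq_mul, Circle.coe_mul]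
  ring

theorem multiplierRestrict_freqCutoff_eq (Δ : W →L[ℝ] V) {g : V → ℂ} (hg : Integrable g) (J : ℕ)
    (σ : Measure V) [IsFiniteMeasure σ] (t : ℝ) (x : W) :
    multiplierRestrict Δ (fun ξ => freqCutoff J ξ * 𝓕 g ξ) (dilatedTransform σ t) x =
      ∫ y, (∫ z, g z * freqKernel J (Δ x - t • y - z)) ∂σ := by
  refine (multiplierRestrict_eq_integral Δ (Continuous.integrable_of_hasCompactSupport
      ((continuous_freqCutoff J).mul (continuous_fourier hg))
      (hasCompactSupport_freqCutoff J).mul_right) σ t x).trans ?_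
  exact integral_congr_ae (Filter.Eventually.of_forall fun y =>
    integral_fourierChar_freqCutoff_mul hg J _)

theorem tendsto_integral_mul_freqKernel {g : V → ℂ} (hg : Continuous g) {M : ℝ}
    (hM : ∀ z, ‖g z‖ ≤ M) (u : V) :
    Filter.Tendsto (fun J => ∫ z, g z * freqKernel J (u - z)) Filter.atTop (nhds (g u)) := by
  have h1 : ∀ J, ∫ z, g z * freqKernel J (u - z) =
      ∫ v, g (u - ((2 : ℝ) ^ J)⁻¹ • v) * unitKernel V v := by
    intro J
    rw [← integral_sub_left_eq_self (fun z => g z * freqKernel J (u - z)) volume u]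
    simp_rw [sub_sub_cancel, freqKernel_eq]
    have h2 := Measure.integral_comp_smul_of_nonneg (volume : Measure V)
      (fun v => g (u - ((2 : ℝ) ^ J)⁻¹ • v) * unitKernel V v) ((2 : ℝ) ^ J) (hR := by positivity)
    simp_rw [smul_smul, inv_mul_cancel₀ (pow_ne_zero J (two_ne_zero' ℝ)), one_smul] at h2
    simp_rw [mul_smul_comm]
    rw [integral_smul, h2, smul_smul, mul_inv_cancel₀ (by positivity), one_smul]
  simp_rw [h1]
  have h3 : g u = ∫ v, g u * unitKernel V v := by
    rw [integral_const_mul, integral_unitKernel, mul_one]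
  rw [h3]
  have hK := (unitKernel V).integrable (μ := volume)
  refine tendsto_integral_of_dominated_convergence (fun v => M * ‖unitKernel V v‖) ?_
    (hK.norm.const_mul _) ?_ ?_
  · intro J
    have := (unitKernel V).continuous
    exact Continuous.aestronglyMeasurable (by fun_prop)
  · intro J
    refine Filter.Eventually.of_forall fun v => ?_
    rw [norm_mul]
    gcongr
    exact hM _
  · refine Filter.Eventually.of_forall fun v => Filter.Tendsto.mul_const _ ?_
    have h4 : Filter.Tendsto (fun J : ℕ => u - ((2 : ℝ) ^ J)⁻¹ • v) Filter.atTop (nhds u) := by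
      have h5 : Filter.Tendsto (fun J : ℕ => ((2 : ℝ) ^ J)⁻¹) Filter.atTop (nhds 0) :=
        tendsto_inv_atTop_zero.comp (tendsto_pow_atTop_atTop_of_one_lt one_lt_two)
      simpa using tendsto_const_nhds.sub (h5.smul_const v)
    exact (hg.tendsto u).comp h4

/-- The kernels form an approximate identity with L¹ norms independent of `J`, so bounded `g` allows
dominated convergence against the finite measure `σ`. This recovers the true average from its dyadic
pieces. -/
theorem tendsto_multiplierRestrict_freqCutoff (Δ : W →L[ℝ] V) {g : V → ℂ} (hg : Continuous g)
    (hgi : Integrable g) {M : ℝ} (hM : ∀ z, ‖g z‖ ≤ M) (σ : Measure V) [IsFiniteMeasure σ]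
    (t : ℝ) (x : W) :
    Filter.Tendsto (fun J => multiplierRestrict Δ (fun ξ => freqCutoff J ξ * 𝓕 g ξ)
      (dilatedTransform σ t) x) Filter.atTop (nhds (∫ y, g (Δ x - t • y) ∂σ)) := by
  simp_rw [multiplierRestrict_freqCutoff_eq Δ hgi]
  have hK := (unitKernel V).integrable (μ := volume)
  refine tendsto_integral_of_dominated_convergence (μ := σ) (fun _ => M * ∫ v, ‖unitKernel V v‖) ?_
    (integrable_const _) ?_ ?_
  · intro J
    have hK := continuous_freqKernel (V := V) J
    have : Measurable fun q : V × V => g q.2 * freqKernel J (Δ x - t • q.1 - q.2) := by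
      exact Continuous.measurable (by fun_prop)
    exact (this.stronglyMeasurable.integral_prod_right).aestronglyMeasurable
  · intro J
    refine Filter.Eventually.of_forall fun y => ?_
    refine (norm_integral_le_integral_norm _).trans ?_
    set u := Δ x - t • y
    have h1 : ∫ z, ‖freqKernel J (u - z)‖ = ∫ v, ‖unitKernel V v‖ := by
      rw [integral_sub_left_eq_self (fun z => ‖freqKernel J z‖) volume u]
      simp_rw [freqKernel_eq, norm_smul]
      rw [integral_const_mul, Measure.integral_comp_smul_of_nonneg (volume : Measure V)
        (fun v => ‖unitKernel V v‖) ((2 : ℝ) ^ J) (hR := by positivity), smul_eq_mul, ← mul_assoc,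
        Real.norm_of_nonneg (by positivity), mul_inv_cancel₀ (by positivity), one_mul]
    have hint : Integrable fun z => ‖freqKernel J (u - z)‖ := by
      have : Integrable (freqKernel (V := V) J) := by
        have h2 : freqKernel (V := V) J = fun v =>
          ((2 : ℝ) ^ J) ^ Module.finrank ℝ V • unitKernel V ((2 : ℝ) ^ J • v) :=
          funext (freqKernel_eq J)
        rw [h2]
        exact Integrable.smul (((2 : ℝ) ^ J) ^ Module.finrank ℝ V)
          (hK.comp_smul (pow_ne_zero J (two_ne_zero (α := ℝ))))
      exact (this.comp_sub_left u).norm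
    rw [← h1, ← integral_const_mul]
    refine integral_mono_of_nonneg (Filter.Eventually.of_forall fun z => norm_nonneg _)
      (hint.const_mul _) (Filter.Eventually.of_forall fun z => ?_)
    simp only [norm_mul]
    gcongr
    exact hM z
  · exact Filter.Eventually.of_forall fun y => tendsto_integral_mul_freqKernel hg hM _

/-- A rapidly decreasing function is dominated by a sum of multiples of indicator functions of
dyadic balls. -/
theorem exists_enorm_unitKernel_le : ∃ A : ℝ≥0, ∀ v : V, ‖unitKernel V v‖ₑ ≤
    ∑' l : ℕ, (A : ℝ≥0∞) * ((2 : ℝ≥0∞) ^ (l * Module.finrank ℝ V))⁻¹ *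
      (Metric.ball (0 : V) (2 ^ l)).indicator 1 v := by
  set n := Module.finrank ℝ V
  obtain ⟨C0, hC0p, hC0⟩ := (unitKernel V).decay 0 0
  obtain ⟨C1, hC1p, hC1⟩ := (unitKernel V).decay n 0
  simp only [pow_zero, one_mul, norm_iteratedFDeriv_zero] at hC0 hC1
  -- `C0` serves the unit ball. On a shell `2^l ≤ ‖v‖ < 2^(l+1)` the decay `‖v‖^(-n)` is used;
  -- passing to the outer radius costs `2^n`.
  refine ⟨(max C0 (C1 * 2 ^ n)).toNNReal, fun v => ?_⟩
  set A := (max C0 (C1 * 2 ^ n)).toNNReal with hA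
  have hAc : (A : ℝ) = max C0 (C1 * 2 ^ n) := Real.coe_toNNReal _ (by positivity)
  obtain ⟨l, hl1, hl2⟩ : ∃ l : ℕ, ‖v‖ < 2 ^ l ∧ ‖unitKernel V v‖ ≤ A * (2 ^ (l * n))⁻¹ := by
    by_cases hv : ‖v‖ < 1
    · exact ⟨0, by simpa using hv, by simpa [hAc] using Or.inl (hC0 v)⟩
    · obtain ⟨l, h1, h2⟩ := exists_nat_pow_near (not_lt.1 hv) (one_lt_two (α := ℝ))
      refine ⟨l + 1, h2, ?_⟩
      rw [← div_eq_mul_inv, le_div_iff₀ (by positivity)]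
      calc ‖unitKernel V v‖ * 2 ^ ((l + 1) * n) = (2 ^ l) ^ n * ‖unitKernel V v‖ * 2 ^ n := by
            rw [add_mul, pow_add, pow_mul]; ring
        _ ≤ ‖v‖ ^ n * ‖unitKernel V v‖ * 2 ^ n := by gcongr
        _ ≤ C1 * 2 ^ n := by gcongr; exact hC1 v
        _ ≤ A := by rw [hAc]; exact le_max_right _ _
  refine le_trans ?_ (ENNReal.le_tsum l)
  rw [Set.indicator_of_mem (by simpa using hl1), Pi.one_apply, mul_one]
  have h3 : ‖unitKernel V v‖ₑ ≤ ENNReal.ofReal (A * (2 ^ (l * n))⁻¹) := by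
    rw [← ofReal_norm]
    exact ENNReal.ofReal_le_ofReal hl2
  refine h3.trans_eq ?_
  rw [ENNReal.ofReal_mul (by positivity), ENNReal.ofReal_inv_of_pos (by positivity),
    ENNReal.ofReal_pow (by norm_num)]
  simp

/-- In dimension `n + 1` the kernel has height about `2^(J(n+1))` on a ball of radius `2^(-J)`,
whose `σ`-mass is about `2^(-Jn)`; the product is `2^J`. In the tail, the ball enlarged by `2^l` has
mass larger by `2^(ln)` and height smaller by `2^(l(n+1))`, which leaves a geometric series. -/
theorem exists_lintegral_freqKernel_le (hV : 1 ≤ Module.finrank ℝ V) {σ : Measure V}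
    {B : ℝ≥0} (hσ : ∀ (u : V) (r : ℝ), 0 < r →
      σ (Metric.ball u r) ≤ B * ENNReal.ofReal r ^ (Module.finrank ℝ V - 1)) :
    ∃ C : ℝ≥0, ∀ (J : ℕ) (t : ℝ) (u : V), 1 ≤ t →
      ∫⁻ y, ‖freqKernel J (u - t • y)‖ₑ ∂σ ≤ C * 2 ^ J := by
  obtain ⟨A, hA⟩ := exists_enorm_unitKernel_le (V := V)
  obtain ⟨n, hn⟩ : ∃ n, Module.finrank ℝ V = n + 1 := ⟨_, (Nat.sub_add_cancel hV).symm⟩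
  rw [hn] at hA hσ
  simp only [Nat.add_sub_cancel] at hσ
  refine ⟨2 * A * B, fun J t u ht => ?_⟩
  have ht0 : 0 < t := lt_of_lt_of_le one_pos ht
  have h2 : (2 : ℝ≥0∞) ≠ 0 := by norm_num
  have h2t : (2 : ℝ≥0∞) ≠ ⊤ := by norm_num
  have hpt : ∀ y, ‖freqKernel J (u - t • y)‖ₑ ≤ ∑' l : ℕ, (2 : ℝ≥0∞) ^ (J * (n + 1)) *
      (A * ((2 : ℝ≥0∞) ^ (l * (n + 1)))⁻¹) *
      (Metric.ball (t⁻¹ • u) ((2 ^ J)⁻¹ * 2 ^ l)).indicator 1 y := by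
    intro y
    rw [freqKernel_eq, enorm_smul, hn]
    have e1 : ‖((2 : ℝ) ^ J) ^ (n + 1)‖ₑ = (2 : ℝ≥0∞) ^ (J * (n + 1)) := by
      rw [← pow_mul, ← ofReal_norm, norm_pow, Real.norm_ofNat, ENNReal.ofReal_pow (by norm_num)]
      simp
    rw [e1]
    refine (mul_le_mul_right (hA _) _).trans ?_
    rw [← ENNReal.tsum_mul_left]
    refine ENNReal.tsum_le_tsum fun l => ?_
    rw [← mul_assoc]
    gcongr
    by_cases hy : (2 : ℝ) ^ J • (u - t • y) ∈ Metric.ball (0 : V) (2 ^ l)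
    · have hy' : y ∈ Metric.ball (t⁻¹ • u) ((2 ^ J)⁻¹ * 2 ^ l) := by
        rw [mem_ball_zero_iff, norm_smul, norm_pow, Real.norm_ofNat] at hy
        rw [mem_ball_iff_norm', ← lt_inv_mul_iff₀ (by positivity)] at *
        refine lt_of_le_of_lt ?_ hy
        have : u - t • y = t • (t⁻¹ • u - y) := by
          rw [smul_sub, smul_smul, mul_inv_cancel₀ ht0.ne', one_smul]
        rw [this, norm_smul, Real.norm_of_nonneg ht0.le]
        exact le_mul_of_one_le_left (norm_nonneg _) ht
      rw [Set.indicator_of_mem hy, Set.indicator_of_mem hy', Pi.one_apply, Pi.one_apply]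
    · rw [Set.indicator_of_notMem hy]
      exact zero_le
  calc ∫⁻ y, ‖freqKernel J (u - t • y)‖ₑ ∂σ
      ≤ ∫⁻ y, ∑' l : ℕ, (2 : ℝ≥0∞) ^ (J * (n + 1)) * (A * ((2 : ℝ≥0∞) ^ (l * (n + 1)))⁻¹) *
        (Metric.ball (t⁻¹ • u) ((2 ^ J)⁻¹ * 2 ^ l)).indicator 1 y ∂σ := lintegral_mono hpt
    _ = ∑' l : ℕ, (2 : ℝ≥0∞) ^ (J * (n + 1)) * (A * ((2 : ℝ≥0∞) ^ (l * (n + 1)))⁻¹) *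
        σ (Metric.ball (t⁻¹ • u) ((2 ^ J)⁻¹ * 2 ^ l)) := by
        rw [lintegral_tsum]
        · congr 1
          ext l
          rw [lintegral_const_mul _ (measurable_one.indicator Metric.isOpen_ball.measurableSet),
            lintegral_indicator_one Metric.isOpen_ball.measurableSet]
        · intro l
          exact ((measurable_one.indicator Metric.isOpen_ball.measurableSet).const_mul
            _).aemeasurable
    _ ≤ ∑' l : ℕ, (A * B * 2 ^ J) * (2⁻¹ : ℝ≥0∞) ^ l := by
        refine ENNReal.tsum_le_tsum fun l => ?_
        refine (mul_le_mul_right (hσ _ _ (by positivity)) _).trans_eq ?_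
        rw [ENNReal.ofReal_mul (by positivity), ENNReal.ofReal_inv_of_pos (by positivity),
          ENNReal.ofReal_pow (by norm_num), ENNReal.ofReal_pow (by norm_num), ENNReal.ofReal_ofNat]
        have hJ : ((2 : ℝ≥0∞) ^ J) ≠ 0 := pow_ne_zero _ h2
        have hJt : ((2 : ℝ≥0∞) ^ J) ≠ ⊤ := ENNReal.pow_ne_top h2t
        have hl : ((2 : ℝ≥0∞) ^ l) ≠ 0 := pow_ne_zero _ h2
        have hlt : ((2 : ℝ≥0∞) ^ l) ≠ ⊤ := ENNReal.pow_ne_top h2t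
        rw [pow_mul, pow_mul, ENNReal.inv_pow (a := (2 : ℝ≥0∞) ^ l), ← ENNReal.inv_pow (a := 2)]
        have e1 : ((2 : ℝ≥0∞) ^ J) ^ (n + 1) * ((2 ^ J)⁻¹ * 2 ^ l) ^ n * ((2 ^ l)⁻¹) ^ (n + 1) =
            ((2 : ℝ≥0∞) ^ J * (2 ^ J)⁻¹) ^ n * (2 ^ l * (2 ^ l)⁻¹) ^ n * (2 ^ J * (2 ^ l)⁻¹) := by
          ring
        calc _ = A * B * (((2 : ℝ≥0∞) ^ J) ^ (n + 1) * ((2 ^ J)⁻¹ * 2 ^ l) ^ n *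
              ((2 ^ l)⁻¹) ^ (n + 1)) := by ring
          _ = _ := by
            rw [e1, ENNReal.mul_inv_cancel hJ hJt, ENNReal.mul_inv_cancel hl hlt]
            ring
    _ = (2 * A * B : ℝ≥0) * 2 ^ J := by
        rw [ENNReal.tsum_mul_left, ENNReal.tsum_geometric, ENNReal.one_sub_inv_two, inv_inv]
        push_cast
        ring

end LowPass

/-! ### Dyadic pieces of the averages and their endpoint bounds -/

section DyadicPieces

open FourierTransform

variable {V W : Type*} [NormedAddCommGroup V] [InnerProductSpace ℝ V] [FiniteDimensional ℝ V]
  [MeasurableSpace V] [BorelSpace V] [NormedAddCommGroup W] [InnerProductSpace ℝ W]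
  [FiniteDimensional ℝ W] [MeasurableSpace W] [BorelSpace W]

/-- The smooth cutoff to the frequencies of size about `2 ^ j`. -/
noncomputable def pieceCutoff : ℕ → V → ℂ
  | 0, ξ => freqCutoff 0 ξ
  | j + 1, ξ => freqCutoff (j + 1) ξ - freqCutoff j ξ

theorem sum_pieceCutoff (J : ℕ) (ξ : V) :
    ∑ j ∈ Finset.range (J + 1), pieceCutoff j ξ = freqCutoff J ξ := by
  induction J with
  | zero => simp [pieceCutoff]
  | succ J ih => rw [Finset.sum_range_succ, ih]; simp [pieceCutoff]

theorem continuous_pieceCutoff (j : ℕ) : Continuous (pieceCutoff (V := V) j) := by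
  cases j with
  | zero => exact continuous_freqCutoff 0
  | succ j => exact (continuous_freqCutoff (j + 1)).sub (continuous_freqCutoff j)

theorem pieceCutoff_eq_zero {j : ℕ} {ξ : V} (h : 2 ^ (j + 1) ≤ ‖ξ‖) : pieceCutoff j ξ = 0 := by
  cases j with
  | zero => exact freqCutoff_eq_zero h
  | succ j =>
    have h' : (2 : ℝ) ^ (j + 1) ≤ ‖ξ‖ :=
      (pow_le_pow_right₀ one_le_two (Nat.le_succ _)).trans h
    simp [pieceCutoff, freqCutoff_eq_zero h, freqCutoff_eq_zero h']

theorem pieceCutoff_succ_eq_zero {j : ℕ} {ξ : V} (h : ‖ξ‖ ≤ 2 ^ j) :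
    pieceCutoff (j + 1) ξ = 0 := by
  have h' : ‖ξ‖ ≤ 2 ^ (j + 1) := h.trans (pow_le_pow_right₀ one_le_two (Nat.le_succ _))
  simp [pieceCutoff, freqCutoff_eq_one h, freqCutoff_eq_one h']

theorem norm_pieceCutoff_le (j : ℕ) (ξ : V) : ‖pieceCutoff j ξ‖ ≤ 2 := by
  cases j with
  | zero => exact (norm_freqCutoff_le 0 ξ).trans one_le_two
  | succ j =>
    refine (norm_sub_le _ _).trans ?_
    linarith [norm_freqCutoff_le (j + 1) ξ, norm_freqCutoff_le j ξ]

theorem hasCompactSupport_pieceCutoff (j : ℕ) : HasCompactSupport (pieceCutoff (V := V) j) :=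
  HasCompactSupport.intro (isCompact_closedBall (0 : V) (2 ^ (j + 1))) fun ξ hξ =>
    pieceCutoff_eq_zero (by
      rw [mem_closedBall_zero_iff, not_le] at hξ
      exact hξ.le)

/-- The part of the average of `g` over `σ`, dilated by `t`, that comes from the frequencies of
size about `2 ^ j`, at the point `Δ x`. -/
noncomputable def dyadicPiece (Δ : W →L[ℝ] V) (σ : Measure V) (g : V → ℂ) (j : ℕ) (x : W)
    (t : ℝ) : ℂ :=
  multiplierRestrict Δ (fun ξ => pieceCutoff j ξ * 𝓕 g ξ) (dilatedTransform σ t) x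

theorem multiplierRestrict_add (Δ : W →L[ℝ] V) {b₁ b₂ a : V → ℂ} (h₁ : Continuous b₁)
    (h₁c : HasCompactSupport b₁) (h₂ : Continuous b₂) (h₂c : HasCompactSupport b₂)
    (ha : Continuous a) (x : W) :
    multiplierRestrict Δ (fun ξ => b₁ ξ + b₂ ξ) a x =
      multiplierRestrict Δ b₁ a x + multiplierRestrict Δ b₂ a x := by
  have hc := Real.continuous_fourierChar
  unfold multiplierRestrict
  rw [← integral_add]
  · simp_rw [add_mul, smul_add]
  · exact Continuous.integrable_of_hasCompactSupport (by fun_prop) (h₁c.mul_right.smul_left)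
  · exact Continuous.integrable_of_hasCompactSupport (by fun_prop) (h₂c.mul_right.smul_left)

theorem continuous_dilatedTransform_right (σ : Measure V) [IsFiniteMeasure σ] (t : ℝ) :
    Continuous (dilatedTransform σ t) :=
  (continuous_dilatedTransform σ).comp (by fun_prop : Continuous fun ξ => (t, ξ))

theorem sum_dyadicPiece (Δ : W →L[ℝ] V) (σ : Measure V) [IsFiniteMeasure σ] {g : V → ℂ}
    (hg : Integrable g) (J : ℕ) (x : W) (t : ℝ) :
    ∑ j ∈ Finset.range (J + 1), dyadicPiece Δ σ g j x t =
      multiplierRestrict Δ (fun ξ => freqCutoff J ξ * 𝓕 g ξ) (dilatedTransform σ t) x := by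
  have hc := Real.continuous_fourierChar
  have h1 := continuous_fourier hg
  have h2 := continuous_dilatedTransform_right σ t
  unfold dyadicPiece multiplierRestrict
  rw [← integral_finsetSum]
  · congr 1
    ext ξ
    rw [← Finset.smul_sum, ← Finset.sum_mul, ← Finset.sum_mul, sum_pieceCutoff]
  · intro j _
    have := continuous_pieceCutoff (V := V) j
    exact Continuous.integrable_of_hasCompactSupport (by fun_prop)
      ((hasCompactSupport_pieceCutoff j).mul_right.mul_right.smul_left)

theorem dyadicPiece_add (Δ : W →L[ℝ] V) (σ : Measure V) [IsFiniteMeasure σ] {g₁ g₂ : V → ℂ}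
    (hg₁ : Integrable g₁) (hg₂ : Integrable g₂) (j : ℕ) (x : W) (t : ℝ) :
    dyadicPiece Δ σ (fun v => g₁ v + g₂ v) j x t =
      dyadicPiece Δ σ g₁ j x t + dyadicPiece Δ σ g₂ j x t := by
  have hψ := continuous_pieceCutoff (V := V) j
  unfold dyadicPiece
  refine Eq.trans ?_ (multiplierRestrict_add Δ (b₁ := fun ξ => pieceCutoff j ξ * 𝓕 g₁ ξ)
    (b₂ := fun ξ => pieceCutoff j ξ * 𝓕 g₂ ξ) (hψ.mul (continuous_fourier hg₁))
    (hasCompactSupport_pieceCutoff j).mul_right (hψ.mul (continuous_fourier hg₂))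
    (hasCompactSupport_pieceCutoff j).mul_right (continuous_dilatedTransform_right σ t) x)
  congr 1
  ext ξ
  have : 𝓕 (fun v => g₁ v + g₂ v) ξ = 𝓕 g₁ ξ + 𝓕 g₂ ξ := by
    simp_rw [Real.fourier_eq, smul_add]
    exact integral_add ((Real.fourierIntegral_convergent_iff ξ).2 hg₁)
      ((Real.fourierIntegral_convergent_iff ξ).2 hg₂)
  rw [this, mul_add]

theorem dyadicPiece_succ (Δ : W →L[ℝ] V) (σ : Measure V) [IsFiniteMeasure σ] {g : V → ℂ}
    (hg : Integrable g) (j : ℕ) (x : W) (t : ℝ) :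
    dyadicPiece Δ σ g (j + 1) x t =
      multiplierRestrict Δ (fun ξ => freqCutoff (j + 1) ξ * 𝓕 g ξ) (dilatedTransform σ t) x -
      multiplierRestrict Δ (fun ξ => freqCutoff j ξ * 𝓕 g ξ) (dilatedTransform σ t) x := by
  rw [← sum_dyadicPiece Δ σ hg, ← sum_dyadicPiece Δ σ hg, Finset.sum_range_succ]
  ring

/-- By Fubini, the smoothed measure becomes a kernel in `z` that is bounded by `C` and is integrated
against `‖g z‖`. -/
theorem enorm_multiplierRestrict_freqCutoff_le (Δ : W →L[ℝ] V) {σ : Measure V} [IsFiniteMeasure σ]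
    {g : V → ℂ} (hg : Integrable g) {C : ℝ≥0∞} {J : ℕ} {t : ℝ}
    (hC : ∀ u : V, ∫⁻ y, ‖freqKernel J (u - t • y)‖ₑ ∂σ ≤ C) (x : W) :
    ‖multiplierRestrict Δ (fun ξ => freqCutoff J ξ * 𝓕 g ξ) (dilatedTransform σ t) x‖ₑ ≤
      C * ∫⁻ z, ‖g z‖ₑ := by
  have hK := continuous_freqKernel (V := V) J
  rw [multiplierRestrict_freqCutoff_eq Δ hg]
  have hm : AEMeasurable (fun q : V × V => ‖g q.2 * freqKernel J (Δ x - t • q.1 - q.2)‖ₑ)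
      (σ.prod volume) := by
    refine AEStronglyMeasurable.enorm (hg.aestronglyMeasurable.comp_snd.mul ?_)
    exact Continuous.aestronglyMeasurable (by fun_prop)
  calc ‖∫ y, (∫ z, g z * freqKernel J (Δ x - t • y - z)) ∂σ‖ₑ
      ≤ ∫⁻ y, (∫⁻ z, ‖g z * freqKernel J (Δ x - t • y - z)‖ₑ) ∂σ :=
        (enorm_integral_le_lintegral_enorm _).trans
          (lintegral_mono fun y => enorm_integral_le_lintegral_enorm _)
    _ = ∫⁻ z, (∫⁻ y, ‖g z * freqKernel J (Δ x - t • y - z)‖ₑ ∂σ) := lintegral_lintegral_swap hm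
    _ ≤ ∫⁻ z, C * ‖g z‖ₑ := by
        refine lintegral_mono fun z => ?_
        simp_rw [enorm_mul]
        rw [lintegral_const_mul' _ _ (by simp), mul_comm]
        gcongr
        simp_rw [sub_right_comm (Δ x) _ z]
        exact hC _
    _ = C * ∫⁻ z, ‖g z‖ₑ := by
        rw [lintegral_const_mul'' _ hg.aestronglyMeasurable.enorm]

/-- The L¹ to L^∞ endpoint. A piece of positive index is the difference of two low-pass averages,
whence the doubled constant. -/
theorem exists_enorm_dyadicPiece_le (Δ : W →L[ℝ] V) (hV : 1 ≤ Module.finrank ℝ V) {σ : Measure V}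
    [IsFiniteMeasure σ] {B : ℝ≥0} (hσ : ∀ (u : V) (r : ℝ), 0 < r →
      σ (Metric.ball u r) ≤ B * ENNReal.ofReal r ^ (Module.finrank ℝ V - 1)) :
    ∃ C : ℝ≥0, ∀ (g : V → ℂ), Integrable g → ∀ (j : ℕ) (x : W) (t : ℝ), 1 ≤ t →
      ‖dyadicPiece Δ σ g j x t‖ₑ ≤ C * 2 ^ j * ∫⁻ z, ‖g z‖ₑ := by
  obtain ⟨C, hC⟩ := exists_lintegral_freqKernel_le hV hσ
  refine ⟨2 * C, fun g hg j x t ht => ?_⟩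
  have hb : ∀ J, ‖multiplierRestrict Δ (fun ξ => freqCutoff J ξ * 𝓕 g ξ)
      (dilatedTransform σ t) x‖ₑ ≤ C * 2 ^ J * ∫⁻ z, ‖g z‖ₑ := fun J =>
    enorm_multiplierRestrict_freqCutoff_le Δ hg (fun u => hC J t u ht) x
  push_cast
  rw [mul_assoc, mul_assoc, two_mul, ← mul_assoc]
  cases j with
  | zero => exact (hb 0).trans le_self_add
  | succ j =>
    rw [dyadicPiece_succ Δ σ hg]
    refine (enorm_sub_le).trans (add_le_add (hb _) ((hb _).trans ?_))
    gcongr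
    · norm_num
    · exact Nat.le_succ j

theorem dilatedTransform_eq (σ : Measure V) (t : ℝ) (ξ : V) :
    dilatedTransform σ t ξ = dilatedTransform σ 1 (t • ξ) := by
  simp [dilatedTransform, real_inner_smul_right]

theorem smul_dilatedTransformDeriv (σ : Measure V) (t : ℝ) (ξ : V) :
    t * dilatedTransformDeriv σ t ξ = dilatedTransformDeriv σ 1 (t • ξ) := by
  simp only [dilatedTransformDeriv, ← integral_const_mul, real_inner_smul_right, one_mul]
  congr 1
  ext y
  push_cast
  ring

/-- Decay of order `k / 2` of the Fourier transform of `σ` gives decay on the dyadic pieces. -/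
theorem exists_dilatedTransform_le_on_piece {σ : Measure V} [IsFiniteMeasure σ] {R : ℝ}
    (hR : ∀ᵐ y ∂σ, ‖y‖ ≤ R) {k : ℕ} {A : ℝ}
    (h0 : ∀ ξ, ‖dilatedTransform σ 1 ξ‖ ^ 2 * ‖ξ‖ ^ k ≤ A)
    (h1 : ∀ ξ, ‖dilatedTransformDeriv σ 1 ξ‖ ^ 2 * ‖ξ‖ ^ k ≤ A * ‖ξ‖ ^ 2) :
    ∃ C : ℝ≥0, ∀ (j : ℕ) (ξ : V), pieceCutoff j ξ ≠ 0 → ∀ t ∈ Set.Icc (1 : ℝ) 2,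
      ‖dilatedTransform σ t ξ‖ ≤ NNReal.sqrt (C * (2 ^ (j * k))⁻¹) ∧
      ‖dilatedTransformDeriv σ t ξ‖ ≤ (2 ^ j : ℝ≥0) * NNReal.sqrt (C * (2 ^ (j * k))⁻¹) := by
  have hA : 0 ≤ A := le_trans (by positivity) (h0 0)
  set M := σ.real Set.univ
  set R' := max R 0
  have hR' : 0 ≤ R' := le_max_right _ _
  -- The first two terms bound the piece `j = 0`, where only total mass and boundedness of the
  -- support are available. The last one covers the shells, with room to spare: it absorbs the index
  -- shift and `t ≤ 2`.
  set C : ℝ := M ^ 2 + (2 * Real.pi * (R' * 2) * M) ^ 2 + 64 * A * 2 ^ k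
  have hC : 0 ≤ C := by positivity
  refine ⟨C.toNNReal, fun j ξ hξ t ht => ?_⟩
  have ht0 : 0 < t := lt_of_lt_of_le one_pos ht.1
  have hcoe : ((NNReal.sqrt (C.toNNReal * (2 ^ (j * k))⁻¹) : ℝ≥0) : ℝ) =
      Real.sqrt (C * (2 ^ (j * k))⁻¹) := by
    simp [Real.coe_toNNReal _ hC]
  rw [hcoe]
  -- By homogeneity `t` times the derivative at `(t, ξ)` is the derivative at `(1, t ξ)`, and `t ≥
  -- 1`.
  have hderiv : ‖dilatedTransformDeriv σ t ξ‖ ≤ ‖dilatedTransformDeriv σ 1 (t • ξ)‖ := by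
    rw [← smul_dilatedTransformDeriv, norm_mul, Complex.norm_real, Real.norm_of_nonneg ht0.le]
    exact le_mul_of_one_le_left (norm_nonneg _) ht.1
  cases j with
  | zero =>
    have hξ1 : ‖ξ‖ ≤ 2 := by
      by_contra hcon
      exact hξ (pieceCutoff_eq_zero (by simpa using (not_le.1 hcon).le))
    simp only [zero_mul, pow_zero, inv_one, mul_one, NNReal.coe_one, one_mul]
    constructor
    · refine (norm_dilatedTransform_le σ t ξ).trans (Real.le_sqrt_of_sq_le ?_)
      have : 0 ≤ (2 * Real.pi * (R' * 2) * M) ^ 2 + 64 * A * 2 ^ k := by positivity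
      change M ^ 2 ≤ M ^ 2 + (2 * Real.pi * (R' * 2) * M) ^ 2 + 64 * A * 2 ^ k
      linarith
    · have hR2 : ∀ᵐ y ∂σ, ‖y‖ ≤ R' := hR.mono fun y hy => hy.trans (le_max_left _ _)
      refine (norm_dilatedTransformDeriv_le hR2 t ξ).trans ?_
      refine le_trans ?_ (Real.le_sqrt_of_sq_le (x := 2 * Real.pi * (R' * 2) * M) ?_)
      · have := Real.pi_pos
        change 2 * Real.pi * (R' * ‖ξ‖) * M ≤ _
        gcongr
      · have : 0 ≤ M ^ 2 + 64 * A * 2 ^ k := by positivity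
        change _ ≤ M ^ 2 + (2 * Real.pi * (R' * 2) * M) ^ 2 + 64 * A * 2 ^ k
        linarith
  | succ j =>
    have hlow : 2 ^ j < ‖ξ‖ := by
      by_contra hcon
      exact hξ (pieceCutoff_succ_eq_zero (not_lt.1 hcon))
    have hup : ‖ξ‖ < 2 ^ (j + 2) := by
      by_contra hcon
      exact hξ (pieceCutoff_eq_zero (not_lt.1 hcon))
    have hnt : ‖t • ξ‖ = t * ‖ξ‖ := by rw [norm_smul, Real.norm_of_nonneg ht0.le]
    have hlow' : 2 ^ j ≤ ‖t • ξ‖ := by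
      rw [hnt]
      exact hlow.le.trans (le_mul_of_one_le_left (norm_nonneg _) ht.1)
    have hup' : ‖t • ξ‖ ≤ 2 ^ (j + 3) := by
      rw [hnt, pow_succ, mul_comm]
      gcongr
      exact ht.2
    have hk : ((2 : ℝ) ^ ((j + 1) * k)) = 2 ^ (j * k) * 2 ^ k := by ring
    have hpk : (2 : ℝ) ^ (j * k) ≤ ‖t • ξ‖ ^ k := by
      rw [pow_mul]
      gcongr
    constructor
    · rw [dilatedTransform_eq]
      refine Real.le_sqrt_of_sq_le ?_
      rw [← div_eq_mul_inv, le_div_iff₀ (by positivity), hk]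
      have e1 : ‖dilatedTransform σ 1 (t • ξ)‖ ^ 2 * 2 ^ (j * k) ≤ A :=
        le_trans (by gcongr) (h0 (t • ξ))
      calc ‖dilatedTransform σ 1 (t • ξ)‖ ^ 2 * (2 ^ (j * k) * 2 ^ k)
          = ‖dilatedTransform σ 1 (t • ξ)‖ ^ 2 * 2 ^ (j * k) * 2 ^ k := by ring
        _ ≤ A * 2 ^ k := by gcongr
        _ ≤ C := by
          have : 0 ≤ M ^ 2 + (2 * Real.pi * (R' * 2) * M) ^ 2 + 63 * A * 2 ^ k := by positivity
          change _ ≤ M ^ 2 + (2 * Real.pi * (R' * 2) * M) ^ 2 + 64 * A * 2 ^ k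
          linarith
    · refine hderiv.trans ?_
      have e0 : (((2 : ℝ≥0) ^ (j + 1) : ℝ≥0) : ℝ) * Real.sqrt (C * (2 ^ ((j + 1) * k))⁻¹) =
          Real.sqrt ((2 ^ (j + 1)) ^ 2 * (C * (2 ^ ((j + 1) * k))⁻¹)) := by
        rw [Real.sqrt_mul (x := (2 ^ (j + 1)) ^ 2) (by positivity), Real.sqrt_sq (by positivity)]
        simp
      rw [e0]
      refine Real.le_sqrt_of_sq_le ?_
      rw [← mul_assoc, ← div_eq_mul_inv, le_div_iff₀ (by positivity), hk]
      have e1 : ‖dilatedTransformDeriv σ 1 (t • ξ)‖ ^ 2 * 2 ^ (j * k) ≤ A * (2 ^ (j + 3)) ^ 2 :=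
        le_trans (by gcongr) ((h1 (t • ξ)).trans (by gcongr))
      calc ‖dilatedTransformDeriv σ 1 (t • ξ)‖ ^ 2 * (2 ^ (j * k) * 2 ^ k)
          = ‖dilatedTransformDeriv σ 1 (t • ξ)‖ ^ 2 * 2 ^ (j * k) * 2 ^ k := by ring
        _ ≤ A * (2 ^ (j + 3)) ^ 2 * 2 ^ k := by gcongr
        _ = (2 ^ (j + 1)) ^ 2 * (16 * A * 2 ^ k) := by ring
        _ ≤ (2 ^ (j + 1)) ^ 2 * C := by
          gcongr
          have : 0 ≤ M ^ 2 + (2 * Real.pi * (R' * 2) * M) ^ 2 + 48 * A * 2 ^ k := by positivity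
          change _ ≤ M ^ 2 + (2 * Real.pi * (R' * 2) * M) ^ 2 + 64 * A * 2 ^ k
          linarith

/-- The L² endpoint. In squares, the restriction costs `2^(jD)`, the supremum costs `2^j`, and the
decay of order `(D + 1 + b)/2` gains `2^(j(D+1+b))`; the net gain is `2^(jb)`. -/
theorem exists_lintegral_iSup_dyadicPiece_le (Δ : W →L[ℝ] V) (hΔ : Function.Injective Δ)
    {D b : ℕ} (hD : Module.finrank ℝ W + D = Module.finrank ℝ V)
    {σ : Measure V} [IsFiniteMeasure σ] {R : ℝ}
    (hR : ∀ᵐ y ∂σ, ‖y‖ ≤ R) {A : ℝ}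
    (h0 : ∀ ξ, ‖dilatedTransform σ 1 ξ‖ ^ 2 * ‖ξ‖ ^ (D + 1 + b) ≤ A)
    (h1 : ∀ ξ, ‖dilatedTransformDeriv σ 1 ξ‖ ^ 2 * ‖ξ‖ ^ (D + 1 + b) ≤ A * ‖ξ‖ ^ 2) :
    ∃ C : ℝ≥0, ∀ (g : V → ℂ), Integrable g → MemLp g 2 → ∀ j : ℕ,
      ∫⁻ x, ⨆ t ∈ Set.Icc (1 : ℝ) 2, ‖dyadicPiece Δ σ g j x t‖ₑ ^ 2 ≤
        C * ((2 : ℝ≥0∞) ^ (j * b))⁻¹ * ∫⁻ v, ‖g v‖ₑ ^ 2 := by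
  obtain ⟨C1, hC1⟩ := exists_lintegral_iSup_multiplierRestrict_le Δ hΔ hD
  obtain ⟨C2, hC2⟩ := exists_dilatedTransform_le_on_piece hR h0 h1
  refine ⟨C1 * 2 ^ D * C2 * 4, fun g hg hg2 j => ?_⟩
  have h := hC1 σ R hR (fun ξ => pieceCutoff j ξ * 𝓕 g ξ) (2 ^ (j + 1)) (2 ^ j)
    (NNReal.sqrt (C2 * (2 ^ (j * (D + 1 + b)))⁻¹))
    ((continuous_pieceCutoff j).mul (continuous_fourier hg))
    (fun ξ hξ => by
      have : pieceCutoff j ξ = 0 := pieceCutoff_eq_zero (by exact_mod_cast hξ.le)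
      simp [this])
    (one_le_pow₀ one_le_two)
    (fun ξ hξ t ht => hC2 j ξ (left_ne_zero_of_mul hξ) t ht)
  refine h.trans ?_
  have h2 : ∫⁻ ξ, ‖pieceCutoff j ξ * 𝓕 g ξ‖ₑ ^ 2 ≤ 4 * ∫⁻ v, ‖g v‖ₑ ^ 2 := by
    rw [← lintegral_enorm_fourier_sq hg hg2, ← lintegral_const_mul' _ _ (by norm_num)]
    refine lintegral_mono fun ξ => ?_
    rw [enorm_mul, mul_pow]
    gcongr
    have : ‖pieceCutoff j ξ‖ₑ ≤ 2 := by
      have := enorm_le_coe.2 (show ‖pieceCutoff j ξ‖₊ ≤ 2 from norm_pieceCutoff_le j ξ)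
      simpa using this
    calc ‖pieceCutoff j ξ‖ₑ ^ 2 ≤ 2 ^ 2 := by gcongr
      _ = 4 := by norm_num
  refine (mul_le_mul_right h2 _).trans_eq ?_
  have h3 : ((NNReal.sqrt (C2 * (2 ^ (j * (D + 1 + b)))⁻¹) : ℝ≥0) : ℝ≥0∞) ^ 2 =
      C2 * ((2 : ℝ≥0∞) ^ (j * (D + 1 + b)))⁻¹ := by
    rw [← ENNReal.coe_pow, NNReal.sq_sqrt]
    push_cast
    rfl
  rw [h3]
  have hj : ((2 : ℝ≥0∞) ^ (j * (D + 1))) ≠ 0 := pow_ne_zero _ (by norm_num)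
  have hjt : ((2 : ℝ≥0∞) ^ (j * (D + 1))) ≠ ⊤ := ENNReal.pow_ne_top (by norm_num)
  have h4 : ((2 : ℝ≥0∞) ^ (j * (D + 1 + b)))⁻¹ =
      ((2 : ℝ≥0∞) ^ (j * (D + 1)))⁻¹ * ((2 : ℝ≥0∞) ^ (j * b))⁻¹ := by
    rw [mul_add j (D + 1) b, pow_add, ENNReal.mul_inv (Or.inl hj) (Or.inl hjt)]
  rw [h4]
  push_cast
  calc _ = C1 * 2 ^ D * C2 * 4 * ((2 : ℝ≥0∞) ^ (j * b))⁻¹ *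
        (2 ^ (j * (D + 1)) * ((2 : ℝ≥0∞) ^ (j * (D + 1)))⁻¹) * ∫⁻ v, ‖g v‖ₑ ^ 2 := by ring
    _ = _ := by rw [ENNReal.mul_inv_cancel hj hjt]; ring

end DyadicPieces

/-! ### Interpolation between the endpoints and summation over the pieces -/

section Interpolation

open FourierTransform

variable {V W : Type*} [NormedAddCommGroup V] [InnerProductSpace ℝ V] [FiniteDimensional ℝ V]
  [MeasurableSpace V] [BorelSpace V] [NormedAddCommGroup W] [InnerProductSpace ℝ W]
  [FiniteDimensional ℝ W] [MeasurableSpace W] [BorelSpace W]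

/-- The maximal function of the dyadic piece of order `j`. -/
noncomputable def pieceMaximal (Δ : W →L[ℝ] V) (σ : Measure V) (g : V → ℂ) (j : ℕ) (x : W) : ℝ≥0∞ :=
  ⨆ t ∈ Set.Icc (1 : ℝ) 2, ‖dyadicPiece Δ σ g j x t‖ₑ

theorem continuous_dyadicPiece (Δ : W →L[ℝ] V) (σ : Measure V) [IsFiniteMeasure σ] {g : V → ℂ}
    (hg : Integrable g) (j : ℕ) (t : ℝ) : Continuous fun x => dyadicPiece Δ σ g j x t :=
  (continuous_multiplierRestrict Δ ((continuous_pieceCutoff j).mul (continuous_fourier hg))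
    (hasCompactSupport_pieceCutoff j).mul_right (continuous_dilatedTransform σ)
    (A := fun _ => σ.real Set.univ) continuous_const (norm_dilatedTransform_le σ)).comp
    (by fun_prop : Continuous fun x : W => (x, t))

theorem measurable_pieceMaximal (Δ : W →L[ℝ] V) (σ : Measure V) [IsFiniteMeasure σ] {g : V → ℂ}
    (hg : Integrable g) (j : ℕ) : Measurable (pieceMaximal Δ σ g j) :=
  (lowerSemicontinuous_biSup fun t _ =>
    ((continuous_dyadicPiece Δ σ hg j t).enorm).lowerSemicontinuous).measurable

theorem pieceMaximal_add_le (Δ : W →L[ℝ] V) (σ : Measure V) [IsFiniteMeasure σ] {g₁ g₂ : V → ℂ}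
    (hg₁ : Integrable g₁) (hg₂ : Integrable g₂) (j : ℕ) (x : W) :
    pieceMaximal Δ σ (fun v => g₁ v + g₂ v) j x ≤
      pieceMaximal Δ σ g₁ j x + pieceMaximal Δ σ g₂ j x := by
  refine iSup₂_le fun t ht => ?_
  rw [dyadicPiece_add Δ σ hg₁ hg₂]
  exact (enorm_add_le _ _).trans (add_le_add
    (le_iSup₂ (f := fun t (_ : t ∈ Set.Icc (1 : ℝ) 2) => ‖dyadicPiece Δ σ g₁ j x t‖ₑ) t ht)
    (le_iSup₂ (f := fun t (_ : t ∈ Set.Icc (1 : ℝ) 2) => ‖dyadicPiece Δ σ g₂ j x t‖ₑ) t ht))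

/-- For each fixed `t` the partial sums converge to the average, and each is dominated by the series
of maximal functions; no uniformity in `t` is required. -/
theorem iSup_enorm_integral_le_tsum_pieceMaximal (Δ : W →L[ℝ] V) (σ : Measure V)
    [IsFiniteMeasure σ] {g : V → ℂ} (hg : Continuous g) (hgc : HasCompactSupport g) (x : W) :
    ⨆ t ∈ Set.Ioo (1 : ℝ) 2, ‖∫ y, g (Δ x - t • y) ∂σ‖ₑ ≤ ∑' j, pieceMaximal Δ σ g j x := by
  refine iSup₂_le fun t ht => ?_
  have hgi : Integrable g := hg.integrable_of_hasCompactSupport hgc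
  obtain ⟨M, hM⟩ := hg.bounded_above_of_compact_support hgc
  have hlim := tendsto_multiplierRestrict_freqCutoff Δ hg hgi hM σ t x
  refine le_of_tendsto hlim.enorm (Filter.Eventually.of_forall fun J => ?_)
  rw [← sum_dyadicPiece Δ σ hgi]
  refine (enorm_sum_le _ _).trans (le_trans (Finset.sum_le_sum fun j _ => ?_)
    (ENNReal.sum_le_tsum (Finset.range (J + 1))))
  exact le_iSup₂ (f := fun t (_ : t ∈ Set.Icc (1 : ℝ) 2) => ‖dyadicPiece Δ σ g j x t‖ₑ) t
    (Set.Ioo_subset_Icc_self ht)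

theorem ENNReal.le_rpow_half_of_sq_le {a c : ℝ≥0∞} (h : a ^ 2 ≤ c) : a ≤ c ^ (1 / 2 : ℝ) := by
  calc a = (a ^ 2) ^ (1 / 2 : ℝ) := by
        rw [← ENNReal.rpow_natCast, ← ENNReal.rpow_mul]
        norm_num
    _ ≤ c ^ (1 / 2 : ℝ) := by gcongr

theorem sq_pieceMaximal_le (Δ : W →L[ℝ] V) (σ : Measure V) (g : V → ℂ) (j : ℕ) (x : W) :
    pieceMaximal Δ σ g j x ^ 2 ≤
      ⨆ t ∈ Set.Icc (1 : ℝ) 2, ‖dyadicPiece Δ σ g j x t‖ₑ ^ 2 := by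
  have h : pieceMaximal Δ σ g j x ≤
      (⨆ t ∈ Set.Icc (1 : ℝ) 2, ‖dyadicPiece Δ σ g j x t‖ₑ ^ 2) ^ (1 / 2 : ℝ) := by
    refine iSup₂_le fun t ht => ENNReal.le_rpow_half_of_sq_le ?_
    exact le_iSup₂ (f := fun t (_ : t ∈ Set.Icc (1 : ℝ) 2) => ‖dyadicPiece Δ σ g j x t‖ₑ ^ 2) t ht
  calc pieceMaximal Δ σ g j x ^ 2 ≤ (_ ^ (1 / 2 : ℝ)) ^ 2 := by gcongr
    _ = _ := by
      rw [← ENNReal.rpow_natCast, ← ENNReal.rpow_mul]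
      norm_num

/-- The splitting of a function at the height `s`, with bounds by a power of the function. -/
theorem enorm_min_sq_le {a s p : ℝ} (ha : 0 ≤ a) (hs : 0 < s) (hp0 : 0 < p) (hp : p < 2) :
    ‖min a s‖ₑ ^ 2 ≤ ENNReal.ofReal (s ^ (2 - p)) * ‖a‖ₑ ^ p := by
  rw [Real.enorm_of_nonneg (le_min ha hs.le), Real.enorm_of_nonneg ha,
    ENNReal.ofReal_rpow_of_nonneg ha hp0.le, ← ENNReal.ofReal_mul (by positivity),
    ← ENNReal.ofReal_pow (le_min ha hs.le)]
  refine ENNReal.ofReal_le_ofReal ?_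
  rcases ha.eq_or_lt with rfl | ha'
  · rw [min_eq_left hs.le]
    simp [Real.zero_rpow hp0.ne']
  have hm : 0 < min a s := lt_min ha' hs
  calc min a s ^ 2 = min a s ^ (2 - p) * min a s ^ p := by
        rw [← Real.rpow_add hm, ← Real.rpow_natCast]; norm_num
    _ ≤ s ^ (2 - p) * a ^ p := by
        refine mul_le_mul (Real.rpow_le_rpow hm.le (min_le_right _ _) (by linarith))
          (Real.rpow_le_rpow hm.le (min_le_left _ _) hp0.le) (by positivity) (by positivity)

theorem enorm_max_sub_le {a s p : ℝ} (ha : 0 ≤ a) (hs : 0 < s) (hp : 1 < p) :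
    ‖max (a - s) 0‖ₑ ≤ ENNReal.ofReal (s ^ (1 - p)) * ‖a‖ₑ ^ p := by
  rw [Real.enorm_of_nonneg (le_max_right _ _), Real.enorm_of_nonneg ha,
    ENNReal.ofReal_rpow_of_nonneg ha (by linarith), ← ENNReal.ofReal_mul (by positivity)]
  refine ENNReal.ofReal_le_ofReal (max_le ?_ (by positivity))
  rcases le_or_gt a s with h | h
  · have : 0 ≤ s ^ (1 - p) * a ^ p := by positivity
    linarith
  · have ha' : 0 < a := hs.trans h
    calc a - s ≤ a := by linarith
      _ = a ^ (1 - p) * a ^ p := by rw [← Real.rpow_add ha']; norm_num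
      _ ≤ s ^ (1 - p) * a ^ p := by
        gcongr ?_ * _
        exact Real.rpow_le_rpow_of_nonpos hs h.le (by linarith)

theorem ENNReal.tsum_ofReal_pow_lt_top {r : ℝ} (h0 : 0 ≤ r) (h1 : r < 1) :
    ∑' j : ℕ, ENNReal.ofReal (r ^ j) < ⊤ := by
  simp_rw [ENNReal.ofReal_pow h0]
  rw [ENNReal.tsum_geometric]
  refine ENNReal.inv_lt_top.2 (tsub_pos_of_lt ?_)
  simpa using h1

/-- The local maximal estimate for averages over a measure whose Fourier transform decays fast
enough, for continuous functions. -/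
theorem exists_lintegral_maximal_le_of_continuous (Δ : W →L[ℝ] V) (hΔ : Function.Injective Δ)
    {D b : ℕ} (hD : Module.finrank ℝ W + D = Module.finrank ℝ V) (hV : 1 ≤ Module.finrank ℝ V)
    {σ : Measure V} [IsFiniteMeasure σ] {R : ℝ} (hR : ∀ᵐ y ∂σ, ‖y‖ ≤ R) {B : ℝ≥0}
    (hσ : ∀ (u : V) (r : ℝ), 0 < r →
      σ (Metric.ball u r) ≤ B * ENNReal.ofReal r ^ (Module.finrank ℝ V - 1)) {A : ℝ}
    (h0 : ∀ ξ, ‖dilatedTransform σ 1 ξ‖ ^ 2 * ‖ξ‖ ^ (D + 1 + b) ≤ A)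
    (h1 : ∀ ξ, ‖dilatedTransformDeriv σ 1 ξ‖ ^ 2 * ‖ξ‖ ^ (D + 1 + b) ≤ A * ‖ξ‖ ^ 2)
    {p : ℝ} (hp1 : 1 < p) (hp2 : p < 2) (hpb : 1 < (b + 1) * (p - 1)) :
    ∃ C : ℝ≥0, ∀ g : V → ℝ, Continuous g → HasCompactSupport g → (∀ v, 0 ≤ g v) → ∀ z : W,
      ∫⁻ x in Metric.ball z 1, ⨆ t ∈ Set.Ioo (1 : ℝ) 2, ‖∫ y, g (Δ x - t • y) ∂σ‖ₑ ≤
        C * (∫⁻ v, ‖g v‖ₑ ^ p) ^ (1 / p) := by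
  obtain ⟨C1, hC1⟩ := exists_enorm_dyadicPiece_le Δ hV hσ
  obtain ⟨C2, hC2⟩ := exists_lintegral_iSup_dyadicPiece_le Δ hΔ hD hR h0 h1
  have hp0 : 0 < p := by linarith
  -- `1 < α(p-1)` makes the high part summable over `j`, and `α(2-p) < b` the low part. Such an `α`
  -- exists exactly when `(2-p) < b(p-1)`, which is `hpb`.
  obtain ⟨α, hα1, hα2⟩ : ∃ α : ℝ, 1 < α * (p - 1) ∧ α * (2 - p) < b := by
    have h : 1 / (p - 1) < b / (2 - p) := by
      rw [div_lt_div_iff₀ (by linarith) (by linarith)]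
      linarith
    obtain ⟨α, h1, h2⟩ := exists_between h
    exact ⟨α, by rwa [div_lt_iff₀ (by linarith)] at h1, by rwa [lt_div_iff₀ (by linarith)] at h2⟩
  set r1 : ℝ := 2 ^ (1 - α * (p - 1)) with hr1
  set r2 : ℝ := 2 ^ ((α * (2 - p) - b) / 2) with hr2
  have hr1p : 0 < r1 := by positivity
  have hr2p : 0 < r2 := by positivity
  have hr1l : r1 < 1 := Real.rpow_lt_one_of_one_lt_of_neg one_lt_two (by linarith)
  have hr2l : r2 < 1 := Real.rpow_lt_one_of_one_lt_of_neg one_lt_two (by linarith)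
  set v := volume (Metric.ball (0 : W) 1)
  have hv : v < ⊤ := measure_ball_lt_top
  set S1 := ∑' j : ℕ, ENNReal.ofReal (r1 ^ j)
  set S2 := ∑' j : ℕ, ENNReal.ofReal (r2 ^ j)
  have hS1 : S1 < ⊤ := ENNReal.tsum_ofReal_pow_lt_top hr1p.le hr1l
  have hS2 : S2 < ⊤ := ENNReal.tsum_ofReal_pow_lt_top hr2p.le hr2l
  set K := v * C1 * S1 + (v * C2) ^ (1 / 2 : ℝ) * S2
  have hK : K < ⊤ := by
    refine ENNReal.add_lt_top.2 ⟨ENNReal.mul_lt_top (ENNReal.mul_lt_top hv (by simp)) hS1,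
      ENNReal.mul_lt_top (ENNReal.rpow_lt_top_of_nonneg (by norm_num)
        (ENNReal.mul_lt_top hv (by simp)).ne) hS2⟩
  refine ⟨K.toNNReal, fun g hg hgc hg0 z => ?_⟩
  rw [ENNReal.coe_toNNReal hK.ne]
  set I := ∫⁻ v, ‖g v‖ₑ ^ p with hI
  have hIfin : I < ⊤ := by
    have := (eLpNorm_lt_top_iff_lintegral_rpow_enorm_lt_top
      (p := ENNReal.ofReal p) (by simpa using hp0) (by simp)).1
      (hg.memLp_of_hasCompactSupport (μ := volume) hgc).2
    rwa [ENNReal.toReal_ofReal hp0.le] at this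
  -- A vanishing norm would make the splitting height zero; in that case `g` itself vanishes.
  by_cases hI0 : I = 0
  · have hgz : g = 0 := by
      have h1 : (fun v => ‖g v‖ₑ ^ p) =ᵐ[volume] 0 := by
        rw [hI, lintegral_eq_zero_iff (by fun_prop)] at hI0
        exact hI0
      refine Continuous.ae_eq_iff_eq volume hg continuous_zero |>.1 ?_
      filter_upwards [h1] with v hv
      simpa [hp0, hp0.not_gt] using hv
    simp [hgz]
  set P : ℝ := I.toReal ^ (1 / p) with hP
  have hIr : 0 < I.toReal := ENNReal.toReal_pos hI0 hIfin.ne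
  have hPpos : 0 < P := by positivity
  have hPp : P ^ p = I.toReal := by
    rw [hP, ← Real.rpow_mul hIr.le, one_div, inv_mul_cancel₀ hp0.ne', Real.rpow_one]
  have hIP : I = ENNReal.ofReal (P ^ p) := by rw [hPp, ENNReal.ofReal_toReal hIfin.ne]
  have hIpow : I ^ (1 / p) = ENNReal.ofReal P := by
    rw [hP, ← ENNReal.ofReal_rpow_of_pos hIr, ENNReal.ofReal_toReal hIfin.ne]
  clear_value P
  set gc : V → ℂ := fun v => (g v : ℂ) with hgc_def
  have hgcc : Continuous gc := Complex.continuous_ofReal.comp hg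
  have hgccs : HasCompactSupport gc := hgc.comp_left (g := fun t : ℝ => (t : ℂ)) (by simp)
  have hpiece : ∀ j : ℕ, ∫⁻ x in Metric.ball z 1, pieceMaximal Δ σ gc j x ≤
      v * C1 * ENNReal.ofReal P * ENNReal.ofReal (r1 ^ j) +
        (v * C2) ^ (1 / 2 : ℝ) * ENNReal.ofReal P * ENNReal.ofReal (r2 ^ j) := by
    intro j
    -- The height grows with `j`. The truncations `min g s` and `max (g - s) 0` keep continuity and
    -- compact support, unlike cutting with an indicator function.
    set s : ℝ := 2 ^ (j * α) * P with hs
    have hspos : 0 < s := by positivity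
    set g1 : V → ℂ := fun v => ((min (g v) s : ℝ) : ℂ) with hg1
    set g2 : V → ℂ := fun v => ((max (g v - s) 0 : ℝ) : ℂ) with hg2
    have hg1c : Continuous g1 := by fun_prop
    have hg2c : Continuous g2 := by fun_prop
    have hg1s : HasCompactSupport g1 := hgc.comp_left (g := fun t : ℝ => ((min t s : ℝ) : ℂ))
      (by simp [hspos.le])
    have hg2s : HasCompactSupport g2 := hgc.comp_left (g := fun t : ℝ => ((max (t - s) 0 : ℝ) : ℂ))
      (by simp [hspos.le])
    have hg1i : Integrable g1 := hg1c.integrable_of_hasCompactSupport hg1s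
    have hg2i : Integrable g2 := hg2c.integrable_of_hasCompactSupport hg2s
    have hsum : gc = fun v => g1 v + g2 v := by
      ext v
      simp only [hgc_def, hg1, hg2, ← Complex.ofReal_add]
      congr 1
      rcases le_total (g v) s with h | h
      · rw [min_eq_left h, max_eq_right (by linarith), add_zero]
      · rw [min_eq_right h, max_eq_left (by linarith)]; ring
    have hint2 : ∫⁻ v, ‖g2 v‖ₑ ≤ ENNReal.ofReal (s ^ (1 - p)) * ENNReal.ofReal (P ^ p) := by
      rw [← hIP, hI, ← lintegral_const_mul' _ _ (by simp)]
      refine lintegral_mono fun v => ?_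
      simpa [hg2, ← ofReal_norm] using enorm_max_sub_le (hg0 v) hspos hp1
    have hint1 : ∫⁻ v, ‖g1 v‖ₑ ^ 2 ≤ ENNReal.ofReal (s ^ (2 - p)) * ENNReal.ofReal (P ^ p) := by
      rw [← hIP, hI, ← lintegral_const_mul' _ _ (by simp)]
      refine lintegral_mono fun v => ?_
      simpa [hg1, ← ofReal_norm] using enorm_min_sq_le (hg0 v) hspos hp0 hp2
    have hball : volume (Metric.ball z 1) = v := Measure.addHaar_ball_center _ _ _
    -- The high part uses the L¹ to L^∞ bound: `2^j s^(1-p) P^p = P r1^j`.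
    have hb2 : ∫⁻ x in Metric.ball z 1, pieceMaximal Δ σ g2 j x ≤
        v * C1 * ENNReal.ofReal P * ENNReal.ofReal (r1 ^ j) := by
      calc ∫⁻ x in Metric.ball z 1, pieceMaximal Δ σ g2 j x
          ≤ ∫⁻ x in Metric.ball z 1, (C1 * 2 ^ j * (ENNReal.ofReal (s ^ (1 - p)) *
            ENNReal.ofReal (P ^ p))) := by
            refine lintegral_mono fun x => iSup₂_le fun t ht => ?_
            exact (hC1 g2 hg2i j x t ht.1).trans (by gcongr)
        _ = v * C1 * (2 ^ j * (ENNReal.ofReal (s ^ (1 - p)) * ENNReal.ofReal (P ^ p))) := by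
            rw [setLIntegral_const, hball]; ring
        _ = v * C1 * (ENNReal.ofReal P * ENNReal.ofReal (r1 ^ j)) := by
            congr 1
            have : (2 : ℝ≥0∞) ^ j = ENNReal.ofReal (2 ^ j) := by
              rw [ENNReal.ofReal_pow (by norm_num)]; simp
            rw [this, ← ENNReal.ofReal_mul (by positivity), ← ENNReal.ofReal_mul (by positivity),
              ← ENNReal.ofReal_mul (by positivity)]
            congr 1
            rw [hs, Real.mul_rpow (by positivity) hPpos.le, hr1, ← Real.rpow_natCast,
              ← Real.rpow_natCast, ← Real.rpow_mul (by norm_num), ← Real.rpow_mul (by norm_num)]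
            have e1 : P = P ^ (1 - p) * P ^ p := by rw [← Real.rpow_add hPpos]; norm_num
            have e2 : (2 : ℝ) ^ ((1 - α * (p - 1)) * j) = 2 ^ (j : ℝ) * 2 ^ (j * α * (1 - p)) := by
              rw [← Real.rpow_add (by norm_num)]; congr 1; ring
            rw [e2]
            conv_rhs => rw [e1]
            ring
        _ = _ := by ring
    have hb1 : ∫⁻ x in Metric.ball z 1, pieceMaximal Δ σ g1 j x ≤
        (v * C2) ^ (1 / 2 : ℝ) * ENNReal.ofReal P * ENNReal.ofReal (r2 ^ j) := by
      -- The low part uses L², reduced to L¹ on the ball by Cauchy–Schwarz: `2^(-jb) s^(2-p) P^p =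
      -- (P r2^j)²`.
      have h2 : (∫⁻ x in Metric.ball z 1, pieceMaximal Δ σ g1 j x) ^ 2 ≤
          v * C2 * ENNReal.ofReal ((P * r2 ^ j) ^ 2) := by
        calc (∫⁻ x in Metric.ball z 1, pieceMaximal Δ σ g1 j x) ^ 2
            ≤ v * ∫⁻ x in Metric.ball z 1, pieceMaximal Δ σ g1 j x ^ 2 := by
              have := sq_lintegral_le (volume.restrict (Metric.ball z 1))
                (measurable_pieceMaximal Δ σ hg1i j).aemeasurable
              simpa [hball] using this
          _ ≤ v * ∫⁻ x, ⨆ t ∈ Set.Icc (1 : ℝ) 2, ‖dyadicPiece Δ σ g1 j x t‖ₑ ^ 2 := by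
              refine mul_le_mul_right ?_ _
              exact (setLIntegral_le_lintegral _ _).trans
                (lintegral_mono fun x => sq_pieceMaximal_le Δ σ g1 j x)
          _ ≤ v * (C2 * ((2 : ℝ≥0∞) ^ (j * b))⁻¹ * (ENNReal.ofReal (s ^ (2 - p)) *
              ENNReal.ofReal (P ^ p))) := by
              gcongr
              exact (hC2 g1 hg1i (hg1c.memLp_of_hasCompactSupport hg1s) j).trans
                (by gcongr)
          _ = v * C2 * (((2 : ℝ≥0∞) ^ (j * b))⁻¹ * (ENNReal.ofReal (s ^ (2 - p)) *
              ENNReal.ofReal (P ^ p))) := by ring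
          _ = _ := by
              congr 1
              have : ((2 : ℝ≥0∞) ^ (j * b))⁻¹ = ENNReal.ofReal ((2 ^ (j * b))⁻¹) := by
                rw [ENNReal.ofReal_inv_of_pos (by positivity), ENNReal.ofReal_pow (by norm_num)]
                simp
              rw [this, ← ENNReal.ofReal_mul (by positivity), ← ENNReal.ofReal_mul (by positivity)]
              congr 1
              rw [hs, Real.mul_rpow (by positivity) hPpos.le, hr2, mul_pow, ← pow_mul,
                ← Real.rpow_natCast 2 (j * b), ← Real.rpow_neg (by norm_num),
                ← Real.rpow_mul_natCast (by norm_num), ← Real.rpow_mul (by norm_num)]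
              have e1 : P ^ 2 = P ^ (2 - p) * P ^ p := by
                rw [← Real.rpow_add hPpos, ← Real.rpow_natCast]; norm_num
              have e2 : (2 : ℝ) ^ ((α * (2 - p) - b) / 2 * ((j * 2 : ℕ) : ℝ)) =
                  2 ^ (-((j * b : ℕ) : ℝ)) * 2 ^ (j * α * (2 - p)) := by
                rw [← Real.rpow_add (by norm_num)]; congr 1; push_cast; ring
              rw [e1, e2]
              ring
      refine (ENNReal.le_rpow_half_of_sq_le h2).trans_eq ?_
      rw [ENNReal.mul_rpow_of_nonneg _ _ (by norm_num), mul_assoc,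
        ← ENNReal.ofReal_mul hPpos.le, ENNReal.ofReal_rpow_of_nonneg (by positivity) (by norm_num),
        ← Real.sqrt_eq_rpow, Real.sqrt_sq (by positivity)]
    calc ∫⁻ x in Metric.ball z 1, pieceMaximal Δ σ gc j x
        ≤ ∫⁻ x in Metric.ball z 1, (pieceMaximal Δ σ g2 j x + pieceMaximal Δ σ g1 j x) := by
          refine lintegral_mono fun x => ?_
          rw [hsum, add_comm]
          exact pieceMaximal_add_le Δ σ hg1i hg2i j x
      _ = (∫⁻ x in Metric.ball z 1, pieceMaximal Δ σ g2 j x) +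
          ∫⁻ x in Metric.ball z 1, pieceMaximal Δ σ g1 j x :=
          lintegral_add_left (measurable_pieceMaximal Δ σ hg2i j) _
      _ ≤ _ := add_le_add hb2 hb1
  calc ∫⁻ x in Metric.ball z 1, ⨆ t ∈ Set.Ioo (1 : ℝ) 2, ‖∫ y, g (Δ x - t • y) ∂σ‖ₑ
      ≤ ∫⁻ x in Metric.ball z 1, ∑' j, pieceMaximal Δ σ gc j x := by
        refine lintegral_mono fun x => ?_
        refine le_trans (le_of_eq ?_)
          (iSup_enorm_integral_le_tsum_pieceMaximal Δ σ hgcc hgccs x)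
        congr 1; ext t; congr 1; ext ht
        rw [hgc_def, integral_complex_ofReal, ← ofReal_norm, ← ofReal_norm, Complex.norm_real]
    _ = ∑' j, ∫⁻ x in Metric.ball z 1, pieceMaximal Δ σ gc j x :=
        lintegral_tsum fun j => (measurable_pieceMaximal Δ σ
          (hgcc.integrable_of_hasCompactSupport hgccs) j).aemeasurable
    _ ≤ ∑' j : ℕ, (v * C1 * ENNReal.ofReal P * ENNReal.ofReal (r1 ^ j) +
        (v * C2) ^ (1 / 2 : ℝ) * ENNReal.ofReal P * ENNReal.ofReal (r2 ^ j)) :=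
        ENNReal.tsum_le_tsum hpiece
    _ = K * I ^ (1 / p) := by
        rw [ENNReal.tsum_add, ENNReal.tsum_mul_left, ENNReal.tsum_mul_left, hIpow]
        change v * C1 * ENNReal.ofReal P * S1 + (v * C2) ^ (1 / 2 : ℝ) * ENNReal.ofReal P * S2 =
          (v * C1 * S1 + (v * C2) ^ (1 / 2 : ℝ) * S2) * _
        ring

end Interpolation

/-! ### From continuous functions to measurable ones -/

section Extension

open Filter Topology

variable {V W : Type*} [NormedAddCommGroup V] [InnerProductSpace ℝ V] [FiniteDimensional ℝ V]
  [MeasurableSpace V] [BorelSpace V] [NormedAddCommGroup W] [InnerProductSpace ℝ W]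
  [FiniteDimensional ℝ W] [MeasurableSpace W] [BorelSpace W]

/-- The truncation `min F n` is regularized by infimal convolution with `n · dist`, which gives a
Lipschitz function below it, and then multiplied by a cutoff to a ball of radius `n`. Everything
increases with `n`. -/
theorem exists_seq_continuous_of_lowerSemicontinuous {F : V → ℝ≥0∞} (hF : LowerSemicontinuous F) :
    ∃ g : ℕ → V → ℝ, (∀ n, Continuous (g n)) ∧ (∀ n, HasCompactSupport (g n)) ∧
      (∀ n v, 0 ≤ g n v) ∧ Monotone g ∧ ∀ v, ⨆ n, ENNReal.ofReal (g n v) = F v := by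
  set h : ℕ → V → ℝ := fun n v => ⨅ y, ((min (F y) n).toReal + n * dist v y) with hh
  set χ : ℕ → V → ℝ := fun n v => max 0 (min 1 (n - ‖v‖)) with hχ
  have hbdd (n : ℕ) (v : V) :
      BddBelow (Set.range fun y => ((min (F y) (n : ℝ≥0∞)).toReal + n * dist v y)) :=
    ⟨0, by rintro _ ⟨y, rfl⟩; positivity⟩
  have hfin (n : ℕ) (y : V) : min (F y) (n : ℝ≥0∞) ≠ ⊤ :=
    ne_top_of_le_ne_top (ENNReal.natCast_ne_top n) (min_le_right _ _)
  have h0 (n : ℕ) (v : V) : 0 ≤ h n v := le_ciInf fun y => by positivity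
  have hχ0 (n : ℕ) (v : V) : 0 ≤ χ n v := le_max_left _ _
  have hχ1 (n : ℕ) (v : V) : χ n v ≤ 1 := max_le zero_le_one (min_le_left _ _)
  have hle (n : ℕ) (v : V) : h n v ≤ (min (F v) n).toReal :=
    (ciInf_le (hbdd n v) v).trans (by simp)
  have hlip (n : ℕ) : Continuous (h n) := by
    refine (LipschitzWith.of_le_add_mul (n : ℝ≥0) fun x y => ?_).continuous
    rw [← sub_le_iff_le_add]
    refine le_ciInf fun w => ?_
    rw [sub_le_iff_le_add]
    refine (ciInf_le (hbdd n x) w).trans ?_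
    have := dist_triangle x y w
    have h2 : (n : ℝ) * dist x w ≤ n * (dist x y + dist y w) := by gcongr
    simp only [NNReal.coe_natCast]
    linarith
  have hχc (n : ℕ) : Continuous (χ n) := by fun_prop
  refine ⟨fun n v => h n v * χ n v, fun n => (hlip n).mul (hχc n), fun n => ?_,
    fun n v => mul_nonneg (h0 n v) (hχ0 n v), fun a b hab v => ?_, fun v => le_antisymm ?_ ?_⟩
  · refine HasCompactSupport.of_support_subset_isCompact (isCompact_closedBall 0 n) ?_
    intro v hv
    rw [mem_closedBall_zero_iff]
    by_contra! hc
    apply hv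
    have : χ n v = 0 := max_eq_left ((min_le_right _ _).trans (by linarith))
    simp [this]
  · have hab' : (a : ℝ) ≤ b := by exact_mod_cast hab
    refine mul_le_mul ?_ ?_ (hχ0 _ _) (h0 _ _)
    · refine ciInf_mono (hbdd a v) fun y => add_le_add ?_ (by gcongr)
      exact ENNReal.toReal_mono (hfin b y) (min_le_min le_rfl (by exact_mod_cast hab))
    · exact max_le_max le_rfl (min_le_min le_rfl (by linarith))
  · refine iSup_le fun n => ?_
    calc ENNReal.ofReal (h n v * χ n v) ≤ ENNReal.ofReal ((min (F v) n).toReal) :=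
          ENNReal.ofReal_le_ofReal ((mul_le_of_le_one_right (h0 _ _) (hχ1 _ _)).trans (hle n v))
      _ = min (F v) n := ENNReal.ofReal_toReal (hfin n v)
      _ ≤ F v := min_le_left _ _
  · refine le_of_forall_lt_imp_le_of_dense fun c hc => ?_
    have hc' : c ≠ ⊤ := hc.ne_top
    obtain ⟨δ, hδ, hball⟩ := Metric.eventually_nhds_iff_ball.1 (hF v c hc)
    -- Three demands on `n`: the truncation level exceeds `c`, the penalty `n δ` makes points
    -- outside the `δ`-ball irrelevant, and the cutoff equals `1` at `v`.
    obtain ⟨n, hn⟩ := exists_nat_ge (max c.toReal (max (c.toReal / δ) (‖v‖ + 1)))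
    have hn1 : c.toReal ≤ n := (le_max_left _ _).trans hn
    have hn2 : c.toReal / δ ≤ n := ((le_max_left _ _).trans (le_max_right _ _)).trans hn
    have hn3 : ‖v‖ + 1 ≤ n := ((le_max_right _ _).trans (le_max_right _ _)).trans hn
    rw [div_le_iff₀ hδ] at hn2
    refine le_iSup_of_le n ?_
    have hχe : χ n v = 1 := by
      simp only [hχ]
      rw [min_eq_left (by linarith), max_eq_right zero_le_one]
    beta_reduce
    rw [hχe, mul_one]
    refine (ENNReal.le_ofReal_iff_toReal_le hc' (h0 n v)).2 (le_ciInf fun y => ?_)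
    rcases lt_or_ge (dist v y) δ with hd | hd
    · have : c ≤ min (F y) n := le_min (hball y (by rwa [Metric.mem_ball, dist_comm])).le (by
        rw [← ENNReal.ofReal_toReal hc', ← ENNReal.ofReal_natCast]
        exact ENNReal.ofReal_le_ofReal hn1)
      have := ENNReal.toReal_mono (hfin n y) this
      have h3 : 0 ≤ (n : ℝ) * dist v y := by positivity
      linarith
    · have h3 : (n : ℝ) * δ ≤ n * dist v y := by gcongr
      have : 0 ≤ (min (F y) n).toReal := ENNReal.toReal_nonneg
      linarith

/-- The maximal function of the averages of a nonnegative function over the sets `Δ x - t • y`. -/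
noncomputable def posMaximal (Δ : W →L[ℝ] V) (σ : Measure V) (F : V → ℝ≥0∞) (x : W) : ℝ≥0∞ :=
  ⨆ t ∈ Set.Ioo (1 : ℝ) 2, ∫⁻ y, F (Δ x - t • y) ∂σ

/-- The maximal function of the averages of a function over the sets `Δ x - t • y`. -/
noncomputable def restrictMaximal {K : Type*} [NormedAddCommGroup K] [NormedSpace ℝ K]
    (Δ : W →L[ℝ] V) (σ : Measure V) (F : V → K) (x : W) : ℝ≥0∞ :=
  ⨆ t ∈ Set.Ioo (1 : ℝ) 2, ‖∫ y, F (Δ x - t • y) ∂σ‖ₑ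

/-- The local `L^r` bound for continuous functions with compact support. -/
def HasMaximalBound (Δ : W →L[ℝ] V) (σ : Measure V) (r : ℝ) (C : ℝ≥0) : Prop :=
  ∀ g : V → ℝ, Continuous g → HasCompactSupport g → (∀ v, 0 ≤ g v) → ∀ z : W,
    ∫⁻ x in Metric.ball z 1, restrictMaximal Δ σ g x ≤ C * (∫⁻ v, ‖g v‖ₑ ^ r) ^ (1 / r)

variable {Δ : W →L[ℝ] V} {σ : Measure V} [IsFiniteMeasure σ] {r : ℝ} {C : ℝ≥0}

theorem posMaximal_mono {F G : V → ℝ≥0∞} (h : ∀ v, F v ≤ G v) (x : W) :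
    posMaximal Δ σ F x ≤ posMaximal Δ σ G x :=
  iSup₂_mono fun _ _ => lintegral_mono fun _ => h _

theorem integrable_comp_of_hasCompactSupport {K : Type*} [NormedAddCommGroup K] {g : V → K}
    (hg : Continuous g) (hgs : HasCompactSupport g) (u : V) (t : ℝ) :
    Integrable (fun y => g (u - t • y)) σ := by
  obtain ⟨M, hM⟩ := hgs.exists_bound_of_continuous hg
  exact (integrable_const M).mono' (by fun_prop : Continuous _).aestronglyMeasurable
    (.of_forall fun y => hM _)

theorem measurable_restrictMaximal {K : Type*} [NormedAddCommGroup K] [NormedSpace ℝ K] {g : V → K}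
    (hg : Continuous g) (hgs : HasCompactSupport g) : Measurable (restrictMaximal Δ σ g) := by
  obtain ⟨M, hM⟩ := hgs.exists_bound_of_continuous hg
  refine LowerSemicontinuous.measurable ?_
  refine lowerSemicontinuous_biSup fun t _ => Continuous.lowerSemicontinuous ?_
  refine Continuous.enorm ?_
  exact continuous_of_dominated (fun x => (by fun_prop : Continuous _).aestronglyMeasurable)
    (fun x => .of_forall fun y => hM _) (integrable_const M) (.of_forall fun y => by fun_prop)

theorem posMaximal_ofReal {g : V → ℝ} (hg : Continuous g) (hgs : HasCompactSupport g)
    (hg0 : ∀ v, 0 ≤ g v) (x : W) :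
    posMaximal Δ σ (fun v => ENNReal.ofReal (g v)) x = restrictMaximal Δ σ g x := by
  refine iSup_congr fun t => iSup_congr fun _ => ?_
  rw [← ofReal_integral_eq_lintegral_ofReal (integrable_comp_of_hasCompactSupport hg hgs _ _)
    (.of_forall fun y => hg0 _), Real.enorm_of_nonneg (integral_nonneg fun y => hg0 _)]

/-- For an increasing sequence of continuous functions the supremum over `n` commutes with that over
`t` and, by monotone convergence, with the integral. Hence the maximal function is a countable
supremum of measurable ones. -/
theorem measurable_posMaximal_and_lintegral_le (hC : HasMaximalBound Δ σ r C) (hr : 0 < r)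
    {F : V → ℝ≥0∞} (hF : LowerSemicontinuous F) :
    Measurable (posMaximal Δ σ F) ∧ ∀ z : W, ∫⁻ x in Metric.ball z 1, posMaximal Δ σ F x ≤
      C * (∫⁻ v, F v ^ r) ^ (1 / r) := by
  obtain ⟨g, hgc, hgs, hg0, hgm, hgF⟩ := exists_seq_continuous_of_lowerSemicontinuous hF
  have key : posMaximal Δ σ F = fun x => ⨆ n, restrictMaximal Δ σ (g n) x := by
    ext x
    simp_rw [← posMaximal_ofReal (hgc _) (hgs _) (hg0 _), posMaximal]
    rw [iSup_comm]
    refine iSup_congr fun t => ?_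
    rw [iSup_comm]
    refine iSup_congr fun ht => ?_
    rw [← lintegral_iSup]
    · simp_rw [hgF]
    · intro n
      exact (ENNReal.continuous_ofReal.comp ((hgc n).comp (by fun_prop))).measurable
    · exact fun a b hab y => ENNReal.ofReal_le_ofReal (hgm hab _)
  have hmeas (n) : Measurable (restrictMaximal Δ σ (g n)) := measurable_restrictMaximal (hgc n) (hgs n)
  refine ⟨key ▸ Measurable.iSup hmeas, fun z => ?_⟩
  rw [key, lintegral_iSup hmeas]
  · refine iSup_le fun n => (hC (g n) (hgc n) (hgs n) (hg0 n) z).trans ?_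
    refine mul_le_mul_right (ENNReal.rpow_le_rpow (lintegral_mono fun v => ?_) (by positivity)) _
    refine ENNReal.rpow_le_rpow ?_ hr.le
    rw [Real.enorm_of_nonneg (hg0 n v), ← hgF v]
    exact le_iSup (fun n => ENNReal.ofReal (g n v)) n
  · intro a b hab x
    simp only
    rw [← posMaximal_ofReal (hgc _) (hgs _) (hg0 _), ← posMaximal_ofReal (hgc _) (hgs _) (hg0 _)]
    exact posMaximal_mono (fun v => ENNReal.ofReal_le_ofReal (hgm hab v)) x

/-- The majorant must dominate at every point, because the singular measure `σ` sees null sets. So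
the exceptional null set is first given the value `∞`, which costs nothing in the integral; the
Vitali–Carathéodory theorem then applies to the power `r`. -/
theorem exists_lowerSemicontinuous_majorant (hr : 0 < r) {F : V → ℝ≥0∞} (hF : AEMeasurable F)
    {ε : ℝ≥0∞} (hε : ε ≠ 0) : ∃ G : V → ℝ≥0∞, LowerSemicontinuous G ∧ (∀ v, F v ≤ G v) ∧
      ∫⁻ v, G v ^ r ≤ (∫⁻ v, F v ^ r) + ε := by
  set N := toMeasurable volume {v | F v ≠ hF.mk F v} with hN
  have hN0 : volume N = 0 := by rw [hN, measure_toMeasurable]; exact hF.ae_eq_mk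
  have hNm : MeasurableSet N := measurableSet_toMeasurable _ _
  set F' : V → ℝ≥0∞ := fun v => N.indicator (fun _ => ⊤) v + hF.mk F v with hF'
  have hF'm : Measurable F' := (measurable_const.indicator hNm).add hF.measurable_mk
  have hle (v) : F v ≤ F' v := by
    by_cases hv : v ∈ N
    · simp [hF', hv]
    · have : F v = hF.mk F v := by
        by_contra h
        exact hv (subset_toMeasurable _ _ h)
      simp [hF', hv, this]
  have hae : F' =ᵐ[volume] F := by
    filter_upwards [hF.ae_eq_mk, measure_eq_zero_iff_ae_notMem.1 hN0] with v h1 h2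
    simp [hF', h1, h2]
  obtain ⟨g, hg1, hg2, hg3⟩ := exists_le_lowerSemicontinuous_lintegral_ge volume
    (fun v => F' v ^ r) (hF'm.pow_const r) hε
  refine ⟨fun v => g v ^ (1 / r), ?_, fun v => (hle v).trans ?_, ?_⟩
  · exact (ENNReal.continuous_rpow_const (y := 1 / r)).comp_lowerSemicontinuous hg2
      (ENNReal.monotone_rpow_of_nonneg (by positivity))
  · calc F' v = (F' v ^ r) ^ (1 / r) := by
          rw [← ENNReal.rpow_mul, mul_one_div_cancel hr.ne', ENNReal.rpow_one]
      _ ≤ _ := ENNReal.rpow_le_rpow (hg1 v) (by positivity)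
  · calc ∫⁻ v, (g v ^ (1 / r)) ^ r = ∫⁻ v, g v := by
          simp_rw [← ENNReal.rpow_mul, one_div_mul_cancel hr.ne', ENNReal.rpow_one]
      _ ≤ _ := hg3
      _ = _ := by
          congr 1
          exact lintegral_congr_ae (hae.mono fun v hv => by simp only [hv])

/-- The integral on the left is an upper integral, since measurability of this supremum is not
known; it is bounded through semicontinuous majorants, letting `ε` tend to `0`. -/
theorem lintegral_posMaximal_le (hC : HasMaximalBound Δ σ r C) (hr : 0 < r)
    {F : V → ℝ≥0∞} (hF : AEMeasurable F) (z : W) :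
    ∫⁻ x in Metric.ball z 1, posMaximal Δ σ F x ≤ C * (∫⁻ v, F v ^ r) ^ (1 / r) := by
  have hlim : Tendsto (fun ε : ℝ≥0∞ => (C : ℝ≥0∞) * ((∫⁻ v, F v ^ r) + ε) ^ (1 / r)) (𝓝[>] 0)
      (𝓝 (C * ((∫⁻ v, F v ^ r) + 0) ^ (1 / r))) := by
    refine ENNReal.Tendsto.const_mul ?_ (Or.inr ENNReal.coe_ne_top)
    refine Tendsto.mono_left ?_ nhdsWithin_le_nhds
    exact (ENNReal.continuous_rpow_const.tendsto _).comp
      ((continuous_const.add continuous_id).tendsto _)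
  rw [add_zero] at hlim
  refine ge_of_tendsto hlim ?_
  filter_upwards [self_mem_nhdsWithin] with ε hε
  obtain ⟨G, hG, hle, hint⟩ := exists_lowerSemicontinuous_majorant hr hF hε.ne'
  refine (lintegral_mono fun x => posMaximal_mono hle x).trans
    (((measurable_posMaximal_and_lintegral_le hC hr hG).2 z).trans ?_)
  exact mul_le_mul_right (ENNReal.rpow_le_rpow hint (by positivity)) _

variable {R : ℝ}

/-- `‖Δ‖` accounts for moving `x` within the unit ball and `2 R` for `t y`; the extra `1` makes the
inequality strict. -/
theorem norm_sub_smul_lt (Δ : W →L[ℝ] V) {x z : W} (hx : x ∈ Metric.ball z 1) {t : ℝ}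
    (ht : t ∈ Set.Ioo (1 : ℝ) 2) {y : V} (hy : ‖y‖ ≤ R) :
    Δ x - t • y ∈ Metric.ball (Δ z) (‖Δ‖ + 2 * R + 1) := by
  rw [mem_ball_iff_norm] at *
  have h1 : ‖Δ (x - z)‖ ≤ ‖Δ‖ * 1 := (Δ.le_opNorm _).trans (by gcongr)
  have h2 : ‖t • y‖ ≤ 2 * R := by
    rw [norm_smul, Real.norm_of_nonneg (by linarith [ht.1])]
    exact mul_le_mul ht.2.le hy (norm_nonneg _) (by norm_num)
  calc ‖Δ x - t • y - Δ z‖ = ‖Δ (x - z) - t • y‖ := by rw [map_sub]; congr 1; abel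
    _ ≤ ‖Δ (x - z)‖ + ‖t • y‖ := norm_sub_le _ _
    _ < _ := by linarith

theorem lintegral_posMaximal_le_local (hC : HasMaximalBound Δ σ r C) (hr : 0 < r)
    (hR : ∀ᵐ y ∂σ, ‖y‖ ≤ R) {F : V → ℝ≥0∞} (hF : AEMeasurable F) (z : W) :
    ∫⁻ x in Metric.ball z 1, posMaximal Δ σ F x ≤
      C * (∫⁻ v in Metric.ball (Δ z) (‖Δ‖ + 2 * R + 1), F v ^ r) ^ (1 / r) := by
  set U := Metric.ball (Δ z) (‖Δ‖ + 2 * R + 1) with hU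
  have h1 : ∀ x ∈ Metric.ball z 1, posMaximal Δ σ F x ≤ posMaximal Δ σ (U.indicator F) x := by
    intro x hx
    refine iSup₂_mono fun t ht => le_of_eq (lintegral_congr_ae ?_)
    filter_upwards [hR] with y hy
    rw [Set.indicator_of_mem (norm_sub_smul_lt Δ hx ht hy)]
  refine (setLIntegral_mono' measurableSet_ball h1).trans
    ((lintegral_posMaximal_le hC hr (hF.indicator measurableSet_ball) z).trans (le_of_eq ?_))
  rw [← lintegral_indicator measurableSet_ball]
  congr 2
  refine lintegral_congr fun v => ?_
  by_cases hv : v ∈ U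
  · rw [Set.indicator_of_mem hv, Set.indicator_of_mem hv]
  · rw [Set.indicator_of_notMem hv, Set.indicator_of_notMem hv, ENNReal.zero_rpow_of_pos hr]

/-- A Borel–Cantelli argument: on each unit ball the L¹ norms of the maximal functions of the
majorants are summable, so their series converges almost everywhere. Unit balls exhaust the space.
-/
theorem ae_tendsto_posMaximal (hC : HasMaximalBound Δ σ r C) (hr : 0 < r) {F : ℕ → V → ℝ≥0∞}
    (hF : ∀ n, AEMeasurable (F n)) (hF2 : ∀ n, ∫⁻ v, F n v ^ r ≤ ((2⁻¹ : ℝ≥0∞) ^ n) ^ r) :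
    ∀ᵐ x : W, Tendsto (fun n => posMaximal Δ σ (F n) x) atTop (𝓝 0) := by
  have hε (n : ℕ) : ((2⁻¹ : ℝ≥0∞) ^ n) ^ r ≠ 0 := by
    rw [Ne, ENNReal.rpow_eq_zero_iff]
    simp [hr.not_gt]
  choose G hG hle hint using fun n => exists_lowerSemicontinuous_majorant hr (hF n) (hε n)
  have hG2 (n) : (∫⁻ v, G n v ^ r) ^ (1 / r) ≤ (2 : ℝ≥0∞) ^ (1 / r) * 2⁻¹ ^ n := by
    calc (∫⁻ v, G n v ^ r) ^ (1 / r) ≤ (2 * ((2⁻¹ : ℝ≥0∞) ^ n) ^ r) ^ (1 / r) := by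
          refine ENNReal.rpow_le_rpow ((hint n).trans ?_) (by positivity)
          rw [two_mul]
          exact add_le_add_left (hF2 n) _
      _ = _ := by
          rw [ENNReal.mul_rpow_of_nonneg _ _ (by positivity), ← ENNReal.rpow_mul,
            mul_one_div_cancel hr.ne', ENNReal.rpow_one]
  have hm (n) := (measurable_posMaximal_and_lintegral_le hC hr (hG n)).1
  have hloc (z : W) : ∀ᵐ x ∂(volume.restrict (Metric.ball z 1)),
      Tendsto (fun n => posMaximal Δ σ (F n) x) atTop (𝓝 0) := by
    have hsum : ∫⁻ x in Metric.ball z 1, (∑' n, posMaximal Δ σ (G n) x) ≠ ⊤ := by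
      rw [lintegral_tsum fun n => (hm n).aemeasurable]
      refine ne_top_of_le_ne_top ?_ (ENNReal.tsum_le_tsum fun n =>
        ((measurable_posMaximal_and_lintegral_le hC hr (hG n)).2 z).trans
          (mul_le_mul_right (hG2 n) _))
      simp_rw [← mul_assoc]
      rw [ENNReal.tsum_mul_left, ENNReal.tsum_geometric]
      refine ENNReal.mul_ne_top (ENNReal.mul_ne_top ENNReal.coe_ne_top
        (ENNReal.rpow_ne_top_of_nonneg (by positivity) (by norm_num))) ?_
      simp
    filter_upwards [ae_lt_top (Measurable.tsum hm) hsum] with x hx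
    exact tendsto_of_tendsto_of_tendsto_of_le_of_le tendsto_const_nhds
      (ENNReal.tendsto_atTop_zero_of_tsum_ne_top hx.ne) (fun n => zero_le)
      (fun n => posMaximal_mono (hle n) x)
  rw [ae_iff]
  refine measure_null_of_locally_null _ fun x _ => ⟨_, Filter.inter_mem self_mem_nhdsWithin
    (mem_nhdsWithin_of_mem_nhds (Metric.ball_mem_nhds x one_pos)), ?_⟩
  have := hloc x
  rwa [ae_restrict_iff' measurableSet_ball, ae_iff, show {a | ¬(a ∈ Metric.ball x 1 →
    Tendsto (fun n => posMaximal Δ σ (F n) a) atTop (𝓝 0))} = {a | ¬ Tendsto (fun n =>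
      posMaximal Δ σ (F n) a) atTop (𝓝 0)} ∩ Metric.ball x 1 by ext; simp; tauto] at this

/-- The preceding convergence, for the constant sequence equal to the indicator of a measurable null
set containing `N`, says that its maximal function vanishes almost everywhere. One exceptional set
of `x` serves all `t`. -/
theorem ae_measure_preimage_eq_zero (hC : HasMaximalBound Δ σ r C) (hr : 0 < r) {N : Set V}
    (hN : volume N = 0) :
    ∀ᵐ x : W, ∀ t ∈ Set.Ioo (1 : ℝ) 2, σ {y | Δ x - t • y ∈ N} = 0 := by
  set N' := toMeasurable volume N
  have hN' : volume N' = 0 := by rw [measure_toMeasurable]; exact hN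
  have hm : MeasurableSet N' := measurableSet_toMeasurable _ _
  have h := ae_tendsto_posMaximal hC hr (F := fun _ => N'.indicator 1)
    (fun n => (measurable_one.indicator hm).aemeasurable) (fun n => by
      rw [lintegral_congr_ae (g := 0), Pi.zero_def, lintegral_zero]
      · exact zero_le
      · filter_upwards [measure_eq_zero_iff_ae_notMem.1 hN'] with v hv
        simp [hv, hr])
  filter_upwards [h] with x hx t ht
  have h0 : posMaximal Δ σ (N'.indicator 1) x = 0 := tendsto_nhds_unique tendsto_const_nhds hx
  have h1 := (iSup₂_eq_bot.1 h0) t ht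
  have hms : MeasurableSet {y | Δ x - t • y ∈ N'} :=
    (by fun_prop : Measurable fun y => Δ x - t • y) hm
  refine measure_mono_null (t := {y | Δ x - t • y ∈ N'})
    (fun y hy => subset_toMeasurable _ _ hy) ?_
  rw [← lintegral_indicator_one hms]
  exact h1

/-- Approximate `F` in `L^r` by compactly supported continuous functions with errors `2^(-n)`. The
maximal functions of the errors tend to zero almost everywhere, which yields integrability for all
`t` at once and exhibits the maximal function as an almost everywhere limit of measurable ones. -/
theorem ae_integrable_and_aemeasurable (hC : HasMaximalBound Δ σ r C) (hr : 1 ≤ r) {F : V → ℂ}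
    (hF : MemLp F (ENNReal.ofReal r)) :
    (∀ᵐ x : W, ∀ t ∈ Set.Ioo (1 : ℝ) 2, Integrable (fun y => F (Δ x - t • y)) σ) ∧
      AEMeasurable (restrictMaximal Δ σ F) := by
  have hr0 : 0 < r := by linarith
  have hε (n : ℕ) : (2⁻¹ : ℝ≥0∞) ^ n ≠ 0 := by simp
  choose φ hφs hφe hφc hφL using fun n =>
    hF.exists_hasCompactSupport_eLpNorm_sub_le ENNReal.ofReal_ne_top (hε n)
  have hlim := ae_tendsto_posMaximal hC hr0 (F := fun n v => ‖F v - φ n v‖ₑ)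
    (fun n => (hF.1.sub (hφL n).1).enorm) (fun n => by
      have h := hφe n
      rw [eLpNorm_eq_lintegral_rpow_enorm_toReal (by simpa using hr0) ENNReal.ofReal_ne_top,
        ENNReal.toReal_ofReal hr0.le] at h
      have h2 := ENNReal.rpow_le_rpow h hr0.le
      rwa [← ENNReal.rpow_mul, one_div_mul_cancel hr0.ne', ENNReal.rpow_one] at h2)
  -- For almost every `x`, changing `F` on a null set does not affect any of its averages; this
  -- provides measurability along the surface.
  have hnull := ae_measure_preimage_eq_zero hC hr0 (N := {v | F v ≠ hF.1.mk F v}) hF.1.ae_eq_mk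
  have hmeas : ∀ᵐ x : W, ∀ t ∈ Set.Ioo (1 : ℝ) 2,
      AEStronglyMeasurable (fun y => F (Δ x - t • y)) σ := by
    filter_upwards [hnull] with x hx t ht
    refine ⟨fun y => hF.1.mk F (Δ x - t • y),
      hF.1.stronglyMeasurable_mk.comp_measurable (by fun_prop), ?_⟩
    exact hx t ht
  have hint : ∀ᵐ x : W, ∀ t ∈ Set.Ioo (1 : ℝ) 2, Integrable (fun y => F (Δ x - t • y)) σ := by
    filter_upwards [hmeas, hlim] with x hx hlx t ht
    refine ⟨hx t ht, ?_⟩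
    obtain ⟨n, hn⟩ := ((tendsto_order.1 hlx).2 1 one_pos).exists
    have h2 : ∫⁻ y, ‖F (Δ x - t • y) - φ n (Δ x - t • y)‖ₑ ∂σ < ⊤ :=
      (le_iSup₂ (f := fun t (_ : t ∈ Set.Ioo (1 : ℝ) 2) =>
        ∫⁻ y, ‖F (Δ x - t • y) - φ n (Δ x - t • y)‖ₑ ∂σ) t ht).trans_lt
        (hn.trans ENNReal.one_lt_top)
    have hφi := integrable_comp_of_hasCompactSupport (σ := σ) (hφc n) (hφs n) (Δ x) t
    have : Integrable (fun y => (F (Δ x - t • y) - φ n (Δ x - t • y)) + φ n (Δ x - t • y)) σ :=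
      Integrable.add ⟨(hx t ht).sub hφi.1, h2⟩ hφi
    simpa using this.2
  refine ⟨hint, aemeasurable_of_tendsto_metrizable_ae atTop
    (fun n => (measurable_restrictMaximal (Δ := Δ) (σ := σ) (hφc n) (hφs n)).aemeasurable) ?_⟩
  filter_upwards [hint, hlim] with x hx hlx
  have hle (a b : V → ℂ) (ha : ∀ t ∈ Set.Ioo (1 : ℝ) 2, Integrable (fun y => a (Δ x - t • y)) σ)
      (hb : ∀ t ∈ Set.Ioo (1 : ℝ) 2, Integrable (fun y => b (Δ x - t • y)) σ) :
      restrictMaximal Δ σ a x ≤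
        restrictMaximal Δ σ b x + posMaximal Δ σ (fun v => ‖a v - b v‖ₑ) x := by
    refine iSup₂_le fun t ht => ?_
    have h1 : ∫ y, a (Δ x - t • y) ∂σ = (∫ y, b (Δ x - t • y) ∂σ) +
        ∫ y, (a (Δ x - t • y) - b (Δ x - t • y)) ∂σ := by
      rw [integral_sub (ha t ht) (hb t ht)]; ring
    rw [h1]
    refine (enorm_add_le _ _).trans (add_le_add ?_ ?_)
    · exact le_iSup₂ (f := fun t (_ : t ∈ Set.Ioo (1 : ℝ) 2) => ‖∫ y, b (Δ x - t • y) ∂σ‖ₑ) t ht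
    · exact (enorm_integral_le_lintegral_enorm _).trans
        (le_iSup₂ (f := fun t (_ : t ∈ Set.Ioo (1 : ℝ) 2) =>
          ∫⁻ y, ‖a (Δ x - t • y) - b (Δ x - t • y)‖ₑ ∂σ) t ht)
  have hφi (n) (t : ℝ) (_ : t ∈ Set.Ioo (1 : ℝ) 2) :=
    integrable_comp_of_hasCompactSupport (σ := σ) (hφc n) (hφs n) (Δ x) t
  have hlo : Tendsto (fun n => restrictMaximal Δ σ F x - posMaximal Δ σ (fun v => ‖F v - φ n v‖ₑ) x)
      atTop (𝓝 (restrictMaximal Δ σ F x - 0)) :=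
    ENNReal.Tendsto.sub tendsto_const_nhds hlx (Or.inr ENNReal.zero_ne_top)
  have hhi : Tendsto (fun n => restrictMaximal Δ σ F x + posMaximal Δ σ (fun v => ‖F v - φ n v‖ₑ) x)
      atTop (𝓝 (restrictMaximal Δ σ F x + 0)) := tendsto_const_nhds.add hlx
  rw [tsub_zero] at hlo
  rw [add_zero] at hhi
  refine tendsto_of_tendsto_of_tendsto_of_le_of_le hlo hhi (fun n => ?_) (fun n => ?_)
  · exact tsub_le_iff_right.2 (hle F (φ n) hx (hφi n))
  · refine (hle (φ n) F (hφi n) hx).trans (le_of_eq ?_)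
    simp_rw [← enorm_neg (F _ - φ n _), neg_sub]

/-- For `p > r` a product of `L^p` functions need only be locally in `L^r`. Near each `x` the
averages involve a bounded set, so truncation to a large ball is harmless. -/
theorem ae_integrable_and_aemeasurable_of_local (hC : HasMaximalBound Δ σ r C) (hr : 1 ≤ r)
    (hR : ∀ᵐ y ∂σ, ‖y‖ ≤ R) {F : V → ℂ} 
    (hF : ∀ n : ℕ, MemLp ((Metric.ball 0 (n : ℝ)).indicator F) (ENNReal.ofReal r)) :
    (∀ᵐ x : W, ∀ t ∈ Set.Ioo (1 : ℝ) 2, Integrable (fun y => F (Δ x - t • y)) σ) ∧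
      AEMeasurable (restrictMaximal Δ σ F) := by
  have h (n : ℕ) := ae_integrable_and_aemeasurable hC hr (hF n)
  have hev (x : W) : ∀ᶠ n : ℕ in atTop, ∀ t ∈ Set.Ioo (1 : ℝ) 2,
      (fun y => (Metric.ball 0 (n : ℝ)).indicator F (Δ x - t • y)) =ᵐ[σ]
        fun y => F (Δ x - t • y) := by
    filter_upwards [tendsto_natCast_atTop_atTop.eventually_ge_atTop
      (‖Δ x‖ + (‖Δ‖ + 2 * R + 1))] with n hn t ht
    filter_upwards [hR] with y hy
    rw [Set.indicator_of_mem]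
    have := norm_sub_smul_lt Δ (Metric.mem_ball_self (x := x) one_pos) ht hy
    rw [mem_ball_iff_norm] at this
    rw [mem_ball_zero_iff]
    have h3 := norm_sub_norm_le (Δ x - t • y) (Δ x)
    linarith
  constructor
  · filter_upwards [ae_all_iff.2 fun n => (h n).1] with x hx t ht
    obtain ⟨n, hn⟩ := (hev x).exists
    exact (hx n t ht).congr (hn t ht)
  · refine aemeasurable_of_tendsto_metrizable_ae atTop (fun n => (h n).2) (.of_forall fun x => ?_)
    refine tendsto_const_nhds.congr' ?_
    filter_upwards [hev x] with n hn
    exact iSup_congr fun t => iSup_congr fun ht => by rw [integral_congr_ae (hn t ht)]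

end Extension

/-! ### Power inequalities and products for lower integrals -/

theorem rpow_lintegral_le {α : Type*} [MeasurableSpace α] {μ : Measure α} {f : α → ℝ≥0∞}
    (hf : AEMeasurable f μ) {s : ℝ} (hs : 1 ≤ s) :
    (∫⁻ x, f x ∂μ) ^ s ≤ (∫⁻ x, f x ^ s ∂μ) * μ Set.univ ^ (s - 1) := by
  have h := eLpNorm'_le_eLpNorm'_mul_rpow_measure_univ (p := 1) (q := s) one_pos hs
    hf.aestronglyMeasurable
  have hs0 : 0 < s := by linarith
  simp only [eLpNorm', enorm_eq_self, ENNReal.rpow_one, one_div_one] at h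
  have h2 := ENNReal.rpow_le_rpow h hs0.le
  rwa [ENNReal.mul_rpow_of_nonneg _ _ hs0.le, ← ENNReal.rpow_mul, one_div_mul_cancel hs0.ne',
    ENNReal.rpow_one, ← ENNReal.rpow_mul, sub_mul, one_mul, one_div_mul_cancel hs0.ne'] at h2

theorem lintegral_rpow_le {α : Type*} [MeasurableSpace α] {μ : Measure α} {f : α → ℝ≥0∞}
    (hf : AEMeasurable f μ) {q : ℝ} (hq0 : 0 < q) (hq : q ≤ 1) :
    ∫⁻ x, f x ^ q ∂μ ≤ (∫⁻ x, f x ∂μ) ^ q * μ Set.univ ^ (1 - q) := by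
  have h := rpow_lintegral_le (hf.pow_const q) (s := 1 / q) (by rw [le_div_iff₀ hq0]; linarith)
  simp_rw [← ENNReal.rpow_mul, mul_one_div_cancel hq0.ne', ENNReal.rpow_one] at h
  have h2 := ENNReal.rpow_le_rpow h hq0.le
  rwa [ENNReal.mul_rpow_of_nonneg _ _ hq0.le, ← ENNReal.rpow_mul, ← ENNReal.rpow_mul,
    one_div_mul_cancel hq0.ne', ENNReal.rpow_one, sub_mul, one_div_mul_cancel hq0.ne',
    one_mul] at h2

theorem lintegral_fin_prod_eq_prod {n : ℕ} {E : Fin n → Type*} {mE : ∀ i, MeasurableSpace (E i)}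
    {μ : (i : Fin n) → Measure (E i)} [∀ i, SigmaFinite (μ i)] {f : (i : Fin n) → E i → ℝ≥0∞}
    (hf : ∀ i, Measurable (f i)) :
    ∫⁻ x : (i : Fin n) → E i, ∏ i, f i (x i) ∂(Measure.pi μ) = ∏ i, ∫⁻ x, f i x ∂(μ i) := by
  induction n with
  | zero => simp
  | succ n n_ih =>
      calc
        _ = ∫⁻ x : E 0 × ((i : Fin n) → E (Fin.succ i)),
            f 0 x.1 * ∏ i : Fin n, f (Fin.succ i) (x.2 i)
            ∂((μ 0).prod (Measure.pi (fun i ↦ μ i.succ))) := by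
          have hm : Measurable fun x : (i : Fin (n + 1)) → E i => ∏ i, f i (x i) :=
            Finset.measurable_prod _ fun i _ => (hf i).comp (measurable_pi_apply i)
          rw [← ((measurePreserving_piFinSuccAbove μ 0).symm).lintegral_comp hm]
          simp_rw [MeasurableEquiv.piFinSuccAbove_symm_apply, Fin.insertNthEquiv,
            Fin.prod_univ_succ, Fin.insertNth_zero, Equiv.coe_fn_mk, Fin.cons_succ,
            Fin.zero_succAbove, Fin.cons_zero]
          rfl
        _ = (∫⁻ x, f 0 x ∂μ 0)
            * ∏ i : Fin n, ∫⁻ (x : E (Fin.succ i)), f (Fin.succ i) x ∂(μ i.succ) := by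
          rw [← n_ih fun i => hf _, ← lintegral_prod_mul (hf 0).aemeasurable]
          exact (Finset.measurable_prod _ fun i _ =>
            (hf _).comp (measurable_pi_apply i)).aemeasurable
        _ = ∏ i, ∫⁻ x, f i x ∂(μ i) := by rw [Fin.prod_univ_succ]

theorem enorm_finset_prod {ι : Type*} (s : Finset ι) (f : ι → ℂ) :
    ‖∏ i ∈ s, f i‖ₑ = ∏ i ∈ s, ‖f i‖ₑ := by
  simp [enorm_eq_nnnorm, nnnorm_prod]

/-! ### Averaging over the centres of balls -/

section Averaging

variable {X : Type*} [NormedAddCommGroup X] [InnerProductSpace ℝ X] [FiniteDimensional ℝ X]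
  [MeasurableSpace X] [BorelSpace X]

theorem aemeasurable_indicator_ball {h : X → ℝ≥0∞} (hh : AEMeasurable h) (ρ : ℝ) :
    AEMeasurable (fun p : X × X => (Metric.ball p.1 ρ).indicator h p.2)
      ((volume : Measure X).prod volume) := by
  have h1 : MeasurableSet {p : X × X | dist p.2 p.1 < ρ} :=
    (isOpen_lt (by fun_prop) continuous_const).measurableSet
  exact (hh.comp_quasiMeasurePreserving Measure.quasiMeasurePreserving_snd).indicator h1

theorem aemeasurable_lintegral_ball {h : X → ℝ≥0∞} (hh : AEMeasurable h) (ρ : ℝ) :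
    AEMeasurable (fun z => ∫⁻ x in Metric.ball z ρ, h x) := by
  simp_rw [← lintegral_indicator measurableSet_ball]
  exact (aemeasurable_indicator_ball hh ρ).lintegral_prod_right'

theorem lintegral_lintegral_ball {h : X → ℝ≥0∞} (hh : AEMeasurable h) (ρ : ℝ) :
    ∫⁻ z, (∫⁻ x in Metric.ball z ρ, h x) = volume (Metric.ball (0 : X) ρ) * ∫⁻ x, h x := by
  simp_rw [← lintegral_indicator measurableSet_ball]
  rw [lintegral_lintegral_swap (aemeasurable_indicator_ball hh ρ)]
  have h1 (x : X) : ∫⁻ z, (Metric.ball z ρ).indicator h x =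
      volume (Metric.ball (0 : X) ρ) * h x := by
    have : (fun z => (Metric.ball z ρ).indicator h x) =
        (Metric.ball x ρ).indicator fun _ => h x := by
      ext z
      by_cases hz : x ∈ Metric.ball z ρ
      · rw [Set.indicator_of_mem hz, Set.indicator_of_mem (Metric.mem_ball_comm.1 hz)]
      · rw [Set.indicator_of_notMem hz, Set.indicator_of_notMem (mt Metric.mem_ball_comm.1 hz)]
    rw [this, lintegral_indicator_const measurableSet_ball, Measure.addHaar_ball_center, mul_comm]
  simp_rw [h1]
  exact lintegral_const_mul' _ _ measure_ball_lt_top.ne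

end Averaging

/-! ### From the linear to the multilinear maximal function -/

section Blocks

variable {m d : ℕ}

/-- The diagonal embedding `x ↦ (x, …, x)`. -/
noncomputable def diagonal (m d : ℕ) : EuclideanSpace ℝ (Fin d) →L[ℝ] BlockSpace m d :=
  (PiLp.continuousLinearEquiv 2 ℝ (fun _ : Fin m => EuclideanSpace ℝ (Fin d))).symm.toContinuousLinearMap ∘L
    ContinuousLinearMap.pi fun _ => ContinuousLinearMap.id ℝ _

theorem localMaximal_le (σ : Measure (BlockSpace m d)) (f : Fin m → EuclideanSpace ℝ (Fin d) → ℂ)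
    (x : EuclideanSpace ℝ (Fin d)) :
    localMaximal σ f x ≤ posMaximal (diagonal m d) σ (fun v => ‖∏ i, f i (v i)‖ₑ) x :=
  iSup₂_mono fun _ _ => enorm_integral_le_lintegral_enorm _

/-- Uniqueness of Haar measure up to a constant is enough: the value of the constant never matters
below. -/
theorem exists_map_volume (m d : ℕ) : ∃ c : ℝ≥0, Measure.map
    (PiLp.continuousLinearEquiv 2 ℝ (fun _ : Fin m => EuclideanSpace ℝ (Fin d)))
      (volume : Measure (BlockSpace m d)) = c • Measure.pi (fun _ => volume) :=
  ⟨_, Measure.isAddLeftInvariant_eq_smul _ _⟩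

theorem quasiMeasurePreserving_apply (i : Fin m) :
    Measure.QuasiMeasurePreserving (fun v : BlockSpace m d => v i) := by
  obtain ⟨c, hc⟩ := exists_map_volume m d
  have h1 : Measure.QuasiMeasurePreserving
      (PiLp.continuousLinearEquiv 2 ℝ (fun _ : Fin m => EuclideanSpace ℝ (Fin d)))
      (volume : Measure (BlockSpace m d)) (Measure.pi fun _ => volume) :=
    ⟨(ContinuousLinearEquiv.continuous _).measurable, by
      rw [hc]; exact Measure.smul_absolutelyContinuous⟩
  exact (Measure.quasiMeasurePreserving_eval _ i).comp h1

theorem exists_lintegral_prod_eq (m d : ℕ) : ∃ c : ℝ≥0,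
    ∀ f : Fin m → EuclideanSpace ℝ (Fin d) → ℝ≥0∞, (∀ i, AEMeasurable (f i)) →
      ∫⁻ v : BlockSpace m d, ∏ i, f i (v i) = c * ∏ i, ∫⁻ x, f i x := by
  obtain ⟨c, hc⟩ := exists_map_volume m d
  refine ⟨c, fun f hf => ?_⟩
  have h1 : ∫⁻ v : BlockSpace m d, ∏ i, f i (v i) =
      ∫⁻ v : BlockSpace m d, ∏ i, (hf i).mk (f i) (v i) := by
    refine lintegral_congr_ae ?_
    filter_upwards [ae_all_iff.2 fun i =>
      (quasiMeasurePreserving_apply (m := m) i).ae_eq_comp (hf i).ae_eq_mk] with v hv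
    exact Finset.prod_congr rfl fun i _ => hv i
  have h2 (i) : ∫⁻ x, f i x = ∫⁻ x, (hf i).mk (f i) x := lintegral_congr_ae (hf i).ae_eq_mk
  have hm : Measurable fun u : Fin m → EuclideanSpace ℝ (Fin d) => ∏ i, (hf i).mk (f i) (u i) :=
    Finset.measurable_prod _ fun i _ => (hf i).measurable_mk.comp (measurable_pi_apply i)
  simp_rw [h1, h2]
  rw [← lintegral_fin_prod_eq_prod fun i => (hf i).measurable_mk, ← smul_eq_mul,
    ← ENNReal.smul_def, ← lintegral_smul_measure, ← hc, lintegral_map hm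
    (ContinuousLinearEquiv.continuous _).measurable]
  rfl

theorem aestronglyMeasurable_prod {f : Fin m → EuclideanSpace ℝ (Fin d) → ℂ}
    (hf : ∀ i, AEStronglyMeasurable (f i)) :
    AEStronglyMeasurable (fun v : BlockSpace m d => ∏ i, f i (v i)) :=
  Finset.aestronglyMeasurable_fun_prod _ fun i _ =>
    (hf i).comp_quasiMeasurePreserving (quasiMeasurePreserving_apply i)

/-- A Euclidean ball around a diagonal point lies in the product of the balls with the same radius
in each block, and on that product the integral factors. -/
theorem exists_lintegral_ball_prod_le (m d : ℕ) : ∃ c : ℝ≥0,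
    ∀ f : Fin m → EuclideanSpace ℝ (Fin d) → ℂ, (∀ i, AEStronglyMeasurable (f i)) →
      ∀ (z : EuclideanSpace ℝ (Fin d)) (ρ r : ℝ), 0 ≤ r →
      ∫⁻ v in Metric.ball (diagonal m d z) ρ, ‖∏ i, f i (v i)‖ₑ ^ r ≤
        c * ∏ i, ∫⁻ x in Metric.ball z ρ, ‖f i x‖ₑ ^ r := by
  obtain ⟨c, hc⟩ := exists_lintegral_prod_eq m d
  refine ⟨c, fun f hf z ρ r hr => ?_⟩
  simp_rw [← lintegral_indicator measurableSet_ball]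
  rw [← hc _ fun i => ((hf i).enorm.pow_const r).indicator measurableSet_ball]
  refine lintegral_mono fun v => ?_
  by_cases hv : v ∈ Metric.ball (diagonal m d z) ρ
  · rw [Set.indicator_of_mem hv, enorm_finset_prod, ← ENNReal.prod_rpow_of_nonneg hr]
    refine (Finset.prod_congr rfl fun i _ => ?_).le
    rw [Set.indicator_of_mem]
    rw [mem_ball_iff_norm] at hv ⊢
    exact (PiLp.norm_apply_le (v - diagonal m d z) i).trans_lt hv
  · rw [Set.indicator_of_notMem hv]
    exact zero_le

variable {σ : Measure (BlockSpace m d)} [IsFiniteMeasure σ] {r : ℝ} {C : ℝ≥0} {R : ℝ}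

theorem lintegral_ball_lt_top {f : EuclideanSpace ℝ (Fin d) → ℂ} {p : ℝ≥0∞}
    (hf : MemLp f p) (hr : 0 < r) (hrp : ENNReal.ofReal r ≤ p) (z : EuclideanSpace ℝ (Fin d))
    (ρ : ℝ) : ∫⁻ x in Metric.ball z ρ, ‖f x‖ₑ ^ r < ⊤ := by
  have : IsFiniteMeasure (volume.restrict (Metric.ball z ρ)) :=
    ⟨by rw [Measure.restrict_apply_univ]; exact measure_ball_lt_top⟩
  have h := (hf.restrict (Metric.ball z ρ)).mono_exponent hrp
  have := lintegral_rpow_enorm_lt_top_of_eLpNorm_lt_top (by simpa using hr) ENNReal.ofReal_ne_top h.2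
  rwa [ENNReal.toReal_ofReal hr.le] at this

theorem ae_integrable_and_aemeasurable_localMaximal (hC : HasMaximalBound (diagonal m d) σ r C)
    (hr : 1 ≤ r) (hR : ∀ᵐ y ∂σ, ‖y‖ ≤ R) {f : Fin m → EuclideanSpace ℝ (Fin d) → ℂ} {p : ℝ≥0∞}
    (hf : ∀ i, MemLp (f i) p) (hrp : ENNReal.ofReal r ≤ p) :
    (∀ᵐ x, ∀ t ∈ Set.Ioo (1 : ℝ) 2, Integrable (fun y => ∏ i, f i (x - t • y i)) σ) ∧
      AEMeasurable (localMaximal σ f) := by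
  have hr0 : 0 < r := by linarith
  obtain ⟨c, hc⟩ := exists_lintegral_ball_prod_le m d
  refine ae_integrable_and_aemeasurable_of_local hC hr hR (F := fun v => ∏ i, f i (v i)) fun n => ?_
  rw [memLp_indicator_iff_restrict measurableSet_ball]
  refine ⟨(aestronglyMeasurable_prod fun i => (hf i).1).restrict, ?_⟩
  rw [eLpNorm_lt_top_iff_lintegral_rpow_enorm_lt_top (by simpa using hr0) ENNReal.ofReal_ne_top,
    ENNReal.toReal_ofReal hr0.le]
  have := hc f (fun i => (hf i).1) 0 n r hr0.le
  rw [map_zero] at this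
  refine this.trans_lt (ENNReal.mul_lt_top ENNReal.coe_lt_top (ENNReal.prod_lt_top fun i _ => ?_))
  exact lintegral_ball_lt_top (hf i) hr0 hrp 0 n

/-- On a unit ball, Hölder's inequality with `q = r/m ≤ 1` passes from L¹ to `L^q`, and the local
`L^r` norm of the tensor product factors, each factor with exponent `1/m`. Integration over the
centre `z` and Hölder with `m` exponents `1/m` make the estimate global. -/
theorem exists_lintegral_localMaximal_rpow_le (hC : HasMaximalBound (diagonal m d) σ r C)
    (hr : 1 ≤ r) (hrm : r ≤ m) (hR : ∀ᵐ y ∂σ, ‖y‖ ≤ R) : ∃ K : ℝ≥0,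
    ∀ f : Fin m → EuclideanSpace ℝ (Fin d) → ℂ, (∀ i, MemLp (f i) (ENNReal.ofReal r)) →
      ∫⁻ x, localMaximal σ f x ^ (r / m) ≤ K * ∏ i, (∫⁻ x, ‖f i x‖ₑ ^ r) ^ (1 / (m : ℝ)) := by
  have hr0 : 0 < r := by linarith
  have hm0 : (0 : ℝ) < m := by linarith
  obtain ⟨c, hc⟩ := exists_lintegral_ball_prod_le m d
  set q := r / m with hq
  have hq0 : 0 < q := by positivity
  have hq1 : q ≤ 1 := by rwa [hq, div_le_one hm0]
  set ρ := ‖diagonal m d‖ + 2 * R + 1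
  set β : ℝ≥0∞ := volume (Metric.ball (0 : EuclideanSpace ℝ (Fin d)) 1) with hβ
  set γ : ℝ≥0∞ := volume (Metric.ball (0 : EuclideanSpace ℝ (Fin d)) ρ) with hγ
  have hβ0 : β ≠ 0 := (Metric.measure_ball_pos _ _ one_pos).ne'
  have hβt : β ≠ ⊤ := measure_ball_lt_top.ne
  have hγt : γ ≠ ⊤ := measure_ball_lt_top.ne
  set K : ℝ≥0∞ := β⁻¹ * ((C : ℝ≥0∞) ^ q * (c : ℝ≥0∞) ^ (1 / (m : ℝ)) * β ^ (1 - q) *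
    ∏ _i : Fin m, γ ^ (1 / (m : ℝ))) with hK
  have hKt : K ≠ ⊤ := by
    refine ENNReal.mul_ne_top (ENNReal.inv_ne_top.2 hβ0) (ENNReal.mul_ne_top (ENNReal.mul_ne_top
      (ENNReal.mul_ne_top ?_ ?_) ?_) (ENNReal.prod_ne_top fun _ _ => ?_)) <;>
    refine ENNReal.rpow_ne_top_of_nonneg ?_ (by simp [hβt, hγt])
    exacts [hq0.le, by positivity, by linarith, by positivity]
  refine ⟨K.toNNReal, fun f hf => ?_⟩
  rw [ENNReal.coe_toNNReal hKt]
  have hmeas := (ae_integrable_and_aemeasurable_localMaximal hC hr hR hf le_rfl).2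
  have hfm (i) : AEMeasurable fun x => ‖f i x‖ₑ ^ r := (hf i).1.enorm.pow_const r
  have hloc (z) : ∫⁻ x in Metric.ball z 1, localMaximal σ f x ^ q ≤
      (C : ℝ≥0∞) ^ q * (c : ℝ≥0∞) ^ (1 / (m : ℝ)) * β ^ (1 - q) *
        ∏ i, (∫⁻ x in Metric.ball z ρ, ‖f i x‖ₑ ^ r) ^ (1 / (m : ℝ)) := by
    have h1 : ∫⁻ x in Metric.ball z 1, localMaximal σ f x ≤
        C * (c * ∏ i, ∫⁻ x in Metric.ball z ρ, ‖f i x‖ₑ ^ r) ^ (1 / r) := by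
      refine (lintegral_mono fun x => localMaximal_le σ f x).trans
        ((lintegral_posMaximal_le_local hC hr0 hR
          (aestronglyMeasurable_prod fun i => (hf i).1).enorm z).trans ?_)
      exact mul_le_mul_right (ENNReal.rpow_le_rpow (hc f (fun i => (hf i).1) z _ r hr0.le)
        (by positivity)) _
    calc _ ≤ (∫⁻ x in Metric.ball z 1, localMaximal σ f x) ^ q * β ^ (1 - q) := by
          have := lintegral_rpow_le (hmeas.restrict (s := Metric.ball z 1)) hq0 hq1
          rwa [Measure.restrict_apply_univ, Measure.addHaar_ball_center] at this
      _ ≤ (C * (c * ∏ i, ∫⁻ x in Metric.ball z ρ, ‖f i x‖ₑ ^ r) ^ (1 / r)) ^ q * β ^ (1 - q) :=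
          mul_le_mul_left (ENNReal.rpow_le_rpow h1 hq0.le) _
      _ = _ := by
          have h3 : 1 / r * q = 1 / m := by rw [hq]; field_simp
          rw [ENNReal.mul_rpow_of_nonneg _ _ hq0.le, ← ENNReal.rpow_mul, h3,
            ENNReal.mul_rpow_of_nonneg _ _ (by positivity),
            ← ENNReal.prod_rpow_of_nonneg (by positivity)]
          ring
  -- The exponents `1/m` add up to one; by Fubini, integrating a local mass over all centres returns
  -- the full mass times the volume `γ` of a ball.
  have hH : ∫⁻ z, ∏ i, (∫⁻ x in Metric.ball z ρ, ‖f i x‖ₑ ^ r) ^ (1 / (m : ℝ)) ≤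
      ∏ i, (γ * ∫⁻ x, ‖f i x‖ₑ ^ r) ^ (1 / (m : ℝ)) := by
    refine (ENNReal.lintegral_prod_norm_pow_le Finset.univ
      (f := fun i z => ∫⁻ x in Metric.ball z ρ, ‖f i x‖ₑ ^ r)
      (fun i _ => aemeasurable_lintegral_ball (hfm i) ρ) (p := fun _ => 1 / (m : ℝ)) ?_ ?_).trans ?_
    · simp; field_simp
    · intro i _; positivity
    · refine (Finset.prod_congr rfl fun i _ => ?_).le
      rw [lintegral_lintegral_ball (hfm i)]
  have h5 := lintegral_lintegral_ball (hmeas.pow_const q) 1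
  calc _ = β⁻¹ * (β * ∫⁻ x, localMaximal σ f x ^ q) := by
        rw [← mul_assoc, ENNReal.inv_mul_cancel hβ0 hβt, one_mul]
    _ = β⁻¹ * ∫⁻ z, (∫⁻ x in Metric.ball z 1, localMaximal σ f x ^ q) := by rw [h5]
    _ ≤ β⁻¹ * ∫⁻ z, ((C : ℝ≥0∞) ^ q * (c : ℝ≥0∞) ^ (1 / (m : ℝ)) * β ^ (1 - q) *
        ∏ i, (∫⁻ x in Metric.ball z ρ, ‖f i x‖ₑ ^ r) ^ (1 / (m : ℝ))) :=
        mul_le_mul_right (lintegral_mono hloc) _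
    _ ≤ β⁻¹ * ((C : ℝ≥0∞) ^ q * (c : ℝ≥0∞) ^ (1 / (m : ℝ)) * β ^ (1 - q) *
        ∏ i, (γ * ∫⁻ x, ‖f i x‖ₑ ^ r) ^ (1 / (m : ℝ))) := by
        refine mul_le_mul_right ?_ _
        rw [lintegral_const_mul']
        · exact mul_le_mul_right hH _
        · refine ENNReal.mul_ne_top (ENNReal.mul_ne_top ?_ ?_) ?_ <;>
            refine ENNReal.rpow_ne_top_of_nonneg ?_ (by simp [hβt])
          exacts [hq0.le, by positivity, by linarith]
    _ = _ := by
        simp_rw [ENNReal.mul_rpow_of_nonneg _ _ (by positivity : 0 ≤ 1 / (m : ℝ)),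
          Finset.prod_mul_distrib, hK]
        ring

/-- With `s = p/r`, Jensen's inequality for `σ` dominates the power `s` of an average of `f` by the
average of the functions `|f_i|^s`, which lie in `L^r`; the estimate at `r` then applies to these.
-/
theorem exists_lintegral_localMaximal_rpow_le_of_le (hC : HasMaximalBound (diagonal m d) σ r C)
    (hr : 1 ≤ r) (hrm : r ≤ m) (hR : ∀ᵐ y ∂σ, ‖y‖ ≤ R) {p : ℝ} (hrp : r ≤ p) : ∃ K : ℝ≥0,
    ∀ f : Fin m → EuclideanSpace ℝ (Fin d) → ℂ, (∀ i, MemLp (f i) (ENNReal.ofReal p)) →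
      ∫⁻ x, localMaximal σ f x ^ (p / m) ≤ K * ∏ i, (∫⁻ x, ‖f i x‖ₑ ^ p) ^ (1 / (m : ℝ)) := by
  have hr0 : 0 < r := by linarith
  have hp0 : 0 < p := by linarith
  have hm0 : (0 : ℝ) < m := by linarith
  obtain ⟨K, hK⟩ := exists_lintegral_localMaximal_rpow_le hC hr hrm hR
  set s := p / r with hs
  have hs1 : 1 ≤ s := by rwa [hs, one_le_div hr0]
  have hs0 : 0 < s := by linarith
  have hsr : s * r = p := by rw [hs]; field_simp
  set B : ℝ≥0∞ := (σ Set.univ ^ (s - 1)) ^ (r / m) with hB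
  have hBt : B ≠ ⊤ := ENNReal.rpow_ne_top_of_nonneg (by positivity)
    (ENNReal.rpow_ne_top_of_nonneg (by linarith) (measure_ne_top _ _))
  refine ⟨B.toNNReal * K, fun f hf => ?_⟩
  set h : Fin m → EuclideanSpace ℝ (Fin d) → ℂ := fun i x => ((‖f i x‖ ^ s : ℝ) : ℂ) with hh
  have hhn (i x) : ‖h i x‖ₑ = ‖f i x‖ₑ ^ s := by
    rw [hh]
    simp only
    rw [← ofReal_norm, Complex.norm_real, Real.norm_of_nonneg (by positivity),
      ← ENNReal.ofReal_rpow_of_nonneg (norm_nonneg _) hs0.le, ofReal_norm]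
  have hhm (i) : MemLp (h i) (ENNReal.ofReal r) := by
    refine ⟨?_, ?_⟩
    · exact (Complex.continuous_ofReal.comp
        (Real.continuous_rpow_const hs0.le)).comp_aestronglyMeasurable (hf i).1.norm
    · rw [eLpNorm_lt_top_iff_lintegral_rpow_enorm_lt_top (by simpa using hr0)
        ENNReal.ofReal_ne_top, ENNReal.toReal_ofReal hr0.le]
      simp_rw [hhn, ← ENNReal.rpow_mul, hsr]
      have := lintegral_rpow_enorm_lt_top_of_eLpNorm_lt_top (by simpa using hp0)
        ENNReal.ofReal_ne_top (hf i).2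
      rwa [ENNReal.toReal_ofReal hp0.le] at this
  have h1 := (ae_integrable_and_aemeasurable_localMaximal hC hr hR hf
    (ENNReal.ofReal_le_ofReal hrp)).1
  have h2 := (ae_integrable_and_aemeasurable_localMaximal hC hr hR hhm le_rfl).1
  have key : ∀ᵐ x, localMaximal σ f x ^ s ≤ localMaximal σ h x * σ Set.univ ^ (s - 1) := by
    filter_upwards [h1, h2] with x hx1 hx2
    rw [← ENNReal.le_rpow_inv_iff hs0]
    refine iSup₂_le fun t ht => ?_
    rw [ENNReal.le_rpow_inv_iff hs0]
    refine (ENNReal.rpow_le_rpow (enorm_integral_le_lintegral_enorm _) hs0.le).trans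
      ((rpow_lintegral_le (hx1 t ht).1.enorm hs1).trans (mul_le_mul_left ?_ _))
    refine le_trans (le_of_eq ?_) (le_iSup₂ (f := fun t (_ : t ∈ Set.Ioo (1 : ℝ) 2) =>
      ‖average σ h x t‖ₑ) t ht)
    -- The functions `h i` are nonnegative, so the modulus of their average is the lower integral of
    -- the product.
    have h4 : average σ h x t = ((∫ y, ∏ i, ‖f i (x - t • y i)‖ ^ s ∂σ : ℝ) : ℂ) := by
      rw [average, ← integral_complex_ofReal]
      simp [hh]
    have h5 : Integrable (fun y : BlockSpace m d => ∏ i, ‖f i (x - t • y i)‖ ^ s) σ := by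
      have := (hx2 t ht).re
      refine this.congr (.of_forall fun y => ?_)
      simp only [hh, ← Complex.ofReal_prod]
      exact Complex.ofReal_re _
    rw [h4, ← ofReal_norm, Complex.norm_real, Real.norm_of_nonneg
      (integral_nonneg fun y => Finset.prod_nonneg fun i _ => by positivity),
      ofReal_integral_eq_lintegral_ofReal h5
      (.of_forall fun y => Finset.prod_nonneg fun i _ => by positivity)]
    refine lintegral_congr fun y => ?_
    rw [enorm_finset_prod, ← ENNReal.prod_rpow_of_nonneg hs0.le,
      ENNReal.ofReal_prod_of_nonneg fun i _ => by positivity]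
    refine Finset.prod_congr rfl fun i _ => ?_
    rw [← ENNReal.ofReal_rpow_of_nonneg (norm_nonneg _) hs0.le, ofReal_norm]
  calc ∫⁻ x, localMaximal σ f x ^ (p / m)
      ≤ ∫⁻ x, localMaximal σ h x ^ (r / m) * B := by
        refine lintegral_mono_ae ?_
        filter_upwards [key] with x hx
        have := ENNReal.rpow_le_rpow hx (by positivity : 0 ≤ r / m)
        rwa [← ENNReal.rpow_mul, ENNReal.mul_rpow_of_nonneg _ _ (by positivity),
          show s * (r / m) = p / m by rw [← hsr]; ring] at this
    _ = B * ∫⁻ x, localMaximal σ h x ^ (r / m) := by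
        rw [lintegral_mul_const' _ _ hBt, mul_comm]
    _ ≤ B * (K * ∏ i, (∫⁻ x, ‖h i x‖ₑ ^ r) ^ (1 / (m : ℝ))) := mul_le_mul_right (hK h hhm) _
    _ = _ := by
        simp_rw [hhn, ← ENNReal.rpow_mul, hsr]
        rw [ENNReal.coe_mul, ENNReal.coe_toNNReal hBt, mul_assoc]

/-- The essential bound on the product holds off a null set of `V`, and almost every `x` has no
dilate charging that set. -/
theorem eLpNorm_top_localMaximal_le (hC : HasMaximalBound (diagonal m d) σ r C)
    (hr : 1 ≤ r) (f : Fin m → EuclideanSpace ℝ (Fin d) → ℂ) :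
    eLpNorm (localMaximal σ f) ⊤ volume ≤ σ Set.univ * ∏ i, eLpNorm (f i) ⊤ volume := by
  have h1 : ∀ᵐ v : BlockSpace m d, ‖∏ i, f i (v i)‖ₑ ≤ ∏ i, eLpNorm (f i) ⊤ volume := by
    filter_upwards [ae_all_iff.2 fun i => (quasiMeasurePreserving_apply (m := m) i).ae
      (ae_le_eLpNormEssSup (f := f i))] with v hv
    rw [enorm_finset_prod]
    simp_rw [eLpNorm_exponent_top]
    exact Finset.prod_le_prod' fun i _ => hv i
  have h2 := ae_measure_preimage_eq_zero hC (by linarith) h1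
  rw [eLpNorm_exponent_top]
  refine eLpNormEssSup_le_of_ae_enorm_bound ?_
  filter_upwards [h2] with x hx
  rw [enorm_eq_self]
  refine iSup₂_le fun t ht => (enorm_integral_le_lintegral_enorm _).trans ?_
  have h3 : ∀ᵐ y ∂σ, ‖∏ i, f i (x - t • y i)‖ₑ ≤ ∏ i, eLpNorm (f i) ⊤ volume := hx t ht
  refine (lintegral_mono_ae h3).trans ?_
  rw [lintegral_const, mul_comm]

theorem exists_localMaximal_bound (hC : HasMaximalBound (diagonal m d) σ r C)
    (hr : 1 ≤ r) (hrm : r ≤ m) (hR : ∀ᵐ y ∂σ, ‖y‖ ≤ R) {p : ℝ≥0∞} (hrp : ENNReal.ofReal r ≤ p) :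
    ∃ K : ℝ≥0, ∀ f : Fin m → EuclideanSpace ℝ (Fin d) → ℂ, (∀ i, MemLp (f i) p volume) →
      (∀ᵐ x, ∀ t ∈ Set.Ioo (1 : ℝ) 2,
        Integrable (fun y : BlockSpace m d => ∏ i, f i (x - t • y i)) σ) ∧
      MemLp (localMaximal σ f) (p / m) volume ∧
      eLpNorm (localMaximal σ f) (p / m) volume ≤ K * ∏ i, eLpNorm (f i) p volume := by
  have hr0 : 0 < r := by linarith
  have hm0 : (0 : ℝ) < m := by linarith
  have hm0' : m ≠ 0 := by rintro rfl; simp at hm0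
  suffices h : ∃ K : ℝ≥0, ∀ f : Fin m → EuclideanSpace ℝ (Fin d) → ℂ,
      (∀ i, MemLp (f i) p volume) →
        eLpNorm (localMaximal σ f) (p / m) volume ≤ K * ∏ i, eLpNorm (f i) p volume by
    obtain ⟨K, hK⟩ := h
    refine ⟨K, fun f hf => ?_⟩
    obtain ⟨h1, h2⟩ := ae_integrable_and_aemeasurable_localMaximal hC hr hR hf hrp
    exact ⟨h1, ⟨h2.aestronglyMeasurable, (hK f hf).trans_lt (ENNReal.mul_lt_top ENNReal.coe_lt_top
      (ENNReal.prod_lt_top fun i _ => (hf i).2))⟩, hK f hf⟩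
  rcases eq_or_ne p ⊤ with rfl | hp
  · refine ⟨(σ Set.univ).toNNReal, fun f _ => ?_⟩
    rw [ENNReal.top_div_of_ne_top (ENNReal.natCast_ne_top m),
      ENNReal.coe_toNNReal (measure_ne_top _ _)]
    exact eLpNorm_top_localMaximal_le hC hr f
  · obtain ⟨p, rfl⟩ : ∃ p' : ℝ, p = ENNReal.ofReal p' := ⟨p.toReal, (ENNReal.ofReal_toReal hp).symm⟩
    have hp0 : 0 < p := by
      have := (ENNReal.ofReal_pos.2 hr0).trans_le hrp
      exact ENNReal.ofReal_pos.1 this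
    have hrp' : r ≤ p := (ENNReal.ofReal_le_ofReal_iff hp0.le).1 hrp
    obtain ⟨K, hK⟩ := exists_lintegral_localMaximal_rpow_le_of_le hC hr hrm hR hrp'
    have hq0 : 0 < p / m := by positivity
    have hdiv : ENNReal.ofReal p / (m : ℝ≥0∞) = ENNReal.ofReal (p / m) := by
      rw [ENNReal.ofReal_div_of_pos hm0, ENNReal.ofReal_natCast]
    have hKt : (K : ℝ≥0∞) ^ (1 / (p / m)) ≠ ⊤ :=
      ENNReal.rpow_ne_top_of_nonneg (by positivity) ENNReal.coe_ne_top
    refine ⟨((K : ℝ≥0∞) ^ (1 / (p / m))).toNNReal, fun f hf => ?_⟩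
    rw [ENNReal.coe_toNNReal hKt, hdiv,
      eLpNorm_eq_lintegral_rpow_enorm_toReal (by simpa using hq0) ENNReal.ofReal_ne_top,
      ENNReal.toReal_ofReal hq0.le]
    simp_rw [eLpNorm_eq_lintegral_rpow_enorm_toReal (ENNReal.ofReal_pos.2 hp0).ne'
      ENNReal.ofReal_ne_top, ENNReal.toReal_ofReal hp0.le, enorm_eq_self]
    refine (ENNReal.rpow_le_rpow (hK f hf) (by positivity)).trans (le_of_eq ?_)
    rw [ENNReal.mul_rpow_of_nonneg _ _ (by positivity),
      ← ENNReal.prod_rpow_of_nonneg (by positivity)]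
    congr 1
    refine Finset.prod_congr rfl fun i _ => ?_
    rw [← ENNReal.rpow_mul]
    congr 1
    field_simp

end Blocks

/-! ### Uniform nonstationary phase -/

section NonstationaryPhase

open Filter Topology

universe u

variable {T : Type u} [NormedAddCommGroup T] [InnerProductSpace ℝ T] [FiniteDimensional ℝ T]
  [MeasurableSpace T] [BorelSpace T] {ι : Type*} {U : ι → Set T} {v : ι → T}

/-- The functions `F i` and their derivatives along `v i` up to order `n` are bounded on `U i`,
uniformly in `i`. -/
def UnifBounded (U : ι → Set T) (v : ι → T) : ℕ → (ι → T → ℂ) → Prop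
  | 0, F => ∃ C : ℝ, ∀ i, ∀ x ∈ U i, ‖F i x‖ ≤ C
  | n + 1, F => (∃ C : ℝ, ∀ i, ∀ x ∈ U i, ‖F i x‖ ≤ C) ∧
      UnifBounded U v n fun i x => fderiv ℝ (F i) x (v i)

namespace UnifBounded

theorem bound {n : ℕ} {F : ι → T → ℂ} (h : UnifBounded U v n F) :
    ∃ C : ℝ, 0 ≤ C ∧ ∀ i, ∀ x ∈ U i, ‖F i x‖ ≤ C := by
  obtain ⟨C, hC⟩ : ∃ C : ℝ, ∀ i, ∀ x ∈ U i, ‖F i x‖ ≤ C := by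
    cases n with
    | zero => exact h
    | succ n => exact h.1
  exact ⟨max C 0, le_max_right _ _, fun i x hx => (hC i x hx).trans (le_max_left _ _)⟩

theorem of_succ {n : ℕ} {F : ι → T → ℂ} (h : UnifBounded U v (n + 1) F) : UnifBounded U v n F := by
  induction n generalizing F with
  | zero => exact h.1
  | succ n ih => exact ⟨h.1, ih h.2⟩

theorem congr (hU : ∀ i, IsOpen (U i)) {n : ℕ} {F G : ι → T → ℂ} (h : UnifBounded U v n F)
    (hFG : ∀ i, Set.EqOn (F i) (G i) (U i)) : UnifBounded U v n G := by
  induction n generalizing F G with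
  | zero =>
    obtain ⟨C, hC⟩ := h
    exact ⟨C, fun i x hx => by rw [← hFG i hx]; exact hC i x hx⟩
  | succ n ih =>
    obtain ⟨⟨C, hC⟩, h2⟩ := h
    refine ⟨⟨C, fun i x hx => by rw [← hFG i hx]; exact hC i x hx⟩, ih h2 fun i x hx => ?_⟩
    have : F i =ᶠ[𝓝 x] G i := (hFG i).eventuallyEq_of_mem ((hU i).mem_nhds hx)
    simp only [this.fderiv_eq]

theorem contDiffOn_fderiv {F : T → ℂ} {S : Set T} (hS : IsOpen S) (hF : ContDiffOn ℝ ∞ F S) (w : T) :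
    ContDiffOn ℝ ∞ (fun x => fderiv ℝ F x w) S :=
  (hF.fderiv_of_isOpen hS (by simp)).clm_apply contDiffOn_const

theorem differentiableAt {F : T → ℂ} {S : Set T} (hS : IsOpen S) (hF : ContDiffOn ℝ ∞ F S) {x : T}
    (hx : x ∈ S) : DifferentiableAt ℝ F x :=
  (hF.contDiffAt (hS.mem_nhds hx)).differentiableAt (by simp)

theorem add (hU : ∀ i, IsOpen (U i)) {n : ℕ} {F G : ι → T → ℂ}
    (hF : ∀ i, ContDiffOn ℝ ∞ (F i) (U i)) (hG : ∀ i, ContDiffOn ℝ ∞ (G i) (U i))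
    (h1 : UnifBounded U v n F) (h2 : UnifBounded U v n G) :
    UnifBounded U v n fun i x => F i x + G i x := by
  have hb : ∃ C : ℝ, ∀ i, ∀ x ∈ U i, ‖F i x + G i x‖ ≤ C := by
    obtain ⟨C1, -, hC1⟩ := h1.bound
    obtain ⟨C2, -, hC2⟩ := h2.bound
    exact ⟨C1 + C2, fun i x hx => (norm_add_le _ _).trans (add_le_add (hC1 i x hx) (hC2 i x hx))⟩
  induction n generalizing F G with
  | zero => exact hb
  | succ n ih =>
    refine ⟨hb, (ih (fun i => contDiffOn_fderiv (hU i) (hF i) (v i))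
      (fun i => contDiffOn_fderiv (hU i) (hG i) (v i)) h1.2 h2.2 ?_).congr hU fun i x hx => ?_⟩
    · obtain ⟨C1, -, hC1⟩ := h1.2.bound
      obtain ⟨C2, -, hC2⟩ := h2.2.bound
      exact ⟨C1 + C2, fun i x hx =>
        (norm_add_le _ _).trans (add_le_add (hC1 i x hx) (hC2 i x hx))⟩
    · simp only
      rw [fderiv_fun_add (differentiableAt (hU i) (hF i) hx) (differentiableAt (hU i) (hG i) hx)]
      rfl

theorem mul (hU : ∀ i, IsOpen (U i)) {n : ℕ} {F G : ι → T → ℂ}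
    (hF : ∀ i, ContDiffOn ℝ ∞ (F i) (U i)) (hG : ∀ i, ContDiffOn ℝ ∞ (G i) (U i))
    (h1 : UnifBounded U v n F) (h2 : UnifBounded U v n G) :
    UnifBounded U v n fun i x => F i x * G i x := by
  have hb : ∃ C : ℝ, ∀ i, ∀ x ∈ U i, ‖F i x * G i x‖ ≤ C := by
    obtain ⟨C1, hC0, hC1⟩ := h1.bound
    obtain ⟨C2, -, hC2⟩ := h2.bound
    exact ⟨C1 * C2, fun i x hx => by
      rw [norm_mul]; exact mul_le_mul (hC1 i x hx) (hC2 i x hx) (norm_nonneg _) hC0⟩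
  induction n generalizing F G with
  | zero => exact hb
  | succ n ih =>
    have hF' (i) := contDiffOn_fderiv (hU i) (hF i) (v i)
    have hG' (i) := contDiffOn_fderiv (hU i) (hG i) (v i)
    have hmul {A B : ι → T → ℂ} (hA : ∀ i, ContDiffOn ℝ ∞ (A i) (U i))
        (hB : ∀ i, ContDiffOn ℝ ∞ (B i) (U i)) (a : UnifBounded U v n A)
        (b : UnifBounded U v n B) : UnifBounded U v n fun i x => A i x * B i x := by
      refine ih hA hB a b ?_
      obtain ⟨C1, hC0, hC1⟩ := a.bound
      obtain ⟨C2, -, hC2⟩ := b.bound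
      exact ⟨C1 * C2, fun i x hx => by
        rw [norm_mul]; exact mul_le_mul (hC1 i x hx) (hC2 i x hx) (norm_nonneg _) hC0⟩
    refine ⟨hb, (add hU (fun i => (hF i).mul (hG' i)) (fun i => (hF' i).mul (hG i))
      (hmul hF hG' h1.of_succ h2.2) (hmul hF' hG h1.2 h2.of_succ)).congr hU fun i x hx => ?_⟩
    simp only
    rw [fderiv_fun_mul (differentiableAt (hU i) (hF i) hx) (differentiableAt (hU i) (hG i) hx)]
    simp only [add_apply, smul_apply, smul_eq_mul]
    ring

theorem const {n : ℕ} {K : ι → ℂ} {C : ℝ} (hK : ∀ i, ‖K i‖ ≤ C) :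
    UnifBounded U v n fun i _ => K i := by
  induction n generalizing K C with
  | zero => exact ⟨C, fun i _ _ => hK i⟩
  | succ n ih =>
    refine ⟨⟨C, fun i _ _ => hK i⟩, ?_⟩
    simp only [fderiv_fun_const, Pi.zero_apply, zero_apply]
    exact ih (K := fun _ => 0) (C := 0) (by simp)

/-- Induction through `(1/F)' = -F' (1/F)²`: the derivative involves `1/F` only to lower order. -/
theorem inv (hU : ∀ i, IsOpen (U i)) {n : ℕ} {F : ι → T → ℂ}
    (hF : ∀ i, ContDiffOn ℝ ∞ (F i) (U i)) (h : UnifBounded U v n F) {c : ℝ} (hc : 0 < c)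
    (hFc : ∀ i, ∀ x ∈ U i, c ≤ ‖F i x‖) : UnifBounded U v n fun i x => (F i x)⁻¹ := by
  have hb : ∃ C : ℝ, ∀ i, ∀ x ∈ U i, ‖(F i x)⁻¹‖ ≤ C :=
    ⟨c⁻¹, fun i x hx => by rw [norm_inv]; exact inv_anti₀ hc (hFc i x hx)⟩
  have hne (i) (x) (hx : x ∈ U i) : F i x ≠ 0 := norm_pos_iff.1 (hc.trans_le (hFc i x hx))
  induction n with
  | zero => exact hb
  | succ n ih =>
    have hI (i) : ContDiffOn ℝ ∞ (fun x => (F i x)⁻¹) (U i) := (hF i).inv (hne i)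
    have hF' (i) := contDiffOn_fderiv (hU i) (hF i) (v i)
    have ihn := ih h.of_succ
    refine ⟨hb, (mul hU (fun i => contDiffOn_const) (fun i => (hF' i).mul ((hI i).mul (hI i)))
      (const (K := fun _ => -1) (C := 1) (by simp))
      (mul hU hF' (fun i => (hI i).mul (hI i)) h.2 (mul hU hI hI ihn ihn))).congr hU
        fun i x hx => ?_⟩
    have h1 := ((differentiableAt (hU i) (hF i) hx).hasFDerivAt)
    have h2 := (hasDerivAt_inv (hne i x hx)).hasFDerivAt.restrictScalars ℝ
    have h3 := (h2.comp x h1).fderiv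
    simp only [Function.comp_def] at h3
    simp only [h3]
    simp [pow_two]

variable {K : Type u} [NormedAddCommGroup K] [NormedSpace ℝ K]

/-- The target `K` is arbitrary for the sake of the induction: differentiating replaces `f` by its
derivative, with values in `T →L[ℝ] K`, and the functional by its composition with evaluation at `v
i`. -/
theorem comp_translate {f : T → K} (hf : ContDiff ℝ ∞ f) (hfs : HasCompactSupport f) {n : ℕ}
    {ℓ : ι → K →L[ℝ] ℂ} {C : ℝ} (hℓ : ∀ i, ‖ℓ i‖ ≤ C) (hv : ∀ i, ‖v i‖ ≤ 1) (w : ι → T) :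
    UnifBounded U v n fun i x => ℓ i (f (x + w i)) := by
  induction n generalizing K C with
  | zero =>
    obtain ⟨M, hM⟩ := hfs.exists_bound_of_continuous hf.continuous
    refine ⟨C * M, fun i x _ => ((ℓ i).le_opNorm _).trans ?_⟩
    exact mul_le_mul (hℓ i) (hM _) (norm_nonneg _) ((norm_nonneg _).trans (hℓ i))
  | succ n ih =>
    refine ⟨?_, ?_⟩
    · obtain ⟨M, hM⟩ := hfs.exists_bound_of_continuous hf.continuous
      refine ⟨C * M, fun i x _ => ((ℓ i).le_opNorm _).trans ?_⟩
      exact mul_le_mul (hℓ i) (hM _) (norm_nonneg _) ((norm_nonneg _).trans (hℓ i))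
    · have := ih (f := fderiv ℝ f) (hf.fderiv_right (by simp)) (hfs.fderiv ℝ)
        (ℓ := fun i => (ℓ i).comp (ContinuousLinearMap.apply ℝ K (v i))) (C := C) (fun i => ?_)
      · convert! this using 3 with i x
        have h1 : DifferentiableAt ℝ f (x + w i) := hf.differentiable (by simp) _
        have h2 := ((ℓ i).hasFDerivAt.comp x ((h1.hasFDerivAt.comp x
          ((hasFDerivAt_id x).add_const (w i))))).fderiv
        simp only [Function.comp_def, id] at h2
        rw [h2]
        simp
      · refine (ContinuousLinearMap.opNorm_comp_le _ _).trans ?_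
        have h0 : ‖ContinuousLinearMap.apply ℝ K (v i)‖ ≤ 1 := by
          refine ContinuousLinearMap.opNorm_le_bound _ zero_le_one fun L => ?_
          rw [ContinuousLinearMap.apply_apply, one_mul]
          exact (L.le_opNorm _).trans (mul_le_of_le_one_right (norm_nonneg _) (hv i))
        exact (mul_le_of_le_one_right (norm_nonneg _) h0).trans (hℓ i)

/-- The mean value inequality bounds a difference quotient by the derivative, uniformly in the
shift; derivatives of the quotient are quotients of the derivative, so the same induction applies.
-/
theorem comp_difference {f : T → K} (hf : ContDiff ℝ ∞ f) (hfs : HasCompactSupport f) {n : ℕ}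
    {ℓ : ι → K →L[ℝ] ℂ} {C : ℝ} (hℓ : ∀ i, ‖ℓ i‖ ≤ C) (hv : ∀ i, ‖v i‖ ≤ 1) (w : ι → T) :
    UnifBounded U v n fun i x => ℓ i (‖w i‖⁻¹ • (f (x + w i) - f x)) := by
  have hb {K : Type u} [NormedAddCommGroup K] [NormedSpace ℝ K] {f : T → K} (hf : ContDiff ℝ ∞ f)
      (hfs : HasCompactSupport f) {ℓ : ι → K →L[ℝ] ℂ} {C : ℝ} (hℓ : ∀ i, ‖ℓ i‖ ≤ C) :
      ∃ C' : ℝ, ∀ i, ∀ x ∈ U i, ‖ℓ i (‖w i‖⁻¹ • (f (x + w i) - f x))‖ ≤ C' := by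
    obtain ⟨M, hM⟩ := (hfs.fderiv ℝ).exists_bound_of_continuous (hf.continuous_fderiv (by simp))
    have hM0 : 0 ≤ M := (norm_nonneg _).trans (hM 0)
    refine ⟨C * M, fun i x _ => ((ℓ i).le_opNorm _).trans ?_⟩
    refine mul_le_mul (hℓ i) ?_ (norm_nonneg _) ((norm_nonneg _).trans (hℓ i))
    have h1 := convex_univ.norm_image_sub_le_of_norm_fderiv_le (𝕜 := ℝ) (f := f)
      (fun x _ => hf.differentiable (by simp) x) (fun x _ => hM x) (Set.mem_univ x)
      (Set.mem_univ (x + w i))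
    rw [add_sub_cancel_left] at h1
    rw [norm_smul, norm_inv, norm_norm]
    rcases (norm_nonneg (w i)).eq_or_lt with h0 | h0
    · rw [← h0]; simpa using hM0
    · rwa [inv_mul_le_iff₀ h0, mul_comm]
  induction n generalizing K C with
  | zero => exact hb hf hfs hℓ
  | succ n ih =>
    refine ⟨hb hf hfs hℓ, ?_⟩
    have := ih (f := fderiv ℝ f) (hf.fderiv_right (by simp)) (hfs.fderiv ℝ)
      (ℓ := fun i => (ℓ i).comp (ContinuousLinearMap.apply ℝ K (v i))) (C := C) (fun i => ?_)
    · convert! this using 3 with i x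
      have h0 (y : T) : DifferentiableAt ℝ f y := hf.differentiable (by simp) _
      have h2 := ((ℓ i).hasFDerivAt.comp x ((((h0 (x + w i)).hasFDerivAt.comp x
        ((hasFDerivAt_id x).add_const (w i))).sub (h0 x).hasFDerivAt).const_smul
          (‖w i‖⁻¹))).fderiv
      simp only [Function.comp_def, id] at h2
      have h3 : (fun x => ℓ i (‖w i‖⁻¹ • (f (x + w i) - f x))) = fun x =>
        ℓ i ((‖w i‖⁻¹ • ((fun x => f (x + w i)) - f)) x) := rfl
      beta_reduce
      rw [h3, h2]
      simp
    · refine (ContinuousLinearMap.opNorm_comp_le _ _).trans ?_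
      have h0 : ‖ContinuousLinearMap.apply ℝ K (v i)‖ ≤ 1 := by
        refine ContinuousLinearMap.opNorm_le_bound _ zero_le_one fun L => ?_
        rw [ContinuousLinearMap.apply_apply, one_mul]
        exact (L.le_opNorm _).trans (mul_le_of_le_one_right (norm_nonneg _) (hv i))
      exact (mul_le_of_le_one_right (norm_nonneg _) h0).trans (hℓ i)

end UnifBounded

theorem contDiff_div_of_tsupport {b w : T → ℂ} (hb : ContDiff ℝ ∞ b) {S : Set T} (hS : IsOpen S)
    (hbS : tsupport b ⊆ S) (hw : ContDiffOn ℝ ∞ w S) (hw0 : ∀ x ∈ S, w x ≠ 0) :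
    ContDiff ℝ ∞ fun x => b x / w x := by
  rw [contDiff_iff_contDiffAt]
  intro x
  by_cases hx : x ∈ tsupport b
  · simp_rw [div_eq_mul_inv]
    exact hb.contDiffAt.mul ((hw.contDiffAt (hS.mem_nhds (hbS hx))).inv (hw0 x (hbS hx)))
  · have : (fun x => b x / w x) =ᶠ[𝓝 x] fun _ => 0 := by
      filter_upwards [notMem_tsupport_iff_eventuallyEq.1 hx] with y hy
      simp [hy]
    exact contDiffAt_const.congr_of_eventuallyEq this

theorem tsupport_div_subset (b w : T → ℂ) : tsupport (fun x => b x / w x) ⊆ tsupport b :=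
  closure_mono fun x hx h => hx (by simp [h])

theorem tsupport_fderiv_apply_subset (b : T → ℂ) (w : T) :
    tsupport (fun x => fderiv ℝ b x w) ⊆ tsupport b := by
  have : Function.support (fun x => fderiv ℝ b x w) ⊆ Function.support (fderiv ℝ b) :=
    fun x hx h => hx (by simp [h])
  exact (closure_mono this).trans (tsupport_fderiv_subset ℝ)

/-- On the support of `b` the phase factor is its own derivative along `e` divided by `i M w`;
integrating by parts moves that derivative to `b / w`. -/
theorem integral_mul_cexp_eq {b w : T → ℂ} (hb : ContDiff ℝ ∞ b) (hbs : HasCompactSupport b)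
    {S : Set T} (hS : IsOpen S) (hbS : tsupport b ⊆ S) (hw : ContDiffOn ℝ ∞ w S)
    (hw0 : ∀ x ∈ S, w x ≠ 0) {ψ : T → ℝ} (hψ : ContDiff ℝ ∞ ψ) {M : ℝ} (hM : 0 < M) {e : T}
    (hψw : ∀ x ∈ S, ((fderiv ℝ ψ x e : ℝ) : ℂ) = M * w x) :
    ∫ x, b x * Complex.exp (ψ x * Complex.I) = (Complex.I / M) *
      ∫ x, fderiv ℝ (fun x => b x / w x) x e * Complex.exp (ψ x * Complex.I) := by
  have hq := contDiff_div_of_tsupport hb hS hbS hw hw0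
  have hqs : HasCompactSupport fun x => b x / w x :=
    hbs.of_isClosed_subset (isClosed_tsupport _) (tsupport_div_subset b w)
  have hE : ContDiff ℝ ∞ fun x => Complex.exp (ψ x * Complex.I) :=
    ((Complex.ofRealCLM.contDiff.comp hψ).mul contDiff_const).cexp
  have hEd (x : T) : fderiv ℝ (fun x => Complex.exp (ψ x * Complex.I)) x e =
      Complex.exp (ψ x * Complex.I) * (((fderiv ℝ ψ x e : ℝ) : ℂ) * Complex.I) := by
    have h1 := (hψ.differentiable (by simp) x).hasFDerivAt
    have h2 := (((Complex.ofRealCLM.hasFDerivAt.comp x h1).mul_const Complex.I).cexp).fderiv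
    simp only [Function.comp_def, Complex.ofRealCLM_apply] at h2
    rw [h2]
    simp
    ring
  have hc {g h : T → ℂ} (hg : Continuous g) (hgs : HasCompactSupport g) (hh : Continuous h) :
      Integrable fun x => g x * h x := (hg.mul hh).integrable_of_hasCompactSupport hgs.mul_right
  have hqd : Continuous fun x => fderiv ℝ (fun x => b x / w x) x e :=
    (hq.continuous_fderiv (by simp)).clm_apply continuous_const
  have hqds : HasCompactSupport fun x => fderiv ℝ (fun x => b x / w x) x e :=
    hqs.fderiv_apply ℝ e
  have hEc : Continuous fun x => fderiv ℝ (fun x => Complex.exp (ψ x * Complex.I)) x e :=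
    (hE.continuous_fderiv (by simp)).clm_apply continuous_const
  have key := integral_mul_fderiv_eq_neg_fderiv_mul_of_integrable (μ := (volume : Measure T))
    (f := fun x => b x / w x) (g := fun x => Complex.exp (ψ x * Complex.I)) (v := e)
    (hc hqd hqds hE.continuous) (hc hq.continuous hqs hEc) (hc hq.continuous hqs hE.continuous)
    (fun x _ => hq.differentiable (by simp) x) (fun x _ => hE.differentiable (by simp) x)
  have h3 : ∫ x, b x / w x * fderiv ℝ (fun x => Complex.exp (ψ x * Complex.I)) x e =
      (M * Complex.I) * ∫ x, b x * Complex.exp (ψ x * Complex.I) := by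
    rw [← integral_const_mul]
    refine integral_congr_ae (.of_forall fun x => ?_)
    simp only [hEd]
    by_cases hx : x ∈ tsupport b
    · rw [hψw x (hbS hx)]
      have := hw0 x (hbS hx)
      field_simp
    · simp [image_eq_zero_of_notMem_tsupport hx]
  rw [h3] at key
  have hM' : (M : ℂ) ≠ 0 := by exact_mod_cast hM.ne'
  have h4 : (M : ℂ) * Complex.I ≠ 0 := mul_ne_zero hM' Complex.I_ne_zero
  rw [← mul_right_inj' h4, key, ← mul_assoc]
  have : (M : ℂ) * Complex.I * (Complex.I / M) = -1 := by
    field_simp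
    simp
  rw [this, neg_one_mul]

/-- Each integration by parts gains a factor `M i` and replaces the amplitude by the derivative of
`b / w`, which is again uniformly bounded with one order less. -/
theorem exists_norm_integral_mul_cexp_le (hU : ∀ i, IsOpen (U i)) {Q : Set T}
    (hQ : Bornology.IsBounded Q) (hUQ : ∀ i, U i ⊆ Q) {w : ι → T → ℂ} {ψ : ι → T → ℝ} {M : ι → ℝ}
    (hw : ∀ i, ContDiffOn ℝ ∞ (w i) (U i)) (hψ : ∀ i, ContDiff ℝ ∞ (ψ i)) (hM : ∀ i, 0 < M i)
    {c : ℝ} (hc : 0 < c) (hwc : ∀ i, ∀ x ∈ U i, c ≤ ‖w i x‖)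
    (hψw : ∀ i, ∀ x ∈ U i, ((fderiv ℝ (ψ i) x (v i) : ℝ) : ℂ) = M i * w i x) (N : ℕ)
    (hwN : UnifBounded U v N w) {b : ι → T → ℂ} (hb : ∀ i, ContDiff ℝ ∞ (b i))
    (hbs : ∀ i, HasCompactSupport (b i)) (hbU : ∀ i, tsupport (b i) ⊆ U i)
    (hbN : UnifBounded U v N b) :
    ∃ C : ℝ, 0 ≤ C ∧ ∀ i, ‖∫ x, b i x * Complex.exp (ψ i x * Complex.I)‖ * M i ^ N ≤ C := by
  induction N generalizing b with
  | zero =>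
    obtain ⟨C, hC0, hC⟩ := hbN.bound
    refine ⟨C * volume.real Q, by positivity, fun i => ?_⟩
    rw [pow_zero, mul_one]
    have h0 : ∀ x, x ∉ Q → b i x * Complex.exp (ψ i x * Complex.I) = 0 := fun x hx => by
      rw [image_eq_zero_of_notMem_tsupport fun h => hx (hUQ i (hbU i h)), zero_mul]
    rw [← setIntegral_eq_integral_of_forall_compl_eq_zero h0]
    refine norm_setIntegral_le_of_norm_le_const hQ.measure_lt_top fun x _ => ?_
    rw [norm_mul, Complex.norm_exp_ofReal_mul_I, mul_one]
    by_cases hx : x ∈ tsupport (b i)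
    · exact hC i x (hbU i hx)
    · rw [image_eq_zero_of_notMem_tsupport hx, norm_zero]
      exact hC0
  | succ N ih =>
    have hne (i) (x) (hx : x ∈ U i) : w i x ≠ 0 := norm_pos_iff.1 (hc.trans_le (hwc i x hx))
    have hq (i) := contDiff_div_of_tsupport (hb i) (hU i) (hbU i) (hw i) (hne i)
    have hsub (i) : tsupport (fun x => fderiv ℝ (fun x => b i x / w i x) x (v i)) ⊆
        tsupport (b i) := (tsupport_fderiv_apply_subset _ _).trans (tsupport_div_subset _ _)
    have hUB : UnifBounded U v (N + 1) fun i x => b i x / w i x := by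
      simp_rw [div_eq_mul_inv]
      exact UnifBounded.mul hU (fun i => (hb i).contDiffOn) (fun i => (hw i).inv (hne i)) hbN
        (UnifBounded.inv hU hw hwN hc hwc)
    obtain ⟨C, hC0, hC⟩ := ih hwN.of_succ
      (b := fun i x => fderiv ℝ (fun x => b i x / w i x) x (v i))
      (fun i => ((hq i).fderiv_right (by simp)).clm_apply contDiff_const)
      (fun i => (hbs i).of_isClosed_subset (isClosed_tsupport _) (hsub i))
      (fun i => (hsub i).trans (hbU i)) hUB.2
    refine ⟨C, hC0, fun i => ?_⟩
    rw [integral_mul_cexp_eq (hb i) (hbs i) (hU i) (hbU i) (hw i) (hne i) (hψ i) (hM i) (hψw i),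
      norm_mul, norm_div, Complex.norm_I, Complex.norm_real, Real.norm_of_nonneg (hM i).le]
    refine le_of_eq_of_le ?_ (hC i)
    rw [pow_succ', one_div, mul_mul_mul_comm, inv_mul_cancel₀ (hM i).ne', one_mul]

end NonstationaryPhase

/-! ### Decay of oscillatory integrals with a graph phase -/

section GraphPhase

open Filter Topology ComplexConjugate

variable {T : Type} [NormedAddCommGroup T] [InnerProductSpace ℝ T] [FiniteDimensional ℝ T]
  [MeasurableSpace T] [BorelSpace T]

theorem integrable_prod_of_integral_norm_le {X : Type*} [MeasurableSpace X] {μ : Measure X}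
    [IsFiniteMeasure μ] {f : T × X → ℂ} (hf : AEStronglyMeasurable f ((volume : Measure T).prod μ))
    (hi : ∀ q, Integrable fun v => f (v, q)) {C : ℝ} (hC : ∀ q, ∫ v, ‖f (v, q)‖ ≤ C) :
    Integrable f ((volume : Measure T).prod μ) := by
  rw [integrable_prod_iff' hf]
  refine ⟨.of_forall hi, (integrable_const C).mono' ?_ (.of_forall fun q => ?_)⟩
  · exact hf.norm.prod_swap.integral_prod_right'
  · rw [Real.norm_of_nonneg (integral_nonneg fun _ => norm_nonneg _)]
    exact hC q

/-- A van der Corput type inequality: the square of an integral is controlled by the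
autocorrelations along a subspace. -/
theorem exists_sq_integral_le_lintegral_autocorrelation (P : Submodule ℝ T) (ε : ℝ) : ∃ C : ℝ≥0,
    ∀ F : T → ℂ, Continuous F → tsupport F ⊆ Metric.ball 0 ε → ∀ H : P → ℝ≥0∞, Measurable H →
      (∀ h : P, ‖∫ v, F (v + h) * conj (F v)‖ₑ ≤ H h) → ‖∫ v, F v‖ₑ ^ 2 ≤ C * ∫⁻ h, H h := by
  set μB : Measure P := volume.restrict (Metric.closedBall 0 1) with hμB
  have hfin : IsFiniteMeasure μB :=
    ⟨by rw [hμB, Measure.restrict_apply_univ]; exact measure_closedBall_lt_top⟩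
  set β : ℝ≥0∞ := μB Set.univ with hβ
  have hβ0 : β ≠ 0 := by
    rw [hβ, hμB, Measure.restrict_apply_univ]
    exact (Metric.measure_closedBall_pos _ _ one_pos).ne'
  have hβt : β ≠ ⊤ := measure_ne_top _ _
  set K := Metric.closedBall (0 : T) (ε + 1)
  have hKt : volume K ≠ ⊤ := measure_closedBall_lt_top.ne
  set C : ℝ≥0∞ := β⁻¹ ^ 2 * (volume K * β) with hC
  have hCt : C ≠ ⊤ := ENNReal.mul_ne_top (ENNReal.pow_ne_top (ENNReal.inv_ne_top.2 hβ0))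
    (ENNReal.mul_ne_top hKt hβt)
  refine ⟨C.toNNReal, fun F hF hFs H hH hFH => ?_⟩
  rw [ENNReal.coe_toNNReal hCt]
  have hFcs : HasCompactSupport F :=
    (isCompact_closedBall (0 : T) ε).of_isClosed_subset (isClosed_tsupport _)
      (hFs.trans Metric.ball_subset_closedBall)
  have hFi : Integrable F := hF.integrable_of_hasCompactSupport hFcs
  obtain ⟨M, hM⟩ := hFcs.exists_bound_of_continuous hF
  -- Averaging `F` over the unit ball of `P` only multiplies its integral by the volume of that
  -- ball.
  set G : T → ℂ := fun v => ∫ h, F (v + (h : T)) ∂μB with hG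
  have hG1 : ∫ v, G v = β.toReal * ∫ v, F v := by
    rw [hG, integral_integral_swap]
    · simp_rw [integral_add_right_eq_self F]
      rw [integral_const, Complex.real_smul]
      rfl
    · refine integrable_prod_of_integral_norm_le (C := ∫ v, ‖F v‖) ?_ ?_ ?_
      · exact (by fun_prop : Continuous _).aestronglyMeasurable
      · exact fun q => hFi.comp_add_right (q : T)
      · intro q
        exact (integral_add_right_eq_self (fun v => ‖F v‖) (q : T)).le
  have hGc : Continuous G := by
    refine continuous_of_dominated (bound := fun _ => M)
      (fun x => (by fun_prop : Continuous _).aestronglyMeasurable)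
      (fun x => .of_forall fun y => hM _) (integrable_const M) (.of_forall fun y => by fun_prop)
  have hG0 (v : T) (hv : v ∉ K) : G v = 0 := by
    refine integral_eq_zero_of_ae ?_
    filter_upwards [ae_restrict_mem Metric.isClosed_closedBall.measurableSet] with h hh
    refine image_eq_zero_of_notMem_tsupport fun hm => hv ?_
    have h1 := hFs hm
    rw [mem_ball_zero_iff] at h1
    rw [mem_closedBall_zero_iff] at hh ⊢
    have h2 : ‖v‖ ≤ ‖v + (h : T)‖ + ‖(h : T)‖ := by
      simpa using norm_sub_le (v + (h : T)) (h : T)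
    rw [Submodule.coe_norm] at hh
    linarith
  -- Cauchy–Schwarz on the bounded set `K` that contains the support of `G`.
  have hCS : ‖∫ v, G v‖ₑ ^ 2 ≤ volume K * ∫⁻ v, ‖G v‖ₑ ^ 2 := by
    rw [← setIntegral_eq_integral_of_forall_compl_eq_zero hG0]
    calc _ ≤ (∫⁻ v in K, ‖G v‖ₑ) ^ 2 := by gcongr; exact enorm_integral_le_lintegral_enorm _
      _ ≤ (volume.restrict K) Set.univ * ∫⁻ v in K, ‖G v‖ₑ ^ 2 :=
          sq_lintegral_le _ hGc.enorm.measurable.aemeasurable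
      _ ≤ _ := by
          rw [Measure.restrict_apply_univ]
          exact mul_le_mul_right (setLIntegral_le_lintegral _ _) _
  have hGcs : HasCompactSupport fun v => ‖G v‖ ^ 2 :=
    HasCompactSupport.of_support_subset_isCompact (isCompact_closedBall (0 : T) (ε + 1))
      fun v hv => by by_contra h; exact hv (by simp [hG0 v h])
  have hGG : ∫⁻ v, ‖G v‖ₑ ^ 2 = ‖∫ v, G v * conj (G v)‖ₑ := by
    have h1 : ∫ v, G v * conj (G v) = ((∫ v, ‖G v‖ ^ 2 : ℝ) : ℂ) := by
      rw [← integral_complex_ofReal]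
      refine integral_congr_ae (.of_forall fun v => ?_)
      simp only
      rw [Complex.mul_conj, Complex.normSq_eq_norm_sq]
    have hi : Integrable fun v => ‖G v‖ ^ 2 :=
      (hGc.norm.pow 2).integrable_of_hasCompactSupport hGcs
    rw [h1, ← ofReal_norm, Complex.norm_real, Real.norm_of_nonneg (integral_nonneg fun v =>
      by positivity), ofReal_integral_eq_lintegral_ofReal hi (.of_forall fun v => by positivity)]
    refine lintegral_congr fun v => ?_
    rw [← ofReal_norm, ENNReal.ofReal_pow (norm_nonneg _)]
  have hprod (v : T) : G v * conj (G v) =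
      ∫ q : P × P, F (v + (q.1 : T)) * conj (F (v + (q.2 : T))) ∂(μB.prod μB) := by
    rw [integral_prod_mul (fun h : P => F (v + (h : T))) (fun h : P => conj (F (v + (h : T)))),
      integral_conj]
  have hswap : ∫ v, G v * conj (G v) = ∫ q : P × P,
      (∫ v, F (v + (q.1 : T)) * conj (F (v + (q.2 : T)))) ∂(μB.prod μB) := by
    simp_rw [hprod]
    rw [integral_integral_swap]
    refine integrable_prod_of_integral_norm_le (C := (∫ v, ‖F v‖) * M) ?_ ?_ ?_
    · exact (by fun_prop : Continuous _).aestronglyMeasurable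
    · intro q
      exact (hFi.comp_add_right (q.1 : T)).mul_bdd (c := M) (by fun_prop : Continuous _).aestronglyMeasurable
        (.of_forall fun v => by simpa using hM _)
    · intro q
      calc _ ≤ ∫ v, ‖F (v + (q.1 : T))‖ * M := by
            refine integral_mono_of_nonneg (.of_forall fun _ => norm_nonneg _)
              ((hFi.comp_add_right _).norm.mul_const M) (.of_forall fun v => ?_)
            simp only [Function.uncurry, norm_mul, RCLike.norm_conj]
            exact mul_le_mul_of_nonneg_left (hM _) (norm_nonneg _)
        _ = _ := by
            rw [integral_mul_const, integral_add_right_eq_self (fun v => ‖F v‖) (q.1 : T)]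
  -- By translation invariance the correlation of two shifts depends only on their difference, so
  -- the double integral over shifts collapses to one over `P`.
  have hk (q : P × P) : ‖∫ v, F (v + (q.1 : T)) * conj (F (v + (q.2 : T)))‖ₑ ≤ H (q.1 - q.2) := by
    refine le_trans (le_of_eq ?_) (hFH (q.1 - q.2))
    rw [← integral_add_right_eq_self (fun v => F (v + ((q.1 - q.2 : P) : T)) * conj (F v)) (q.2 : T)]
    simp
  have hfinal : ‖∫ v, G v * conj (G v)‖ₑ ≤ β * ∫⁻ h, H h := by
    rw [hswap]
    refine (enorm_integral_le_lintegral_enorm _).trans ((lintegral_mono hk).trans ?_)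
    have hHm : Measurable fun q : P × P => H (q.1 - q.2) :=
      hH.comp (measurable_fst.sub measurable_snd)
    rw [lintegral_prod_symm _ hHm.aemeasurable]
    calc _ ≤ ∫⁻ _ : P, (∫⁻ h, H h) ∂μB := by
          refine lintegral_mono fun y => ?_
          refine (setLIntegral_le_lintegral _ _).trans (le_of_eq ?_)
          simp only
          exact lintegral_sub_right_eq_self H y
      _ = _ := by rw [lintegral_const, mul_comm]
  have hβF : ‖∫ v, F v‖ₑ = β⁻¹ * ‖∫ v, G v‖ₑ := by
    rw [hG1, enorm_mul]
    have : ‖((β.toReal : ℝ) : ℂ)‖ₑ = β := by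
      rw [← ofReal_norm, Complex.norm_real, Real.norm_of_nonneg ENNReal.toReal_nonneg,
        ENNReal.ofReal_toReal hβt]
    rw [this, ← mul_assoc, ENNReal.inv_mul_cancel hβ0 hβt, one_mul]
  calc ‖∫ v, F v‖ₑ ^ 2 = β⁻¹ ^ 2 * ‖∫ v, G v‖ₑ ^ 2 := by rw [hβF, mul_pow]
    _ ≤ β⁻¹ ^ 2 * (volume K * (β * ∫⁻ h, H h)) := by
        refine mul_le_mul_right (hCS.trans (mul_le_mul_right ?_ _)) _
        rw [hGG]
        exact hfinal
    _ = _ := by rw [hC]; ring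

/-- Scaling `h` by `s` produces the factor `s^(-dim P)`; the exponent `dim P + 1` makes the profile
integrable. -/
theorem exists_lintegral_rpow_one_add_le (P : Submodule ℝ T) : ∃ C : ℝ≥0, ∀ s : ℝ, 0 < s →
    ∫⁻ h : P, ENNReal.ofReal ((1 + s * ‖h‖) ^ (-(Module.finrank ℝ P + 1 : ℝ))) *
      ENNReal.ofReal s ^ Module.finrank ℝ P ≤ C := by
  set κ := Module.finrank ℝ P
  have hi : Integrable fun h : P => (1 + ‖h‖) ^ (-(κ + 1 : ℝ)) :=
    integrable_one_add_norm (by linarith)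
  have h0 (x : P) : 0 ≤ (1 + ‖x‖) ^ (-(κ + 1 : ℝ)) := by positivity
  refine ⟨(∫ h : P, (1 + ‖h‖) ^ (-(κ + 1 : ℝ))).toNNReal, fun s hs => ?_⟩
  have h1 := Measure.integral_comp_smul (volume : Measure P)
    (fun h : P => (1 + ‖h‖) ^ (-(κ + 1 : ℝ))) s
  have hn (h : P) : (1 + ‖s • h‖) ^ (-(κ + 1 : ℝ)) = (1 + s * ‖h‖) ^ (-(κ + 1 : ℝ)) := by
    rw [norm_smul, Real.norm_of_nonneg hs.le]
  have hi2 : Integrable fun h : P => (1 + ‖s • h‖) ^ (-(κ + 1 : ℝ)) := hi.comp_smul hs.ne'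
  simp_rw [← hn]
  rw [lintegral_mul_const' _ _ (ENNReal.pow_ne_top ENNReal.ofReal_ne_top),
    ← ofReal_integral_eq_lintegral_ofReal hi2 (.of_forall fun h => h0 _), h1,
    ← ENNReal.ofReal_pow hs.le, ← ENNReal.ofReal_mul (by
      rw [smul_eq_mul]; exact mul_nonneg (abs_nonneg _) (integral_nonneg h0))]
  rw [abs_of_pos (by positivity), smul_eq_mul, mul_right_comm, inv_mul_cancel₀ (by positivity),
    one_mul]
  exact le_rfl

variable {φ : T → ℝ}

/-- When `|s| ≤ ‖τ‖` the linear term wins: along `τ / ‖τ‖` the phase has derivative at least `‖τ‖ /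
2`, because the gradient of `φ` is at most `1/2` on the ball. -/
theorem exists_norm_integral_linear_phase_le (hφ : ContDiff ℝ ∞ φ) (hφs : HasCompactSupport φ)
    {ε : ℝ} (hφε : ∀ x ∈ Metric.ball (0 : T) ε, ‖fderiv ℝ φ x‖ ≤ 1 / 2) {a : T → ℂ}
    (ha : ContDiff ℝ ∞ a) (has : HasCompactSupport a) (haε : tsupport a ⊆ Metric.ball 0 ε) (N : ℕ) :
    ∃ C : ℝ, 0 ≤ C ∧ ∀ (τ : T) (s : ℝ), τ ≠ 0 → |s| ≤ ‖τ‖ →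
      ‖∫ x, a x * Complex.exp ((⟪τ, x⟫_ℝ + s * φ x : ℝ) * Complex.I)‖ * ‖τ‖ ^ N ≤ C := by
  set ι := {q : T × ℝ // q.1 ≠ 0 ∧ |q.2| ≤ ‖q.1‖}
  have hpos (i : ι) : 0 < ‖i.1.1‖ := norm_pos_iff.2 i.2.1
  set v : ι → T := fun i => ‖i.1.1‖⁻¹ • i.1.1 with hv
  have hv1 (i) : ‖v i‖ = 1 := by
    rw [hv, norm_smul, norm_inv, norm_norm, inv_mul_cancel₀ (hpos i).ne']
  set U : ι → Set T := fun _ => Metric.ball 0 ε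
  set ℓ : ι → (T →L[ℝ] ℝ) →L[ℝ] ℂ := fun i =>
    (i.1.2 / ‖i.1.1‖) • (Complex.ofRealCLM.comp (ContinuousLinearMap.apply ℝ ℝ (v i))) with hℓ
  have hq (i : ι) : |i.1.2 / ‖i.1.1‖| ≤ 1 := by
    rw [abs_div, abs_norm]; exact div_le_one_of_le₀ i.2.2 (norm_nonneg _)
  have hℓa (i : ι) (L : T →L[ℝ] ℝ) : ℓ i L = ((i.1.2 / ‖i.1.1‖ * L (v i) : ℝ) : ℂ) := by
    simp [hℓ]
  have hℓb (i : ι) (L : T →L[ℝ] ℝ) : ‖ℓ i L‖ ≤ ‖L‖ := by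
    rw [hℓa, Complex.norm_real, norm_mul, Real.norm_eq_abs (_ / _)]
    refine (mul_le_of_le_one_left (norm_nonneg _) (hq i)).trans ?_
    simpa [hv1] using L.le_opNorm (v i)
  have hℓ1 (i) : ‖ℓ i‖ ≤ 1 := ContinuousLinearMap.opNorm_le_bound _ zero_le_one fun L => by
    rw [one_mul]; exact hℓb i L
  -- The derivative of the phase along `v i`, divided by `‖τ‖`. The trivial shift `x + 0` matches
  -- the form of `UnifBounded.comp_translate`.
  set w : ι → T → ℂ := fun i x => 1 + ℓ i (fderiv ℝ φ (x + 0)) with hw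
  have hDφ : ContDiff ℝ ∞ (fderiv ℝ φ) := hφ.fderiv_right (by simp)
  have hU (i : ι) : IsOpen (U i) := Metric.isOpen_ball
  have hwc (i) : ContDiff ℝ ∞ fun x => ℓ i (fderiv ℝ φ (x + 0)) := by
    simp only [add_zero]
    exact (ℓ i).contDiff.comp hDφ
  have hlow (i : ι) (x : T) (hx : x ∈ U i) : 1 / 2 ≤ ‖w i x‖ := by
    have h1 := (hℓb i (fderiv ℝ φ (x + 0))).trans
      ((congrArg (fun y => ‖fderiv ℝ φ y‖) (add_zero x)).le.trans (hφε x hx))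
    have h2 := norm_sub_le (w i x) (ℓ i (fderiv ℝ φ (x + 0)))
    simp only [hw, add_sub_cancel_right, norm_one] at h2 ⊢
    linarith
  have hder (i : ι) (x : T) (_ : x ∈ U i) :
      ((fderiv ℝ (fun x => ⟪i.1.1, x⟫_ℝ + i.1.2 * φ x) x (v i) : ℝ) : ℂ) = ‖i.1.1‖ * w i x := by
    have h1 := ((innerSL ℝ i.1.1).hasFDerivAt (x := x)).add
      ((hφ.differentiable (by simp) x).hasFDerivAt.const_mul i.1.2)
    have h2 : fderiv ℝ (fun x => ⟪i.1.1, x⟫_ℝ + i.1.2 * φ x) x = _ := h1.fderiv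
    rw [h2]
    simp only [hw, hℓa, add_zero, add_apply, smul_apply, innerSL_apply_apply, smul_eq_mul]
    have h3 : ⟪i.1.1, v i⟫_ℝ = ‖i.1.1‖ := by
      rw [hv, real_inner_smul_right, real_inner_self_eq_norm_sq, pow_two, ← mul_assoc,
        inv_mul_cancel₀ (hpos i).ne', one_mul]
    rw [h3]
    push_cast
    have : ((‖i.1.1‖ : ℝ) : ℂ) ≠ 0 := by exact_mod_cast (hpos i).ne'
    field_simp
  obtain ⟨C, hC0, hC⟩ := exists_norm_integral_mul_cexp_le (U := U) (v := v) hU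
    (Q := Metric.ball 0 ε) Metric.isBounded_ball (fun _ => subset_rfl) (w := w)
    (ψ := fun i x => ⟪i.1.1, x⟫_ℝ + i.1.2 * φ x) (M := fun i => ‖i.1.1‖)
    (fun i => (contDiff_const.add (hwc i)).contDiffOn)
    (fun i => (contDiff_const.inner ℝ contDiff_id).add (contDiff_const.mul hφ))
    hpos (c := 1 / 2) (by norm_num) hlow hder N
    (UnifBounded.add hU (fun i => contDiffOn_const) (fun i => (hwc i).contDiffOn)
      (UnifBounded.const (K := fun _ => 1) (C := 1) (by simp))
      (UnifBounded.comp_translate hDφ (hφs.fderiv ℝ) hℓ1 (fun i => (hv1 i).le) fun _ => 0))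
    (b := fun _ => a) (fun _ => ha) (fun _ => has) (fun _ => haε) (by
      have := UnifBounded.comp_translate (U := U) (v := v) (n := N) ha has
        (ℓ := fun _ => ContinuousLinearMap.id ℝ ℂ) (C := 1)
        (fun _ => ContinuousLinearMap.norm_id_le) (fun i => (hv1 i).le) (fun _ => 0)
      simpa using this)
  · exact ⟨C, hC0, fun τ s h1 h2 => hC ⟨(τ, s), h1, h2⟩⟩

/-- Along `e h` the phase `s (φ (x + h) - φ x)` has derivative at least `c |s| ‖h‖` in modulus, so
it is nowhere stationary. The direction `e h` may depend on `h` and need not lie in `P`. -/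
theorem exists_norm_autocorrelation_le (hφ : ContDiff ℝ ∞ φ) (hφs : HasCompactSupport φ)
    {P : Submodule ℝ T} {c : ℝ} (hc : 0 < c) {ε : ℝ} {e : P → T} (he : ∀ h, ‖e h‖ ≤ 1)
    (hφe : ∀ (h : P) (x : T), x ∈ Metric.ball (0 : T) ε → x + h ∈ Metric.ball (0 : T) ε →
      c * ‖h‖ ≤ |(fderiv ℝ φ (x + h) - fderiv ℝ φ x) (e h)|) {a : T → ℂ}
    (ha : ContDiff ℝ ∞ a) (has : HasCompactSupport a) (haε : tsupport a ⊆ Metric.ball 0 ε) (N : ℕ) :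
    ∃ C : ℝ, 0 ≤ C ∧ ∀ (s : ℝ) (h : P), s ≠ 0 → h ≠ 0 →
      ‖∫ x, (a (x + h) * conj (a x)) * Complex.exp ((s * (φ (x + h) - φ x) : ℝ) * Complex.I)‖ *
        (|s| * ‖h‖) ^ N ≤ C := by
  set ι := {q : ℝ × P // q.1 ≠ 0 ∧ q.2 ≠ 0}
  have hpos (i : ι) : 0 < ‖i.1.2‖ := norm_pos_iff.2 i.2.2
  set w : ι → T := fun i => (i.1.2 : T) with hwdef
  have hwn (i) : ‖w i‖ = ‖i.1.2‖ := rfl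
  set v : ι → T := fun i => e i.1.2 with hv
  set U : ι → Set T := fun i => {x | x ∈ Metric.ball 0 ε ∧ x + w i ∈ Metric.ball 0 ε}
  have hU (i : ι) : IsOpen (U i) := Metric.isOpen_ball.inter
    (Metric.isOpen_ball.preimage (by fun_prop : Continuous fun x => x + w i))
  -- The sign of `s` goes into the functional, so that the large parameter `|s| ‖h‖` is positive.
  set ℓ : ι → (T →L[ℝ] ℝ) →L[ℝ] ℂ := fun i =>
    (SignType.sign i.1.1 : ℝ) • (Complex.ofRealCLM.comp (ContinuousLinearMap.apply ℝ ℝ (v i))) with hℓ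
  have hsg (i : ι) : |((SignType.sign i.1.1 : ℝ))| = 1 := by
    rcases i.2.1.lt_or_gt with h | h <;> simp [h]
  have hℓa (i : ι) (L : T →L[ℝ] ℝ) : ℓ i L = ((SignType.sign i.1.1 * L (v i) : ℝ) : ℂ) := by
    simp [hℓ]
  have hℓn (i : ι) (L : T →L[ℝ] ℝ) : ‖ℓ i L‖ = |L (v i)| := by
    rw [hℓa, Complex.norm_real, norm_mul, Real.norm_eq_abs, hsg, one_mul, Real.norm_eq_abs]
  have hℓ1 (i) : ‖ℓ i‖ ≤ 1 := ContinuousLinearMap.opNorm_le_bound _ zero_le_one fun L => by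
    rw [one_mul, hℓn]
    exact (L.le_opNorm _).trans (mul_le_of_le_one_right (norm_nonneg _) (he _))
  set u : ι → T → ℂ := fun i x => ℓ i (‖w i‖⁻¹ • (fderiv ℝ φ (x + w i) - fderiv ℝ φ x)) with hu
  have hDφ : ContDiff ℝ ∞ (fderiv ℝ φ) := hφ.fderiv_right (by simp)
  have htr (i : ι) : ContDiff ℝ ∞ fun x => x + w i := contDiff_id.add contDiff_const
  have hconj : ContDiff ℝ ∞ fun x => conj (a x) := Complex.conjCLE.contDiff.comp ha
  have hat (i : ι) : ContDiff ℝ ∞ fun x => a (x + w i) := ha.comp (htr i)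
  have hbs (i : ι) : tsupport (fun x => a (x + w i) * conj (a x)) ⊆ tsupport a :=
    closure_mono fun x hx h0 => hx (by simp [h0])
  have hconjs : HasCompactSupport fun x => conj (a x) :=
    has.comp_left (g := fun z : ℂ => conj z) (by simp)
  have hlow (i : ι) (x : T) (hx : x ∈ U i) : c ≤ ‖u i x‖ := by
    have h1 := hφe i.1.2 x hx.1 hx.2
    simp only [hu]
    rw [hℓn, smul_apply, smul_eq_mul, abs_mul, abs_inv, abs_norm, hwn, ← div_eq_inv_mul,
      le_div_iff₀ (hpos i)]
    exact h1
  have hder (i : ι) (x : T) (_ : x ∈ U i) :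
      ((fderiv ℝ (fun x => i.1.1 * (φ (x + w i) - φ x)) x (v i) : ℝ) : ℂ) =
        (|i.1.1| * ‖i.1.2‖ : ℝ) * u i x := by
    have h0 (y : T) : HasFDerivAt φ (fderiv ℝ φ y) y := (hφ.differentiable (by simp) y).hasFDerivAt
    have h1 := (((h0 (x + w i)).comp x ((hasFDerivAt_id x).add_const (w i))).sub
      (h0 x)).const_mul i.1.1
    have h2 : fderiv ℝ (fun x => i.1.1 * (φ (x + w i) - φ x)) x = _ := h1.fderiv
    rw [h2]
    simp only [hu, hℓa]
    rw [← Complex.ofReal_mul]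
    congr 1
    have h3 : |i.1.1| * (SignType.sign i.1.1 : ℝ) = i.1.1 := by
      rcases i.2.1.lt_or_gt with h | h
      · simp [h, abs_of_neg h]
      · simp [h, abs_of_pos h]
    simp only [ContinuousLinearMap.comp_id, smul_apply, sub_apply, smul_eq_mul, hwn]
    have := (hpos i).ne'
    conv_lhs => rw [← h3]
    field_simp
  have hsub (i : ι) : tsupport (fun x => a (x + w i) * conj (a x)) ⊆ U i := by
    refine fun x hx => ⟨haε (hbs i hx), ?_⟩
    have : tsupport (fun x => a (x + w i) * conj (a x)) ⊆ (fun x => x + w i) ⁻¹' tsupport a := by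
      refine closure_minimal (fun x hx => subset_tsupport _ fun h0 => hx ?_)
        ((isClosed_tsupport a).preimage (htr i).continuous)
      simp only [h0, zero_mul]
    exact haε (this hx)
  have hB1 : UnifBounded U v N fun i x => a (x + w i) := by
    have := UnifBounded.comp_translate (U := U) (v := v) (n := N) ha has
      (ℓ := fun _ => ContinuousLinearMap.id ℝ ℂ) (C := 1)
      (fun _ => ContinuousLinearMap.norm_id_le) (fun i => he _) w
    simpa using this
  have hB2 : UnifBounded U v N fun _ x => conj (a x) := by
    have := UnifBounded.comp_translate (U := U) (v := v) (n := N) hconj hconjs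
      (ℓ := fun _ => ContinuousLinearMap.id ℝ ℂ) (C := 1)
      (fun _ => ContinuousLinearMap.norm_id_le) (fun i => he _) (fun _ => 0)
    simpa using this
  obtain ⟨C, hC0, hC⟩ := exists_norm_integral_mul_cexp_le (U := U) (v := v) hU
    (Q := Metric.ball 0 ε) Metric.isBounded_ball (fun _ x hx => hx.1) (w := u)
    (ψ := fun i x => i.1.1 * (φ (x + w i) - φ x)) (M := fun i => |i.1.1| * ‖i.1.2‖)
    (fun i => ((ℓ i).contDiff.comp (((hDφ.comp (htr i)).sub hDφ).const_smul _)).contDiffOn)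
    (fun i => contDiff_const.mul ((hφ.comp (htr i)).sub hφ))
    (fun i => mul_pos (abs_pos.2 i.2.1) (hpos i)) (c := c) hc hlow hder N
    (UnifBounded.comp_difference hDφ (hφs.fderiv ℝ) hℓ1 (fun i => he _) w)
    (b := fun i x => a (x + w i) * conj (a x)) (fun i => (hat i).mul hconj)
    (fun i => has.of_isClosed_subset (isClosed_tsupport _) (hbs i)) hsub
    (UnifBounded.mul hU (fun i => (hat i).contDiffOn) (fun i => hconj.contDiffOn) hB1 hB2)
  · exact ⟨C, hC0, fun s h h1 h2 => hC ⟨(s, h), h1, h2⟩⟩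

theorem le_mul_rpow_one_add {x y A B : ℝ} {N : ℕ} (hx : 0 ≤ x) (hy : 0 ≤ y) (hA : y ≤ A)
    (hB : y * x ^ N ≤ B) : y ≤ 2 ^ N * (A + B) * (1 + x) ^ (-(N : ℝ)) := by
  have hB0 : 0 ≤ B := (by positivity : 0 ≤ y * x ^ N).trans hB
  have hA0 : 0 ≤ A := hy.trans hA
  rw [Real.rpow_neg (by positivity), Real.rpow_natCast, ← div_eq_mul_inv, le_div_iff₀ (by positivity)]
  rcases le_total x 1 with h | h
  · calc y * (1 + x) ^ N ≤ A * 2 ^ N := by gcongr; linarith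
      _ ≤ _ := by rw [mul_comm]; gcongr; linarith
  · calc y * (1 + x) ^ N ≤ y * (2 * x) ^ N := by gcongr; linarith
      _ = 2 ^ N * (y * x ^ N) := by rw [mul_pow]; ring
      _ ≤ _ := by gcongr; linarith

/-- If `‖τ‖` dominates, the phase is nonstationary. If `|s|` dominates, the linear phase contributes
only a unimodular constant to the autocorrelations, whose decay in `|s| ‖h‖` integrates over `P` to
`|s|^(-dim P)`. A lower bound of the Hessian on `P` alone is used. -/
theorem exists_norm_integral_graph_phase_le (hφ : ContDiff ℝ ∞ φ) (hφs : HasCompactSupport φ)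
    (hφ0 : fderiv ℝ φ 0 = 0) (P : Submodule ℝ T) {c : ℝ} (hc : 0 < c)
    (hP : ∀ h ∈ P, ∃ e : T, ‖e‖ ≤ 1 ∧ c * ‖h‖ ≤ |fderiv ℝ (fderiv ℝ φ) 0 h e|) :
    ∃ ε : ℝ, 0 < ε ∧ ∀ a : T → ℂ, ContDiff ℝ ∞ a → tsupport a ⊆ Metric.ball 0 ε →
      ∃ C : ℝ, ∀ (τ : T) (s : ℝ),
        ‖∫ x, a x * Complex.exp ((⟪τ, x⟫_ℝ + s * φ x : ℝ) * Complex.I)‖ ^ 2 *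
          max ‖τ‖ |s| ^ Module.finrank ℝ P ≤ C := by
  set κ := Module.finrank ℝ P with hκ
  have hDφ : ContDiff ℝ ∞ (fderiv ℝ φ) := hφ.fderiv_right (by simp)
  have hstrict : HasStrictFDerivAt (fderiv ℝ φ) (fderiv ℝ (fderiv ℝ φ) 0) 0 :=
    hDφ.contDiffAt.hasStrictFDerivAt (by simp)
  have hc2 : 0 < (c / 2).toNNReal := by simpa using hc
  -- Strict differentiability of the gradient turns the lower bound of the Hessian at `0` into one
  -- for differences of gradients near `0`, with `c / 2` in place of `c`.
  obtain ⟨s, hs, hlin⟩ := hstrict.approximates_deriv_on_nhds (Or.inr hc2)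
  have hsmall : ∀ᶠ x in 𝓝 (0 : T), ‖fderiv ℝ φ x‖ < 1 / 2 := by
    refine (hDφ.continuous.norm.tendsto 0).eventually_lt_const ?_
    rw [hφ0, norm_zero]; norm_num
  obtain ⟨ε, hε, hball⟩ := Metric.mem_nhds_iff.1 (Filter.inter_mem hs hsmall)
  choose e0 he0 hce0 using hP
  set e : P → T := fun h => e0 h h.2 with he
  have hφe : ∀ (h : P) (x : T), x ∈ Metric.ball (0 : T) ε → x + h ∈ Metric.ball (0 : T) ε →
      c / 2 * ‖h‖ ≤ |(fderiv ℝ φ (x + h) - fderiv ℝ φ x) (e h)| := by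
    intro h x hx hxh
    have h1 := hlin _ (hball hxh).1 _ (hball hx).1
    rw [add_sub_cancel_left, Real.coe_toNNReal _ (by positivity)] at h1
    have h2 := hce0 h h.2
    have h3 : |(fderiv ℝ φ (x + h) - fderiv ℝ φ x - fderiv ℝ (fderiv ℝ φ) 0 h) (e h)| ≤
        c / 2 * ‖(h : T)‖ := by
      rw [← Real.norm_eq_abs]
      refine (ContinuousLinearMap.le_opNorm _ _).trans ?_
      exact (mul_le_of_le_one_right (norm_nonneg _) (he0 h h.2)).trans h1
    rw [sub_apply] at h3
    have h4 := abs_sub_abs_le_abs_sub (fderiv ℝ (fderiv ℝ φ) 0 (h : T) (e h))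
      ((fderiv ℝ φ (x + h) - fderiv ℝ φ x) (e h))
    rw [abs_sub_comm] at h4
    rw [Submodule.coe_norm]
    linarith
  refine ⟨ε, hε, fun a ha haε => ?_⟩
  have has : HasCompactSupport a :=
    (isCompact_closedBall (0 : T) ε).of_isClosed_subset (isClosed_tsupport _)
      (haε.trans Metric.ball_subset_closedBall)
  obtain ⟨C1, hC10, hC1⟩ := exists_norm_integral_linear_phase_le hφ hφs
    (fun x hx => (hball hx).2.le) ha has haε κ
  -- One power beyond `κ = dim P` makes the bound integrable over `P`.
  obtain ⟨C2, hC20, hC2⟩ := exists_norm_autocorrelation_le hφ hφs (half_pos hc) (fun h => he0 h h.2)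
    hφe ha has haε (κ + 1)
  obtain ⟨C3, hC3⟩ := exists_sq_integral_le_lintegral_autocorrelation P ε
  obtain ⟨C4, hC4⟩ := exists_lintegral_rpow_one_add_le P
  have hai : Integrable a := ha.continuous.integrable_of_hasCompactSupport has
  obtain ⟨M, hM⟩ := has.exists_bound_of_continuous ha.continuous
  have hM0 : 0 ≤ M := (norm_nonneg _).trans (hM 0)
  set A := ∫ x, ‖a x‖ with hA
  have hA0 : 0 ≤ A := integral_nonneg fun _ => norm_nonneg _
  have htriv (τ : T) (s : ℝ) :
      ‖∫ x, a x * Complex.exp ((⟪τ, x⟫_ℝ + s * φ x : ℝ) * Complex.I)‖ ≤ A := by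
    refine (norm_integral_le_integral_norm _).trans (le_of_eq ?_)
    simp_rw [norm_mul, Complex.norm_exp_ofReal_mul_I, mul_one]
    rfl
  set B := 2 ^ (κ + 1) * (M * A + C2) with hB
  have hB0 : 0 ≤ B := by positivity
  -- One term for each case: `‖τ‖` dominant, `|s|` dominant, and the trivial bound when both vanish.
  refine ⟨A * C1 + C3 * (B * C4) + A ^ 2, fun τ s => ?_⟩
  have hpos1 : 0 ≤ A * C1 := by positivity
  have hpos2 : 0 ≤ C3 * (B * C4) := by positivity
  have hpos3 : 0 ≤ A ^ 2 := by positivity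
  set I := ∫ x, a x * Complex.exp ((⟪τ, x⟫_ℝ + s * φ x : ℝ) * Complex.I) with hI
  by_cases hcase : |s| ≤ ‖τ‖
  · rw [max_eq_left hcase]
    by_cases hτ : τ = 0
    · have h1 : ‖τ‖ ^ κ ≤ 1 := pow_le_one₀ (norm_nonneg _) (by simp [hτ])
      have h2 : ‖I‖ ^ 2 ≤ A ^ 2 := pow_le_pow_left₀ (norm_nonneg _) (htriv τ s) 2
      have h3 := mul_le_mul h2 h1 (by positivity) hpos3
      linarith
    · have h1 := hC1 τ s hτ hcase
      calc ‖I‖ ^ 2 * ‖τ‖ ^ κ = ‖I‖ * (‖I‖ * ‖τ‖ ^ κ) := by ring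
        _ ≤ A * C1 := mul_le_mul (htriv τ s) h1 (by positivity) hA0
        _ ≤ _ := by linarith
  · push Not at hcase
    rw [max_eq_right hcase.le]
    have hs0 : 0 < |s| := (norm_nonneg _).trans_lt hcase
    set F : T → ℂ := fun x => a x * Complex.exp ((⟪τ, x⟫_ℝ + s * φ x : ℝ) * Complex.I) with hF
    have hφc := hφ.continuous
    have hac := ha.continuous
    have hFa : Function.support F ⊆ Function.support a := fun x hx h0 => hx (by simp [hF, h0])
    have hFs : tsupport F ⊆ Metric.ball 0 ε := (closure_mono hFa).trans haε
    have hauto (h : P) : ‖∫ v, F (v + h) * conj (F v)‖ = ‖∫ x, (a (x + h) * conj (a x)) *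
        Complex.exp ((s * (φ (x + h) - φ x) : ℝ) * Complex.I)‖ := by
      have : ∀ x, F (x + h) * conj (F x) = Complex.exp ((⟪τ, (h : T)⟫_ℝ : ℝ) * Complex.I) *
          ((a (x + h) * conj (a x)) *
            Complex.exp ((s * (φ (x + h) - φ x) : ℝ) * Complex.I)) := by
        intro x
        simp only [hF, map_mul, ← Complex.exp_conj, Complex.conj_ofReal, Complex.conj_I]
        rw [show ∀ p q r t : ℂ, p * q * (r * t) = p * r * (q * t) by intros; ring,
          ← Complex.exp_add, mul_left_comm, ← Complex.exp_add]
        congr 2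
        rw [inner_add_right]
        push_cast
        ring
      simp_rw [this]
      rw [integral_const_mul, norm_mul, Complex.norm_exp_ofReal_mul_I, one_mul]
    have hbd (h : P) : ‖∫ v, F (v + h) * conj (F v)‖ ≤
        B * (1 + |s| * ‖h‖) ^ (-((κ + 1 : ℕ) : ℝ)) := by
      refine le_mul_rpow_one_add (by positivity) (norm_nonneg _) ?_ ?_
      · refine (norm_integral_le_of_norm_le (hai.norm.const_mul M) (.of_forall fun v => ?_)).trans
          (le_of_eq (integral_const_mul _ _))
        rw [norm_mul, RCLike.norm_conj]
        simp only [hF, norm_mul, Complex.norm_exp_ofReal_mul_I, mul_one]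
        exact mul_le_mul_of_nonneg_right (hM _) (norm_nonneg _)
      · rw [hauto]
        by_cases hh : h = 0
        · simp only [hh, norm_zero, mul_zero]
          rw [zero_pow (by simp), mul_zero]
          exact hC20
        · exact hC2 s h (abs_pos.1 hs0) hh
    have key := hC3 F (by fun_prop) hFs
      (fun h => ENNReal.ofReal (B * (1 + |s| * ‖h‖) ^ (-((κ + 1 : ℕ) : ℝ))))
      (by fun_prop) (fun h => by
        rw [← ofReal_norm]; exact ENNReal.ofReal_le_ofReal (hbd h))
    have h5 : ‖∫ v, F v‖ₑ ^ 2 * ENNReal.ofReal |s| ^ κ ≤ C3 * (ENNReal.ofReal B * C4) := by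
      refine (mul_le_mul_left key _).trans ?_
      rw [mul_assoc]
      refine mul_le_mul_right ?_ _
      simp_rw [ENNReal.ofReal_mul hB0]
      rw [lintegral_const_mul' _ _ ENNReal.ofReal_ne_top, mul_assoc]
      refine mul_le_mul_right ?_ _
      have := hC4 |s| hs0
      rw [lintegral_mul_const' _ _ (ENNReal.pow_ne_top ENNReal.ofReal_ne_top)] at this
      push_cast
      exact this
    have h6 := ENNReal.toReal_mono (by finiteness) h5
    simp only [ENNReal.toReal_mul, ENNReal.toReal_pow, toReal_enorm, ENNReal.coe_toReal,
      ENNReal.toReal_ofReal hB0, ENNReal.toReal_ofReal hs0.le] at h6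
    have h7 : ‖I‖ ^ 2 * |s| ^ κ ≤ C3 * (B * C4) := h6
    linarith

end GraphPhase

/-! ### Area formula and ball growth for sections of a projection -/

section Area

open Filter Topology Module

/-- The correspondence `g x ↦ f x` is `K`-Lipschitz. It is well defined even without injectivity of
`g`, since the hypothesis forces `f` to agree wherever `g` does. -/
theorem hausdorff_image_le {X Y Z : Type*} [MetricSpace Y] [MeasurableSpace Y]
    [BorelSpace Y] [MetricSpace Z] [MeasurableSpace Z] [BorelSpace Z] {f : X → Y} {g : X → Z}
    {A : Set X} {K : ℝ≥0} (h : ∀ x ∈ A, ∀ y ∈ A, dist (f x) (f y) ≤ K * dist (g x) (g y)) (n : ℕ) :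
    μHE[n] (f '' A) ≤ (K : ℝ≥0∞) ^ n * μHE[n] (g '' A) := by
  classical
  rcases isEmpty_or_nonempty X with hX | hX
  · rw [Set.eq_empty_of_isEmpty A, Set.image_empty, measure_empty]
    exact zero_le
  set j : Z → Y := fun z => f (Function.invFunOn g A z) with hj
  have hjg : ∀ x ∈ A, j (g x) = f x := by
    intro x hx
    have h1 := Function.invFunOn_mem (f := g) (s := A) ⟨x, hx, rfl⟩
    have h2 := Function.invFunOn_eq (f := g) (s := A) ⟨x, hx, rfl⟩
    have := h _ h1 _ hx
    rw [h2, dist_self, mul_zero] at this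
    exact dist_le_zero.1 this
  have hjl : LipschitzOnWith K j (g '' A) := by
    refine LipschitzOnWith.of_dist_le_mul ?_
    rintro _ ⟨x, hx, rfl⟩ _ ⟨y, hy, rfl⟩
    rw [hjg x hx, hjg y hy]
    exact h x hx y hy
  have him : f '' A = j '' (g '' A) := by
    rw [Set.image_image]
    exact Set.image_congr fun x hx => (hjg x hx).symm
  rw [him]
  simp_rw [Measure.euclideanHausdorffMeasure_def, Measure.smul_apply, ENNReal.smul_def, smul_eq_mul]
  rw [mul_left_comm]
  refine mul_le_mul_right ?_ _
  have := hjl.hausdorffMeasure_image_le (d := n) n.cast_nonneg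
  rwa [ENNReal.rpow_natCast] at this

variable {T E : Type*} [NormedAddCommGroup T] [InnerProductSpace ℝ T] [FiniteDimensional ℝ T]
  [MeasurableSpace T] [BorelSpace T] [NormedAddCommGroup E] [InnerProductSpace ℝ E]
  [FiniteDimensional ℝ E] [MeasurableSpace E] [BorelSpace E] {θ : T → E} {Q : E →L[ℝ] T} {p : E}

/-- The range is the fixed-point set of the continuous map `q ↦ θ (Q (q - p))`. -/
theorem isClosed_range_section (hθ : Continuous θ) (hQθ : ∀ v, Q (θ v - p) = v) :
    IsClosed (Set.range θ) := by
  have : Set.range θ = {q | θ (Q (q - p)) = q} := by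
    ext q
    refine ⟨?_, fun h => ⟨_, h⟩⟩
    rintro ⟨v, rfl⟩
    exact congrArg θ (hQθ v)
  rw [this]
  exact isClosed_eq (by fun_prop) continuous_id

theorem dist_le_dist_section (hQ : ‖Q‖ ≤ 1) (hQθ : ∀ v, Q (θ v - p) = v) (x y : T) :
    dist x y ≤ dist (θ x) (θ y) := by
  have h : x - y = Q (θ x - θ y) := by
    conv_lhs => rw [← hQθ x, ← hQθ y, ← map_sub]
    congr 1; abel
  rw [dist_eq_norm, dist_eq_norm, h]
  exact (Q.le_opNorm _).trans (mul_le_of_le_one_left (norm_nonneg _) hQ)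

theorem fderiv_section_comp (hθ : ContDiff ℝ ∞ θ) (hQθ : ∀ v, Q (θ v - p) = v) (x u : T) :
    Q (fderiv ℝ θ x u) = u := by
  have h1 := Q.hasFDerivAt.comp x ((hθ.differentiable (by simp) x).hasFDerivAt.sub_const p)
  have h2 : (Q ∘ fun v => θ v - p) = id := funext hQθ
  rw [h2] at h1
  have := h1.unique (hasFDerivAt_id x)
  exact DFunLike.congr_fun this u

/-- The Jacobian is the square root of a Gram determinant, which does not vanish because `Q` is a
left inverse of the derivative. -/
theorem contDiff_normDet_fderiv (hθ : ContDiff ℝ ∞ θ) (hQθ : ∀ v, Q (θ v - p) = v) :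
    ContDiff ℝ ∞ fun v => (fderiv ℝ θ v).toLinearMap.normDet := by
  set b := stdOrthonormalBasis ℝ T
  have h1 (v : T) : (fderiv ℝ θ v).toLinearMap.normDet =
      √((Matrix.gram ℝ (fun i => fderiv ℝ θ v (b i))).det) := by
    have := (fderiv ℝ θ v).toLinearMap.normDet_sq_eq_det_gram b
    simp only [RCLike.ofReal_real_eq_id, id] at this
    exact (Real.sqrt_sq (LinearMap.normDet_nonneg _)).symm.trans (congrArg Real.sqrt this)
  have hpos (v : T) : (Matrix.gram ℝ (fun i => fderiv ℝ θ v (b i))).det ≠ 0 := by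
    have := (fderiv ℝ θ v).toLinearMap.normDet_sq_eq_det_gram b
    simp only [RCLike.ofReal_real_eq_id, id] at this
    refine fun h => ?_
    have h0 : (fderiv ℝ θ v).toLinearMap.normDet = 0 := by
      have := this.trans h
      exact pow_eq_zero_iff two_ne_zero |>.1 this
    rw [LinearMap.normDet_eq_zero_iff_ker_ne_bot] at h0
    refine h0 (LinearMap.ker_eq_bot.2 fun x y hxy => ?_)
    rw [← fderiv_section_comp hθ hQθ v x, ← fderiv_section_comp hθ hQθ v y]
    exact congrArg Q hxy
  simp_rw [h1]
  refine ContDiff.sqrt ?_ hpos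
  simp_rw [Matrix.det_apply', Matrix.gram_apply]
  have hd (i) : ContDiff ℝ ∞ fun v => fderiv ℝ θ v (b i) :=
    (hθ.fderiv_right (by simp)).clm_apply contDiff_const
  exact ContDiff.sum fun σ _ => contDiff_const.mul (contDiff_prod fun i _ => (hd _).inner ℝ (hd _))

/-- The area formula by differentiation of measures: at small scales `θ` distorts distances like its
derivative up to a factor `1 + δ`, so the measure of the image of a small ball is the Jacobian times
the volume up to `(1 + δ) ^ n`, and `δ` tends to `0`. -/
theorem map_restrict_range_section (hθ : ContDiff ℝ ∞ θ) (hQ : ‖Q‖ ≤ 1)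
    (hQθ : ∀ v, Q (θ v - p) = v) {K : ℝ≥0} (hK : LipschitzWith K θ) :
    ((μHE[finrank ℝ T] : Measure E).restrict (Set.range θ)).map (fun q => Q (q - p)) =
      (volume : Measure T).withDensity
        fun v => ENNReal.ofReal (fderiv ℝ θ v).toLinearMap.normDet := by
  set n := finrank ℝ T
  set lam : Measure T := ((μHE[n] : Measure E).restrict (Set.range θ)).map (fun q => Q (q - p)) with hlam
  have hm : Measurable fun q : E => Q (q - p) := by fun_prop
  have happ {A : Set T} (hA : MeasurableSet A) : lam A = μHE[n] (θ '' A) := by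
    rw [hlam, Measure.map_apply hm hA, Measure.restrict_apply (hm hA)]
    congr 1
    ext q
    constructor
    · rintro ⟨h1, ⟨v, rfl⟩⟩
      refine ⟨v, ?_, rfl⟩
      rw [← hQθ v]
      exact h1
    · rintro ⟨v, hv, rfl⟩
      refine ⟨?_, v, rfl⟩
      rw [← hQθ v] at hv
      exact hv
  have hvol (A : Set T) : μHE[n] ((id : T → T) '' A) = volume A := by
    rw [Set.image_id, InnerProductSpace.euclideanHausdorffMeasure_eq_volume]
  have hupper {A : Set T} (hA : MeasurableSet A) : lam A ≤ (K : ℝ≥0∞) ^ n * volume A := by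
    rw [happ hA, ← hvol]
    exact hausdorff_image_le (fun x _ y _ => hK.dist_le_mul x y) n
  have hac : lam ≪ volume := by
    refine Measure.AbsolutelyContinuous.mk fun A hA h0 => ?_
    have := hupper hA
    rwa [h0, mul_zero, nonpos_iff_eq_zero] at this
  have hloc : IsLocallyFiniteMeasure lam := by
    refine ⟨fun x => ⟨Metric.ball x 1, Metric.ball_mem_nhds x one_pos, ?_⟩⟩
    exact (hupper measurableSet_ball).trans_lt
      (ENNReal.mul_lt_top (ENNReal.pow_lt_top ENNReal.coe_lt_top) measure_ball_lt_top)
  rw [← Measure.withDensity_rnDeriv_eq lam volume hac]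
  refine withDensity_congr_ae ?_
  -- The density is almost everywhere the limit of the ratios of measures on shrinking balls.
  filter_upwards [Besicovitch.ae_tendsto_rnDeriv lam volume] with x hx
  set L := fderiv ℝ θ x with hL
  set J : ℝ≥0∞ := ENNReal.ofReal L.toLinearMap.normDet with hJ
  have hcomp {δ : ℝ≥0} (hδ : 0 < δ) : ∀ᶠ r in 𝓝[>] (0 : ℝ),
      lam (Metric.closedBall x r) / volume (Metric.closedBall x r) ≤ (1 + δ : ℝ≥0) ^ n * J ∧
        J ≤ (1 + δ : ℝ≥0) ^ n *
          (lam (Metric.closedBall x r) / volume (Metric.closedBall x r)) := by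
    obtain ⟨s, hs, hlin⟩ := (hθ.contDiffAt.hasStrictFDerivAt (x := x)
      (by simp)).approximates_deriv_on_nhds (Or.inr hδ)
    obtain ⟨r0, hr0, hball⟩ := Metric.nhds_basis_closedBall.mem_iff.1 hs
    filter_upwards [Ioo_mem_nhdsGT hr0] with r hr
    have hB : Metric.closedBall x r ⊆ s := (Metric.closedBall_subset_closedBall hr.2.le).trans hball
    have hv0 : volume (Metric.closedBall x r) ≠ 0 := (Metric.measure_closedBall_pos _ _ hr.1).ne'
    have hvt : volume (Metric.closedBall x r) ≠ ⊤ := measure_closedBall_lt_top.ne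
    -- Since `‖Q‖ ≤ 1`, neither `L` nor `θ` contracts distances; the linearization error `δ ‖y - z‖`
    -- is therefore a relative error for both.
    have hexp (y z : T) : ‖y - z‖ ≤ ‖L (y - z)‖ := by
      conv_lhs => rw [← fderiv_section_comp hθ hQθ x (y - z)]
      exact (Q.le_opNorm _).trans (mul_le_of_le_one_left (norm_nonneg _) hQ)
    have hlinI : μHE[n] (L.toLinearMap '' Metric.closedBall x r) =
        J * volume (Metric.closedBall x r) :=
      LinearMap.euclideanHausdorffMeasure_image_eq_normDet_mul_volume _ _
    have h1 : lam (Metric.closedBall x r) ≤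
        (1 + δ : ℝ≥0) ^ n * (J * volume (Metric.closedBall x r)) := by
      rw [happ Metric.isClosed_closedBall.measurableSet, ← hlinI]
      refine hausdorff_image_le (fun y hy z hz => ?_) n
      have h2 := hlin y (hB hy) z (hB hz)
      rw [dist_eq_norm, dist_eq_norm]
      simp only [ContinuousLinearMap.coe_coe, ← map_sub]
      have h3 := norm_le_norm_add_norm_sub' (θ y - θ z) (L (y - z))
      have h4 := mul_le_mul_of_nonneg_left (hexp y z) δ.2
      push_cast
      have h5 : (δ : ℝ) * ‖y - z‖ ≤ δ * ‖L (y - z)‖ := h4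
      linarith
    have h2 : J * volume (Metric.closedBall x r) ≤
        (1 + δ : ℝ≥0) ^ n * lam (Metric.closedBall x r) := by
      rw [happ Metric.isClosed_closedBall.measurableSet, ← hlinI]
      refine hausdorff_image_le (fun y hy z hz => ?_) n
      have h2 := hlin y (hB hy) z (hB hz)
      have h6 := dist_le_dist_section hQ hQθ y z
      rw [dist_eq_norm, dist_eq_norm] at h6 ⊢
      simp only [ContinuousLinearMap.coe_coe, ← map_sub]
      have h3 := norm_le_norm_add_norm_sub' (L (y - z)) (θ y - θ z)
      rw [norm_sub_rev (L _)] at h3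
      have h5 : (δ : ℝ) * ‖y - z‖ ≤ δ * ‖θ y - θ z‖ := mul_le_mul_of_nonneg_left h6 δ.2
      push_cast
      linarith
    refine ⟨ENNReal.div_le_of_le_mul (by rwa [mul_assoc]), ?_⟩
    rw [← mul_div_assoc, ENNReal.le_div_iff_mul_le (Or.inl hv0) (Or.inl hvt)]
    exact h2
  set q := lam.rnDeriv volume x
  have hδlim (c : ℝ≥0∞) (hc : c ≠ ⊤) : Tendsto (fun δ : ℝ≥0 => ((1 + δ : ℝ≥0) : ℝ≥0∞) ^ n * c)
      (𝓝[>] 0) (𝓝 c) := by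
    have h1 : Tendsto (fun δ : ℝ≥0 => ((1 + δ : ℝ≥0) : ℝ≥0∞) ^ n) (𝓝 0) (𝓝 1) := by
      have : Continuous fun δ : ℝ≥0 => (((1 + δ) ^ n : ℝ≥0) : ℝ≥0∞) :=
        ENNReal.continuous_coe.comp (by fun_prop)
      have := this.tendsto 0
      simpa using this
    have h2 := ENNReal.Tendsto.mul_const (b := c)
      (h1.mono_left (nhdsWithin_le_nhds (s := Set.Ioi 0))) (Or.inr hc)
    rwa [one_mul] at h2
  have hJt : J ≠ ⊤ := ENNReal.ofReal_ne_top
  have hle1 : q ≤ J := by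
    refine ge_of_tendsto (hδlim J hJt) ?_
    filter_upwards [self_mem_nhdsWithin] with δ hδ
    exact le_of_tendsto hx ((hcomp hδ).mono fun r hr => hr.1)
  refine le_antisymm hle1 (ge_of_tendsto (hδlim q (ne_top_of_le_ne_top hJt hle1)) ?_)
  filter_upwards [self_mem_nhdsWithin] with δ hδ
  refine ge_of_tendsto (ENNReal.Tendsto.const_mul hx (Or.inr (by finiteness))) ?_
  exact (hcomp hδ).mono fun r hr => hr.2

theorem integral_range_section (hθ : ContDiff ℝ ∞ θ) (hQ : ‖Q‖ ≤ 1)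
    (hQθ : ∀ v, Q (θ v - p) = v) {K : ℝ≥0} (hK : LipschitzWith K θ) {F : E → ℂ} (hF : Continuous F) :
    ∫ q in Set.range θ, F q ∂(μHE[finrank ℝ T] : Measure E) =
      ∫ v, ((fderiv ℝ θ v).toLinearMap.normDet : ℂ) * F (θ v) := by
  have h1 : ∫ q in Set.range θ, F q ∂(μHE[finrank ℝ T] : Measure E) =
      ∫ q in Set.range θ, F (θ (Q (q - p))) ∂(μHE[finrank ℝ T] : Measure E) := by
    refine setIntegral_congr_fun (isClosed_range_section hθ.continuous hQθ).measurableSet ?_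
    rintro _ ⟨v, rfl⟩
    simp [hQθ]
  have hθc := hθ.continuous
  have hm : AEMeasurable (fun q : E => Q (q - p))
      ((μHE[finrank ℝ T] : Measure E).restrict (Set.range θ)) := by fun_prop
  have h2 := integral_map hm (f := fun v => F (θ v))
    (hF.comp hθc).aestronglyMeasurable
  rw [h1, ← h2, map_restrict_range_section hθ hQ hQθ hK,
    integral_withDensity_eq_integral_toReal_smul
      ((contDiff_normDet_fderiv hθ hQθ).continuous.measurable.ennreal_ofReal) (by simp)]
  refine integral_congr_ae (.of_forall fun v => ?_)
  simp only
  rw [ENNReal.toReal_ofReal (LinearMap.normDet_nonneg _), Complex.real_smul]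

/-- The part of the range inside a ball projects into a ball of the same radius, and `θ` maps it
back at the cost of `K ^ n`. -/
theorem exists_measure_range_section_inter_ball_le (hQ : ‖Q‖ ≤ 1)
    (hQθ : ∀ v, Q (θ v - p) = v) {K : ℝ≥0} (hK : LipschitzWith K θ) : ∃ B : ℝ≥0,
    ∀ (u : E) (r : ℝ), 0 < r → (μHE[finrank ℝ T] : Measure E) (Set.range θ ∩ Metric.ball u r) ≤
      B * ENNReal.ofReal r ^ finrank ℝ T := by
  set n := finrank ℝ T
  refine ⟨K ^ n * (volume (Metric.ball (0 : T) 1)).toNNReal, fun u r hr => ?_⟩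
  set A : Set T := Metric.ball (Q (u - p)) r with hA
  have hsub : Set.range θ ∩ Metric.ball u r ⊆ θ '' A := by
    rintro _ ⟨⟨v, rfl⟩, hv⟩
    refine ⟨v, ?_, rfl⟩
    rw [mem_ball_iff_norm] at hv ⊢
    have h : v - Q (u - p) = Q (θ v - u) := by
      conv_lhs => rw [← hQθ v, ← map_sub]
      congr 1; abel
    rw [h]
    exact ((Q.le_opNorm _).trans (mul_le_of_le_one_left (norm_nonneg _) hQ)).trans_lt hv
  refine (measure_mono hsub).trans ?_
  have h1 : μHE[n] (θ '' A) ≤ (K : ℝ≥0∞) ^ n * μHE[n] ((id : T → T) '' A) :=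
    hausdorff_image_le (fun x _ y _ => hK.dist_le_mul x y) n
  rw [Set.image_id, InnerProductSpace.euclideanHausdorffMeasure_eq_volume, hA,
    Measure.addHaar_ball_of_pos _ _ hr, ENNReal.ofReal_pow hr.le] at h1
  refine h1.trans (le_of_eq ?_)
  rw [ENNReal.coe_mul, ENNReal.coe_pow, ENNReal.coe_toNNReal measure_ball_lt_top.ne]
  ring

end Area

/-! ### The hypersurface as a local graph -/

section LocalGraph

open Filter Topology Module

variable {E : Type*} [NormedAddCommGroup E] [InnerProductSpace ℝ E] [FiniteDimensional ℝ E]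

/-- The graph over the hyperplane orthogonal to `ν`, through `p`, of the function `φ`. -/
def graphMap (p ν : E) (φ : (ℝ ∙ ν)ᗮ → ℝ) (v : (ℝ ∙ ν)ᗮ) : E := p + v + φ v • ν

/-- The orthogonal projection to the hyperplane orthogonal to `ν`. -/
noncomputable abbrev hyperplaneProj (ν : E) : E →L[ℝ] (ℝ ∙ ν)ᗮ := (ℝ ∙ ν)ᗮ.orthogonalProjectionOnto

theorem hyperplaneProj_self (ν : E) : hyperplaneProj ν ν = 0 :=
  Submodule.orthogonalProjectionOnto_orthogonalComplement_singleton_eq_zero ν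

theorem hyperplaneProj_coe {ν : E} (v : (ℝ ∙ ν)ᗮ) : hyperplaneProj ν v = v :=
  Submodule.orthogonalProjectionOnto_mem_subspace_eq_self v

theorem inner_normal_coe {ν : E} (v : (ℝ ∙ ν)ᗮ) : ⟪ν, (v : E)⟫_ℝ = 0 :=
  Submodule.mem_orthogonal_singleton_iff_inner_right.1 v.2

theorem coe_hyperplaneProj_add {ν : E} (hν : ‖ν‖ = 1) (w : E) :
    (hyperplaneProj ν w : E) + ⟪ν, w⟫_ℝ • ν = w := by
  have h := Submodule.starProjection_add_starProjection_orthogonal (K := ℝ ∙ ν) w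
  rw [Submodule.starProjection_unit_singleton ℝ hν, add_comm] at h
  exact h

theorem eq_of_hyperplaneProj_eq {ν : E} (hν : ‖ν‖ = 1) {w w' : E}
    (h : hyperplaneProj ν w = hyperplaneProj ν w') (h' : ⟪ν, w⟫_ℝ = ⟪ν, w'⟫_ℝ) : w = w' := by
  rw [← coe_hyperplaneProj_add hν w, ← coe_hyperplaneProj_add hν w', h, h']

theorem hyperplaneProj_graphMap (p ν : E) (φ : (ℝ ∙ ν)ᗮ → ℝ) (v : (ℝ ∙ ν)ᗮ) :
    hyperplaneProj ν (graphMap p ν φ v - p) = v := by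
  have : graphMap p ν φ v - p = v + φ v • ν := by rw [graphMap]; abel
  rw [this, map_add, map_smul, hyperplaneProj_self, hyperplaneProj_coe, smul_zero, add_zero]

theorem inner_graphMap {ν : E} (hν : ‖ν‖ = 1) (p : E) (φ : (ℝ ∙ ν)ᗮ → ℝ) (v : (ℝ ∙ ν)ᗮ) :
    ⟪ν, graphMap p ν φ v - p⟫_ℝ = φ v := by
  have : graphMap p ν φ v - p = v + φ v • ν := by rw [graphMap]; abel
  rw [this, inner_add_right, inner_normal_coe, zero_add, inner_smul_right,
    real_inner_self_eq_norm_sq, hν]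
  norm_num

theorem contDiff_graphMap {p ν : E} {φ : (ℝ ∙ ν)ᗮ → ℝ} (hφ : ContDiff ℝ ∞ φ) :
    ContDiff ℝ ∞ (graphMap p ν φ) := by
  have h : ContDiff ℝ ∞ fun v : (ℝ ∙ ν)ᗮ => (v : E) :=
    ContinuousLinearMap.contDiff (ℝ ∙ ν)ᗮ.subtypeL
  exact (contDiff_const.add h).add (hφ.smul contDiff_const)

theorem hasFDerivAt_graphMap {p ν : E} {φ : (ℝ ∙ ν)ᗮ → ℝ} (hφ : ContDiff ℝ ∞ φ) (v : (ℝ ∙ ν)ᗮ) :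
    HasFDerivAt (graphMap p ν φ) ((ℝ ∙ ν)ᗮ.subtypeL + (fderiv ℝ φ v).smulRight ν) v := by
  have h1 : HasFDerivAt (fun v : (ℝ ∙ ν)ᗮ => p + (v : E)) (ℝ ∙ ν)ᗮ.subtypeL v :=
    (ContinuousLinearMap.hasFDerivAt (ℝ ∙ ν)ᗮ.subtypeL).const_add p
  exact h1.add ((hφ.differentiable (by simp) v).hasFDerivAt.smul_const ν)

theorem exists_lipschitzWith_graphMap {p ν : E} {φ : (ℝ ∙ ν)ᗮ → ℝ} (hφ : ContDiff ℝ ∞ φ)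
    (hφs : HasCompactSupport φ) : ∃ K, LipschitzWith K (graphMap p ν φ) := by
  obtain ⟨K, hK⟩ := hφ.lipschitzWith_of_hasCompactSupport hφs (by simp)
  have h1 : LipschitzWith 1 fun v : (ℝ ∙ ν)ᗮ => p + (v : E) := by
    refine LipschitzWith.of_dist_le_mul fun x y => ?_
    simp [dist_eq_norm]
  have h2 : LipschitzWith (K * ‖ν‖₊) fun v : (ℝ ∙ ν)ᗮ => φ v • ν := by
    refine LipschitzWith.of_dist_le_mul fun x y => ?_
    rw [dist_eq_norm, ← sub_smul, norm_smul, NNReal.coe_mul, coe_nnnorm, mul_right_comm]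
    exact mul_le_mul_of_nonneg_right (hK.dist_le_mul x y) (norm_nonneg _)
  exact ⟨_, h1.add h2⟩

/-- The derivative of `q ↦ (proj (q - p), ρ q)` where it is invertible. -/
noncomputable def flatteningEquiv {ν : E} (hν : ‖ν‖ = 1) (L : E →L[ℝ] ℝ) (hL : L ν ≠ 0) :
    E ≃L[ℝ] (ℝ ∙ ν)ᗮ × ℝ :=
  ContinuousLinearEquiv.equivOfInverse ((hyperplaneProj ν).prod L)
    ((ℝ ∙ ν)ᗮ.subtypeL ∘L ContinuousLinearMap.fst ℝ _ ℝ +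
      ((L ν)⁻¹ • (ContinuousLinearMap.snd ℝ (ℝ ∙ ν)ᗮ ℝ -
        L ∘L (ℝ ∙ ν)ᗮ.subtypeL ∘L ContinuousLinearMap.fst ℝ _ ℝ)).smulRight ν)
    (by
      intro w
      have h := coe_hyperplaneProj_add hν w
      have h2 : L w = L (hyperplaneProj ν w) + ⟪ν, w⟫_ℝ * L ν := by
        conv_lhs => rw [← h, map_add, map_smul, smul_eq_mul]
      simp only [add_apply, ContinuousLinearMap.comp_apply, ContinuousLinearMap.prod_apply,
        ContinuousLinearMap.coe_fst', Submodule.subtypeL_apply,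
        ContinuousLinearMap.smulRight_apply, smul_apply, sub_apply,
        ContinuousLinearMap.coe_snd', smul_eq_mul]
      rw [h2, add_sub_cancel_left, mul_comm, mul_inv_cancel_right₀ hL]
      exact h)
    (by
      rintro ⟨v, s⟩
      simp only [add_apply, ContinuousLinearMap.comp_apply, ContinuousLinearMap.prod_apply,
        ContinuousLinearMap.coe_fst', Submodule.subtypeL_apply,
        ContinuousLinearMap.smulRight_apply, smul_apply, sub_apply,
        ContinuousLinearMap.coe_snd', smul_eq_mul, map_add, map_smul]
      refine Prod.ext ?_ ?_
      · simp only [Prod.fst_add, Prod.smul_fst]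
        rw [hyperplaneProj_self, hyperplaneProj_coe, smul_zero, add_zero]
      · simp only [Prod.snd_add, Prod.smul_snd, smul_eq_mul]
        rw [mul_right_comm, inv_mul_cancel₀ hL, one_mul, add_sub_cancel])

/-- The inverse function theorem applies to `q ↦ (proj (q - p), ρ q)`; the normal component of its
inverse on the slice `ρ = 0` is the graph function. A cutoff makes that function global. -/
theorem exists_graph {ρ : E → ℝ} {U : Set E} {p ν : E} (hU : IsOpen U) (hρ : ContDiffOn ℝ ∞ ρ U)
    (hp : p ∈ U) (hρp : ρ p = 0) (hν : ‖ν‖ = 1) (hρν : fderiv ℝ ρ p ν ≠ 0) :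
    ∃ φ : (ℝ ∙ ν)ᗮ → ℝ, ContDiff ℝ ∞ φ ∧ HasCompactSupport φ ∧ φ 0 = 0 ∧
      ∃ V : Set E, IsOpen V ∧ p ∈ V ∧ V ⊆ U ∧ ∀ q ∈ V, (ρ q = 0 ↔ q ∈ Set.range (graphMap p ν φ)) := by
  set Ψ : E → (ℝ ∙ ν)ᗮ × ℝ := fun q => (hyperplaneProj ν (q - p), ρ q) with hΨ
  have hd {q : E} (hq : q ∈ U) : DifferentiableAt ℝ ρ q :=
    (hρ.contDiffAt (hU.mem_nhds hq)).differentiableAt (by simp)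
  have hΨd {q : E} (hq : q ∈ U) (h : fderiv ℝ ρ q ν ≠ 0) :
      HasFDerivAt Ψ (flatteningEquiv hν (fderiv ℝ ρ q) h : E →L[ℝ] (ℝ ∙ ν)ᗮ × ℝ) q := by
    have h1 : HasFDerivAt (fun q => hyperplaneProj ν (q - p)) (hyperplaneProj ν) q := by
      exact ((hyperplaneProj ν).hasFDerivAt.comp q ((hasFDerivAt_id q).sub_const p)).congr_fderiv
        (ContinuousLinearMap.comp_id _)
    exact h1.prodMk (hd hq).hasFDerivAt
  have hΨc {q : E} (hq : q ∈ U) : ContDiffAt ℝ ∞ Ψ q := by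
    refine ContDiffAt.prodMk ?_ (hρ.contDiffAt (hU.mem_nhds hq))
    exact ((hyperplaneProj ν).contDiff.comp (contDiff_id.sub contDiff_const)).contDiffAt
  set e := (hΨc hp).toOpenPartialHomeomorph Ψ (hΨd hp hρν) (by simp) with he
  have hee : (e : E → _) = Ψ := rfl
  have hpe : p ∈ e.source := (hΨc hp).mem_toOpenPartialHomeomorph_source _ _
  have hcont : ContinuousOn (fun q => fderiv ℝ ρ q ν) U :=
    ((hρ.fderiv_of_isOpen (m := ∞) hU (by simp)).continuousOn).clm_apply continuousOn_const
  set G : Set E := e.source ∩ (U ∩ {q | fderiv ℝ ρ q ν ≠ 0}) with hG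
  have hGo : IsOpen G := e.open_source.inter (hcont.isOpen_inter_preimage hU isOpen_ne)
  have hpG : p ∈ G := ⟨hpe, hp, hρν⟩
  set O : Set (ℝ ∙ ν)ᗮ := {v | ((v, 0) : (ℝ ∙ ν)ᗮ × ℝ) ∈ e.target ∩ e.symm ⁻¹' G} with hO
  have hOo : IsOpen O := (e.isOpen_inter_preimage_symm hGo).preimage (by fun_prop)
  have hΨp : Ψ p = (0, 0) := by simp [hΨ, hρp]
  have hsymm0 : e.symm (0, 0) = p := by
    rw [← hΨp, ← hee]; exact e.left_inv hpe
  have hO0 : (0 : (ℝ ∙ ν)ᗮ) ∈ O := by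
    refine ⟨?_, ?_⟩
    · rw [← hΨp, ← hee]; exact e.map_source hpe
    · change e.symm (0, 0) ∈ G
      rw [hsymm0]; exact hpG
  set φ₀ : (ℝ ∙ ν)ᗮ → ℝ := fun v => ⟪ν, e.symm (v, 0) - p⟫_ℝ with hφ₀
  have hφ₀c {v : (ℝ ∙ ν)ᗮ} (hv : v ∈ O) : ContDiffAt ℝ ∞ φ₀ v := by
    have h1 : ContDiffAt ℝ ∞ e.symm (v, 0) :=
      e.contDiffAt_symm hv.1 (hΨd hv.2.2.1 hv.2.2.2) (hΨc hv.2.2.1)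
    have h2 : ContDiffAt ℝ ∞ (fun v : (ℝ ∙ ν)ᗮ => e.symm (v, 0)) v :=
      h1.comp v (contDiff_id.prodMk contDiff_const).contDiffAt
    exact contDiffAt_const.inner ℝ (h2.sub contDiffAt_const)
  obtain ⟨r, hr, hrO⟩ := Metric.isOpen_iff.1 hOo 0 hO0
  -- The bump is supported in `O`, where the graph function is smooth, and equals `1` for `‖v‖ ≤ r /
  -- 4`, so the graph is unchanged over the neighbourhood chosen below.
  let χ : ContDiffBump (0 : (ℝ ∙ ν)ᗮ) := ⟨r / 4, r / 2, by positivity, by linarith⟩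
  have hχO : tsupport χ ⊆ O := by
    rw [χ.tsupport_eq]
    exact (Metric.closedBall_subset_ball (by simp [χ]; linarith)).trans hrO
  refine ⟨fun v => χ v * φ₀ v, ?_, χ.hasCompactSupport.mul_right, ?_,
    G ∩ {q | ‖hyperplaneProj ν (q - p)‖ < r / 4}, ?_, ⟨hpG, ?_⟩, fun q hq => hq.1.2.1, ?_⟩
  · refine contDiff_iff_contDiffAt.2 fun v => ?_
    by_cases hv : v ∈ O
    · exact χ.contDiff.contDiffAt.mul (hφ₀c hv)
    · have : (fun v => χ v * φ₀ v) =ᶠ[𝓝 v] fun _ => 0 := by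
        have h0 := (isClosed_tsupport χ).isOpen_compl.mem_nhds (fun h => hv (hχO h) : v ∈ (tsupport χ)ᶜ)
        filter_upwards [h0] with x hx
        rw [image_eq_zero_of_notMem_tsupport hx, zero_mul]
      exact contDiffAt_const.congr_of_eventuallyEq this
  · simp [hφ₀, hsymm0]
  · exact hGo.inter (isOpen_lt (by fun_prop) continuous_const)
  · simp [hr]
  · rintro q ⟨hqG, hq⟩
    set v := hyperplaneProj ν (q - p) with hv
    have hvO : v ∈ O := hrO (by simpa using hq.trans (by linarith))
    have hχv : χ v = 1 := χ.one_of_mem_closedBall (by simpa [χ] using hq.le)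
    have hq' := e.right_inv hvO.1
    rw [hee] at hq'
    have hq1 : hyperplaneProj ν (e.symm (v, 0) - p) = v := (Prod.ext_iff.1 hq').1
    have hq2 : ρ (e.symm (v, 0)) = 0 := (Prod.ext_iff.1 hq').2
    constructor
    · intro h0
      have hqe : e.symm (v, 0) = q := by
        have : Ψ q = (v, 0) := by simp [hΨ, h0, hv]
        rw [← this, ← hee]; exact e.left_inv hqG.1
      refine ⟨v, ?_⟩
      rw [← sub_left_inj (a := p)]
      refine eq_of_hyperplaneProj_eq hν ?_ ?_
      · rw [hyperplaneProj_graphMap]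
      · rw [inner_graphMap hν, hχv, one_mul, hφ₀]
        simp only [hqe]
    · rintro ⟨w, hw⟩
      have hwv : w = v := by rw [hv, ← hw, hyperplaneProj_graphMap]
      have : q = e.symm (v, 0) := by
        rw [← sub_left_inj (a := p)]
        refine eq_of_hyperplaneProj_eq hν (hv.symm.trans hq1.symm) ?_
        rw [← hw, inner_graphMap hν, hwv, hχv, one_mul]
      rw [this, hq2]

end LocalGraph

/-! ### Principal curvatures and the Hessian of the graph -/

section PrincipalCurvatures

open Filter Topology Module

variable {E : Type*} [NormedAddCommGroup E] [InnerProductSpace ℝ E] [FiniteDimensional ℝ E]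

open Classical in
-- The kernel has dimension at most the multiplicity of `0` as a root, and the real roots number at
-- most the dimension.
theorem card_filter_roots_add_finrank_ker_le {T : Type*} [AddCommGroup T] [Module ℝ T]
    [FiniteDimensional ℝ T] (A : T →ₗ[ℝ] T) :
    (A.charpoly.roots.filter (fun κ => κ ≠ 0)).card + finrank ℝ (LinearMap.ker A) ≤
      finrank ℝ T := by
  have h1 : (A.charpoly.roots.filter (fun κ => κ ≠ 0)).card + A.charpoly.roots.count 0 =
      A.charpoly.roots.card := by
    conv_rhs => rw [← Multiset.filter_add_not (fun κ : ℝ => κ ≠ 0) A.charpoly.roots,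
      Multiset.card_add]
    congr 1
    rw [Multiset.count, Multiset.countP_eq_card_filter]
    congr 1
    refine Multiset.filter_congr fun x _ => ?_
    simp [eq_comm]
  have h2 : finrank ℝ (LinearMap.ker A) ≤ A.charpoly.roots.count 0 := by
    rw [Polynomial.count_roots, Polynomial.rootMultiplicity_eq_natTrailingDegree',
      ← LinearMap.finrank_maxGenEigenspace_zero_eq]
    refine Submodule.finrank_mono fun x hx => ?_
    rw [Module.End.mem_maxGenEigenspace]
    exact ⟨1, by simpa using hx⟩
  have h3 := A.charpoly.card_roots'
  rw [LinearMap.charpoly_natDegree] at h3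
  omega

open Classical in
-- On a complement of the kernel the map is injective, hence bounded below in finite dimension.
theorem exists_submodule_of_roots_charpoly {T : Type*} [NormedAddCommGroup T] [NormedSpace ℝ T]
    [FiniteDimensional ℝ T] (A : T →ₗ[ℝ] T) {k : ℕ}
    (hk : k ≤ (A.charpoly.roots.filter (fun κ => κ ≠ 0)).card) :
    ∃ P : Submodule ℝ T, k ≤ finrank ℝ P ∧ ∃ c : ℝ, 0 < c ∧ ∀ h ∈ P, c * ‖h‖ ≤ ‖A h‖ := by
  obtain ⟨P, hP⟩ := Submodule.exists_isCompl (LinearMap.ker A)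
  refine ⟨P, ?_, ?_⟩
  · have h1 := Submodule.finrank_add_eq_of_isCompl hP
    have h2 := card_filter_roots_add_finrank_ker_le A
    omega
  · obtain ⟨K, hK, hA⟩ := (A ∘ₗ P.subtype).exists_antilipschitzWith (by
      refine LinearMap.ker_eq_bot'.2 fun x hx => Subtype.ext ?_
      exact (Submodule.mem_bot ℝ).1 (hP.disjoint.le_bot ⟨hx, x.2⟩))
    refine ⟨(K : ℝ)⁻¹, by positivity, fun h hh => ?_⟩
    have h1 := hA.le_mul_dist ⟨h, hh⟩ 0
    rw [dist_zero_right, map_zero, dist_zero_right] at h1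
    rw [inv_mul_le_iff₀ (by positivity)]
    exact h1

theorem norm_unitNormal {ρ : E → ℝ} {q : E} (h : gradient ρ q ≠ 0) : ‖unitNormal ρ q‖ = 1 := by
  rw [unitNormal, norm_smul, norm_inv, norm_norm, inv_mul_cancel₀ (norm_ne_zero_iff.2 h)]

theorem inner_unitNormal (ρ : E → ℝ) (q w : E) :
    ⟪unitNormal ρ q, w⟫_ℝ = ‖gradient ρ q‖⁻¹ * fderiv ℝ ρ q w := by
  rw [unitNormal, real_inner_smul_left, inner_gradient_left]

theorem differentiableAt_unitNormal {S U : Set E} {ρ : E → ℝ} (h : IsLocalDefiningFunction S U ρ)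
    {q : E} (hq : q ∈ U) : DifferentiableAt ℝ (unitNormal ρ) q := by
  have h1 : ContDiffAt ℝ ∞ (fderiv ℝ ρ) q :=
    (h.contDiffOn.fderiv_of_isOpen (m := ∞) h.isOpen (by simp)).contDiffAt (h.isOpen.mem_nhds hq)
  have h2 : DifferentiableAt ℝ (gradient ρ) q :=
    ((InnerProductSpace.toDual ℝ E).symm.toContinuousLinearEquiv.differentiableAt).comp q
      (h1.differentiableAt (by simp))
  have h3 := h.gradient_ne_zero q hq
  exact ((h2.norm ℝ h3).inv (norm_ne_zero_iff.2 h3)).smul h2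

/-- The normal along the graph is orthogonal to the tangent vectors `u + dφ(u) ν`. At the base point
this gives `dφ = 0`; differentiating the relation once more there gives the Hessian in terms of the
derivative of the normal. -/
theorem fderiv_graph {S U : Set E} {ρ : E → ℝ} (h : IsLocalDefiningFunction S U ρ)
    {p : E} (hp : p ∈ U) {φ : tangentSpace ρ p → ℝ} (hφ : ContDiff ℝ ∞ φ) (hφ0 : φ 0 = 0)
    (hφρ : ∀ᶠ v in 𝓝 0, ρ (graphMap p (unitNormal ρ p) φ v) = 0) :
    fderiv ℝ φ 0 = 0 ∧ ∀ w u : tangentSpace ρ p,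
      fderiv ℝ (fderiv ℝ φ) 0 w u = ⟪shapeOperator ρ p w, u⟫_ℝ := by
  set ν := unitNormal ρ p with hνdef
  have hν : ‖ν‖ = 1 := norm_unitNormal (h.gradient_ne_zero p hp)
  set θ := graphMap p ν φ with hθ
  have hθ0 : θ 0 = p := by simp [hθ, graphMap, hφ0]
  have hθc : Continuous θ := (contDiff_graphMap hφ).continuous
  have hθU : ∀ᶠ v in 𝓝 0, θ v ∈ U :=
    hθc.continuousAt.eventually_mem (by rw [hθ0]; exact h.isOpen.mem_nhds hp)
  have key (u : tangentSpace ρ p) : ∀ᶠ v in 𝓝 0,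
      ⟪unitNormal ρ (θ v), (u : E)⟫_ℝ + fderiv ℝ φ v u * ⟪unitNormal ρ (θ v), ν⟫_ℝ = 0 := by
    filter_upwards [hφρ.eventually_nhds, hθU] with v hv hvU
    have h1 : HasFDerivAt (fun v => ρ (θ v)) _ v :=
      ((h.contDiffOn.contDiffAt (h.isOpen.mem_nhds hvU)).differentiableAt
        (by simp)).hasFDerivAt.comp v (hasFDerivAt_graphMap hφ v)
    have h2 : HasFDerivAt (fun v => ρ (θ v)) (0 : tangentSpace ρ p →L[ℝ] ℝ) v :=
      (hasFDerivAt_const (0 : ℝ) v).congr_of_eventuallyEq hv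
    have h3 := DFunLike.congr_fun (h1.unique h2) u
    simp only [ContinuousLinearMap.comp_apply, add_apply, Submodule.subtypeL_apply,
      ContinuousLinearMap.smulRight_apply, map_add, map_smul, smul_eq_mul, zero_apply] at h3
    rw [inner_unitNormal, inner_unitNormal, mul_left_comm, ← mul_add, h3, mul_zero]
  have hνν : ⟪ν, ν⟫_ℝ = 1 := by rw [real_inner_self_eq_norm_sq, hν]; norm_num
  have hφ1 : fderiv ℝ φ 0 = 0 := by
    ext u
    have := (key u).self_of_nhds
    rw [hθ0, ← hνdef, inner_normal_coe, hνν] at this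
    simpa using this
  refine ⟨hφ1, fun w u => ?_⟩
  have hθd : HasFDerivAt θ (tangentSpace ρ p).subtypeL 0 := by
    have := hasFDerivAt_graphMap (p := p) (ν := ν) hφ 0
    rw [hφ1] at this
    convert this using 1
    ext; simp
  have hN : HasFDerivAt (fun v => unitNormal ρ (θ v))
      (fderiv ℝ (unitNormal ρ) p ∘L (tangentSpace ρ p).subtypeL) 0 := by
    refine HasFDerivAt.comp (g := unitNormal ρ) 0 ?_ hθd
    rw [hθ0]
    exact (differentiableAt_unitNormal h hp).hasFDerivAt
  have hD : HasFDerivAt (fun v => fderiv ℝ φ v u)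
      ((fderiv ℝ (fderiv ℝ φ) 0).flip u) 0 := by
    have h1 : HasFDerivAt (fderiv ℝ φ) (fderiv ℝ (fderiv ℝ φ) 0) 0 :=
      ((hφ.fderiv_right (m := ∞) (by simp)).differentiable (by simp) 0).hasFDerivAt
    have := h1.clm_apply (hasFDerivAt_const u 0)
    exact this.congr_fderiv (by simp)
  have hsum := (hN.inner ℝ (hasFDerivAt_const (u : E) 0)).add
    (hD.mul (hN.inner ℝ (hasFDerivAt_const ν 0)))
  have hzero := hsum.unique ((hasFDerivAt_const (0 : ℝ) (0 : tangentSpace ρ p)).congr_of_eventuallyEq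
    (key u))
  have h3 := DFunLike.congr_fun hzero w
  have hs : ⟪shapeOperator ρ p w, u⟫_ℝ = -⟪fderiv ℝ (unitNormal ρ) p w, (u : E)⟫_ℝ := by
    rw [shapeOperator]
    simp only [LinearMap.neg_apply, LinearMap.comp_apply, ContinuousLinearMap.coe_coe,
      Submodule.subtype_apply, inner_neg_left]
    rw [real_inner_comm, Submodule.inner_orthogonalProjectionOnto_eq_of_mem_left, real_inner_comm]
  simp [hθ0, hφ1, ← hνdef, hν] at h3
  rw [hs]
  linarith

end PrincipalCurvatures

/-! ### Fourier decay and ball growth of the surface measure -/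

section SurfaceDecay

open Filter Topology Module

variable {E : Type} [NormedAddCommGroup E] [InnerProductSpace ℝ E] [FiniteDimensional ℝ E]
  [MeasurableSpace E] [BorelSpace E]

theorem finrank_orthogonal_singleton {ν : E} (hν : ‖ν‖ = 1) :
    finrank ℝ (ℝ ∙ ν)ᗮ = finrank ℝ E - 1 := by
  have h1 := Submodule.finrank_add_finrank_orthogonal (ℝ ∙ ν)
  rw [finrank_span_singleton (norm_ne_zero_iff.1 (hν ▸ one_ne_zero))] at h1
  omega

theorem norm_le_two_mul_max {ν : E} (hν : ‖ν‖ = 1) (ξ : E) :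
    ‖ξ‖ ≤ 2 * max ‖hyperplaneProj ν ξ‖ |⟪ν, ξ⟫_ℝ| := by
  have h : ‖ξ‖ ≤ ‖hyperplaneProj ν ξ‖ + |⟪ν, ξ⟫_ℝ| := by
    conv_lhs => rw [← coe_hyperplaneProj_add hν ξ]
    refine (norm_add_le _ _).trans (le_of_eq ?_)
    rw [norm_smul, hν, mul_one, Real.norm_eq_abs, Submodule.coe_norm]
  linarith [le_max_left ‖hyperplaneProj ν ξ‖ |⟪ν, ξ⟫_ℝ|, le_max_right ‖hyperplaneProj ν ξ‖ |⟪ν, ξ⟫_ℝ|]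

theorem fourierChar_graphMap {ν : E} (p : E) (φ : (ℝ ∙ ν)ᗮ → ℝ) (v : (ℝ ∙ ν)ᗮ) (ξ : E) :
    ((Real.fourierChar (-⟪graphMap p ν φ v, ξ⟫_ℝ) : Circle) : ℂ) =
      (Real.fourierChar (-⟪p, ξ⟫_ℝ) : Circle) *
        Complex.exp ((⟪(-(2 * Real.pi)) • hyperplaneProj ν ξ, v⟫_ℝ +
          (-(2 * Real.pi) * ⟪ν, ξ⟫_ℝ) * φ v : ℝ) * Complex.I) := by
  rw [Real.fourierChar_apply, Real.fourierChar_apply, ← Complex.exp_add, ← add_mul,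
    ← Complex.ofReal_add]
  congr 3
  rw [graphMap, inner_add_left, inner_add_left, real_inner_smul_left, real_inner_smul_left,
    real_inner_comm v, Submodule.inner_orthogonalProjectionOnto_eq_of_mem_left]
  ring

theorem sq_mul_pow_le_of_le {x M C : ℝ} {k n : ℕ} (hkn : k ≤ n) {z : ℝ} (hx0 : 0 ≤ x)
    (hxM : x ≤ M) (hz : 0 ≤ z) (hC : x ^ 2 * z ^ n ≤ C) : x ^ 2 * z ^ k ≤ M ^ 2 + C := by
  have hC0 : 0 ≤ C := le_trans (by positivity) hC
  rcases le_total z 1 with h | h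
  · have h1 : x ^ 2 * z ^ k ≤ x ^ 2 * 1 :=
      mul_le_mul_of_nonneg_left (pow_le_one₀ hz h) (by positivity)
    have h2 : x ^ 2 ≤ M ^ 2 := pow_le_pow_left₀ hx0 hxM 2
    linarith
  · have h1 : x ^ 2 * z ^ k ≤ x ^ 2 * z ^ n :=
      mul_le_mul_of_nonneg_left (pow_le_pow_right₀ h hkn) (by positivity)
    nlinarith [sq_nonneg M]

theorem norm_coe_fourierChar (x : ℝ) : ‖((Real.fourierChar x : Circle) : ℂ)‖ = 1 :=
  Circle.norm_coe _

open Classical in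
-- In graph coordinates a localized surface integral becomes the oscillatory integral already
-- treated, with the Jacobian absorbed in the amplitude. The tangential part of `ξ` plays `τ` and
-- the normal part plays `s`, up to the factor `-2π`.
theorem exists_local_decay {S U : Set E} {ρ : E → ℝ} (hSc : IsClosed S)
    (h : IsLocalDefiningFunction S U ρ) {p : E} (hp : p ∈ U) (hpS : p ∈ S) {k : ℕ}
    (hk : k ≤ ((principalCurvatures ρ p).filter (fun κ => κ ≠ 0)).card) :
    ∃ V : Set E, IsOpen V ∧ p ∈ V ∧ V ⊆ Metric.ball p 1 ∧
      (∃ B : ℝ≥0, ∀ (u : E) (r : ℝ), 0 < r →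
        μHE[finrank ℝ E - 1] (S ∩ V ∩ Metric.ball u r) ≤
          B * ENNReal.ofReal r ^ (finrank ℝ E - 1)) ∧
      ∀ a : E → ℂ, ContDiff ℝ ∞ a → tsupport a ⊆ V → ∃ C : ℝ, ∀ ξ : E,
        ‖∫ y in S, a y * (Real.fourierChar (-⟪y, ξ⟫_ℝ) : Circle) ∂(μHE[finrank ℝ E - 1])‖ ^ 2 *
          ‖ξ‖ ^ k ≤ C := by
  set ν := unitNormal ρ p with hνdef
  have hν : ‖ν‖ = 1 := norm_unitNormal (h.gradient_ne_zero p hp)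
  have hρν : fderiv ℝ ρ p ν ≠ 0 := by
    intro h0
    have h1 := inner_unitNormal ρ p ν
    rw [h0, mul_zero, ← hνdef, real_inner_self_eq_norm_sq, hν] at h1
    norm_num at h1
  obtain ⟨φ, hφ, hφs, hφ0, W, hWo, hpW, hWU, hW⟩ := exists_graph h.isOpen h.contDiffOn hp
    ((h.mem_iff p hp).1 hpS) hν hρν
  set θ := graphMap p ν φ with hθdef
  have hθ : ContDiff ℝ ∞ θ := contDiff_graphMap hφ
  have hθ0 : θ 0 = p := by simp [hθdef, graphMap, hφ0]
  have hQθ : ∀ v, hyperplaneProj ν (θ v - p) = v := hyperplaneProj_graphMap p ν φ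
  have hQ : ‖hyperplaneProj ν‖ ≤ 1 := Submodule.orthogonalProjectionOnto_norm_le _
  obtain ⟨K, hK⟩ := exists_lipschitzWith_graphMap (p := p) hφ hφs
  have hSW : ∀ q ∈ W, (q ∈ S ↔ q ∈ Set.range θ) := fun q hq =>
    (h.mem_iff q (hWU hq)).trans (hW q hq)
  have hφρ : ∀ᶠ v in 𝓝 0, ρ (graphMap p ν φ v) = 0 := by
    have : ∀ᶠ v in 𝓝 0, θ v ∈ W :=
      hθ.continuous.continuousAt.eventually_mem (by rw [hθ0]; exact hWo.mem_nhds hpW)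
    filter_upwards [this] with v hv
    exact (hW _ hv).2 ⟨v, rfl⟩
  obtain ⟨hφ1, hφ2⟩ := fderiv_graph h hp hφ hφ0 hφρ
  obtain ⟨P, hPk, c, hc, hP⟩ := exists_submodule_of_roots_charpoly (shapeOperator ρ p) hk
  have hPh : ∀ w ∈ P, ∃ e : tangentSpace ρ p, ‖e‖ ≤ 1 ∧
      c * ‖w‖ ≤ |fderiv ℝ (fderiv ℝ φ) 0 w e| := by
    intro w hw
    -- The best test direction is that of `shapeOperator ρ p w` itself; if this vanishes, the
    -- witness is `0`.
    refine ⟨‖shapeOperator ρ p w‖⁻¹ • shapeOperator ρ p w, ?_, ?_⟩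
    · rw [norm_smul, norm_inv, norm_norm]
      exact inv_mul_le_one
    · rw [hφ2, real_inner_smul_right, real_inner_self_eq_norm_sq]
      refine (hP w hw).trans ?_
      rcases eq_or_ne ‖shapeOperator ρ p w‖ 0 with h0 | h0
      · simp [h0]
      · rw [sq, inv_mul_cancel_left₀ h0]
        exact le_abs_self _
  obtain ⟨ε, hε, hdecay⟩ := exists_norm_integral_graph_phase_le hφ hφs hφ1 P hc hPh
  have hfin : finrank ℝ (ℝ ∙ ν)ᗮ = finrank ℝ E - 1 := finrank_orthogonal_singleton hν
  refine ⟨W ∩ Metric.ball p 1 ∩ {q | ‖hyperplaneProj ν (q - p)‖ < ε},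
    (hWo.inter Metric.isOpen_ball).inter (isOpen_lt (by fun_prop) continuous_const),
    ⟨⟨hpW, Metric.mem_ball_self one_pos⟩, by simpa using hε⟩, fun q hq => hq.1.2, ?_, ?_⟩
  · obtain ⟨B, hB⟩ := exists_measure_range_section_inter_ball_le hQ hQθ hK
    rw [hfin] at hB
    refine ⟨B, fun u r hr => (measure_mono ?_).trans (hB u r hr)⟩
    rintro q ⟨⟨hqS, hq⟩, hqu⟩
    exact ⟨(hSW q hq.1.1).1 hqS, hqu⟩
  · intro a ha hasupp
    set b : (ℝ ∙ ν)ᗮ → ℂ := fun v => ((fderiv ℝ θ v).toLinearMap.normDet : ℂ) * a (θ v) with hb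
    have hbc : ContDiff ℝ ∞ b :=
      (Complex.ofRealCLM.contDiff.comp (contDiff_normDet_fderiv hθ hQθ)).mul (ha.comp hθ)
    have hbs : tsupport b ⊆ Metric.ball 0 ε := by
      have h1 : tsupport b ⊆ θ ⁻¹' tsupport a := by
        refine closure_minimal ?_ ((isClosed_tsupport a).preimage hθ.continuous)
        intro v hv
        refine subset_tsupport a ?_
        exact right_ne_zero_of_mul hv
      intro v hv
      have := (hasupp (h1 hv)).2
      rw [Set.mem_ofPred_eq, hQθ] at this
      simpa using this
    have hbcs : HasCompactSupport b :=
      HasCompactSupport.of_support_subset_isCompact (isCompact_closedBall (0 : (ℝ ∙ ν)ᗮ) ε)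
        ((subset_tsupport b).trans (hbs.trans Metric.ball_subset_closedBall))
    obtain ⟨C, hC⟩ := hdecay b hbc hbs
    have hint (ξ : E) : ‖∫ y in S, a y * (Real.fourierChar (-⟪y, ξ⟫_ℝ) : Circle)
        ∂(μHE[finrank ℝ E - 1])‖ = ‖∫ v, b v * Complex.exp
          ((⟪(-(2 * Real.pi)) • hyperplaneProj ν ξ, v⟫_ℝ +
          (-(2 * Real.pi) * ⟪ν, ξ⟫_ℝ) * φ v : ℝ) * Complex.I)‖ := by
      have hzero {q : E} (hq : q ∉ W) : a q = 0 := by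
        by_contra h0
        exact hq (hasupp (subset_tsupport a h0)).1.1
      have hFc : Continuous fun y => a y * ((Real.fourierChar (-⟪y, ξ⟫_ℝ) : Circle) : ℂ) := by
        refine ha.continuous.mul (continuous_subtype_val.comp (Real.continuous_fourierChar.comp ?_))
        fun_prop
      have h1 : ∫ y in S, a y * ((Real.fourierChar (-⟪y, ξ⟫_ℝ) : Circle) : ℂ)
          ∂(μHE[finrank ℝ E - 1]) = ∫ y in Set.range θ, a y *
            ((Real.fourierChar (-⟪y, ξ⟫_ℝ) : Circle) : ℂ) ∂(μHE[finrank ℝ E - 1]) := by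
        rw [setIntegral_eq_of_subset_of_forall_sdiff_eq_zero hSc.measurableSet
          (Set.inter_subset_left (t := W)), setIntegral_eq_of_subset_of_forall_sdiff_eq_zero
          (isClosed_range_section hθ.continuous hQθ).measurableSet
          (Set.inter_subset_left (t := W))]
        · congr 2
          ext q
          exact and_congr_left fun hq => hSW q hq
        · rintro q ⟨hq1, hq2⟩
          rw [hzero fun hq => hq2 ⟨hq1, hq⟩, zero_mul]
        · rintro q ⟨hq1, hq2⟩
          rw [hzero fun hq => hq2 ⟨hq1, hq⟩, zero_mul]
      have h2 := integral_range_section hθ hQ hQθ hK hFc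
      rw [hfin] at h2
      rw [h1, h2]
      simp_rw [hθdef, fourierChar_graphMap, ← hθdef]
      rw [← one_mul ‖∫ v, b v * _‖, ← norm_coe_fourierChar (-⟪p, ξ⟫_ℝ), ← norm_mul,
        ← integral_const_mul]
      congr 2
      ext v
      simp only [hb]
      ring
    refine ⟨(∫ v, ‖b v‖) ^ 2 + C, fun ξ => ?_⟩
    rw [hint]
    -- `P` may have dimension larger than `k`; the excess decay is discarded, the trivial bound
    -- serving for `‖ξ‖ ≤ 1`.
    refine sq_mul_pow_le_of_le hPk (norm_nonneg _) ?_ (norm_nonneg _) ?_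
    · refine (norm_integral_le_integral_norm _).trans (le_of_eq ?_)
      congr 1
      ext v
      rw [norm_mul, Complex.norm_exp_ofReal_mul_I, mul_one]
    · refine le_trans (mul_le_mul_of_nonneg_left (pow_le_pow_left₀ (norm_nonneg _) ?_ _)
        (by positivity)) (hC _ _)
      refine (norm_le_two_mul_max hν ξ).trans ?_
      rw [norm_smul, abs_mul, Real.norm_eq_abs, abs_neg, abs_of_pos Real.two_pi_pos,
        ← mul_max_of_nonneg _ _ Real.two_pi_pos.le]
      refine mul_le_mul_of_nonneg_right ?_ (le_max_of_le_left (norm_nonneg _))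
      linarith [Real.two_le_pi]

open scoped Manifold in
-- By compactness finitely many graph patches suffice. Ball growth adds up over the patches, and
-- decay over a smooth partition of unity.
theorem exists_surface_decay {S : Set E} (hS : IsCompact S) (hSh : IsSmoothHypersurface S) {k : ℕ}
    (hcurv : HasNonvanishingPrincipalCurvatures S k) :
    (∃ B : ℝ≥0, ∀ (u : E) (r : ℝ), 0 < r → μHE[finrank ℝ E - 1] (S ∩ Metric.ball u r) ≤
      B * ENNReal.ofReal r ^ (finrank ℝ E - 1)) ∧ μHE[finrank ℝ E - 1] S < ⊤ ∧
    ∀ a : E → ℂ, ContDiff ℝ ∞ a → ∃ C : ℝ, ∀ ξ : E,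
      ‖∫ y in S, a y * (Real.fourierChar (-⟪y, ξ⟫_ℝ) : Circle) ∂(μHE[finrank ℝ E - 1])‖ ^ 2 *
        ‖ξ‖ ^ k ≤ C := by
  classical
  choose U ρ hpU h using hSh
  choose V hVo hpV hVb hVB hVd using fun p : S => exists_local_decay hS.isClosed (h p p.2)
    (hpU p p.2) p.2 (hcurv p p.2 _ _ (hpU p p.2) (h p p.2))
  choose B hB using hVB
  obtain ⟨t, ht⟩ := hS.elim_finite_subcover V hVo fun q hq => Set.mem_iUnion.2 ⟨⟨q, hq⟩, hpV _⟩
  have hcov {A : Set E} : μHE[finrank ℝ E - 1] (S ∩ A) ≤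
      ∑ p ∈ t, μHE[finrank ℝ E - 1] (S ∩ V p ∩ A) := by
    refine (measure_mono ?_).trans (measure_biUnion_finset_le t _)
    rintro q ⟨hqS, hqA⟩
    obtain ⟨p, hpt, hp⟩ := Set.mem_iUnion₂.1 (ht hqS)
    exact Set.mem_iUnion₂.2 ⟨p, hpt, ⟨hqS, hp⟩, hqA⟩
  have hfinite : μHE[finrank ℝ E - 1] S < ⊤ := by
    have h1 := hcov (A := Set.univ)
    rw [Set.inter_univ] at h1
    refine h1.trans_lt (ENNReal.sum_lt_top.2 fun p _ => ?_)
    -- Each patch lies in a unit ball, so its ball growth at radius `1` bounds its whole measure.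
    refine (measure_mono ?_).trans_lt ((hB p p 1 one_pos).trans_lt ?_)
    · exact fun q hq => ⟨hq.1, hVb p hq.1.2⟩
    · simp
  refine ⟨⟨∑ p ∈ t, B p, fun u r hr => ?_⟩, hfinite, fun a ha => ?_⟩
  · refine hcov.trans ?_
    rw [ENNReal.ofNNReal_finsetSum, Finset.sum_mul]
    exact Finset.sum_le_sum fun p _ => hB p u r hr
  · have htc : S ⊆ ⋃ p : t, V p := fun q hq => by
      obtain ⟨p, hpt, hp⟩ := Set.mem_iUnion₂.1 (ht hq)
      exact Set.mem_iUnion.2 ⟨⟨p, hpt⟩, hp⟩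
    obtain ⟨f, hf⟩ := SmoothPartitionOfUnity.exists_isSubordinate 𝓘(ℝ, E) hS.isClosed
      (fun p : t => V p) (fun p => hVo p) htc
    set g : t → E → ℂ := fun p y => (f p y : ℂ) * a y with hg
    have hgc (p : t) : ContDiff ℝ ∞ (g p) :=
      (Complex.ofRealCLM.contDiff.comp (f p).contMDiff.contDiff).mul ha
    have hgs (p : t) : tsupport (g p) ⊆ V p := by
      refine (closure_mono ?_).trans (hf p)
      intro y hy
      exact fun h0 => left_ne_zero_of_mul hy (by simp [h0])
    choose C hC using fun p : t => hVd p (g p) (hgc p) (hgs p)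
    refine ⟨Fintype.card t * ∑ p, C p, fun ξ => ?_⟩
    have : IsFiniteMeasure ((μHE[finrank ℝ E - 1] : Measure E).restrict S) :=
      ⟨by rwa [Measure.restrict_apply_univ]⟩
    have hgi (p : t) : Integrable (fun y => g p y * ((Real.fourierChar (-⟪y, ξ⟫_ℝ) : Circle) : ℂ))
        ((μHE[finrank ℝ E - 1]).restrict S) := by
      have hcont : Continuous fun y => g p y * ((Real.fourierChar (-⟪y, ξ⟫_ℝ) : Circle) : ℂ) := by
        refine (hgc p).continuous.mul
          (continuous_subtype_val.comp (Real.continuous_fourierChar.comp ?_))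
        fun_prop
      obtain ⟨M, hM⟩ := hS.exists_bound_of_continuousOn hcont.continuousOn
      exact Integrable.of_bound hcont.aestronglyMeasurable M
        (ae_restrict_of_forall_mem hS.isClosed.measurableSet hM)
    have hsum : ∫ y in S, a y * ((Real.fourierChar (-⟪y, ξ⟫_ℝ) : Circle) : ℂ)
        ∂(μHE[finrank ℝ E - 1]) = ∑ p, ∫ y in S, g p y *
          ((Real.fourierChar (-⟪y, ξ⟫_ℝ) : Circle) : ℂ) ∂(μHE[finrank ℝ E - 1]) := by
      rw [← integral_finsetSum _ fun p _ => hgi p]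
      refine setIntegral_congr_fun hS.isClosed.measurableSet fun y hy => ?_
      simp only [hg]
      rw [← Finset.sum_mul, ← Finset.sum_mul, ← Complex.ofReal_sum]
      have := f.sum_eq_one hy
      rw [finsum_eq_sum_of_fintype] at this
      rw [this, Complex.ofReal_one, one_mul]
    rw [hsum]
    have h1 : ‖∑ p, ∫ y in S, g p y * ((Real.fourierChar (-⟪y, ξ⟫_ℝ) : Circle) : ℂ)
        ∂(μHE[finrank ℝ E - 1])‖ ^ 2 ≤ Fintype.card t * ∑ p, ‖∫ y in S, g p y *
          ((Real.fourierChar (-⟪y, ξ⟫_ℝ) : Circle) : ℂ) ∂(μHE[finrank ℝ E - 1])‖ ^ 2 :=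
      (pow_le_pow_left₀ (norm_nonneg _) (norm_sum_le _ _) 2).trans sq_sum_le_card_mul_sum_sq
    refine (mul_le_mul_of_nonneg_right h1 (by positivity)).trans ?_
    rw [mul_assoc, Finset.sum_mul]
    exact mul_le_mul_of_nonneg_left (Finset.sum_le_sum fun p _ => hC p ξ) (Nat.cast_nonneg _)

end SurfaceDecay

/-! ### Decay of the normalized surface measure and the linear maximal bound -/

section SurfaceTransform

open Module

/-- The `t`-derivative inserts the factor `⟪y, ξ⟫`. Expanded in an orthonormal basis, it is a
combination of transforms with smooth densities `⟪y, b i⟫`, which decay like `σ̂`, with coefficients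
of size at most `‖ξ‖`. -/
theorem exists_dilatedTransform_decay {E : Type} [NormedAddCommGroup E] [InnerProductSpace ℝ E]
    [FiniteDimensional ℝ E] [MeasurableSpace E] [BorelSpace E] {S : Set E} (hS : IsCompact S)
    (hSh : IsSmoothHypersurface S) {k : ℕ} (hcurv : HasNonvanishingPrincipalCurvatures S k)
    (c : ℝ≥0) : ∃ A : ℝ,
      (∀ ξ : E, ‖dilatedTransform (c • (μHE[finrank ℝ E - 1]).restrict S) 1 ξ‖ ^ 2 * ‖ξ‖ ^ k ≤ A) ∧
      ∀ ξ : E, ‖dilatedTransformDeriv (c • (μHE[finrank ℝ E - 1]).restrict S) 1 ξ‖ ^ 2 * ‖ξ‖ ^ k ≤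
        A * ‖ξ‖ ^ 2 := by
  obtain ⟨-, hfin, hdec⟩ := exists_surface_decay hS hSh hcurv
  set μ := (μHE[finrank ℝ E - 1] : Measure E).restrict S with hμ
  have : IsFiniteMeasure μ := ⟨by rwa [hμ, Measure.restrict_apply_univ]⟩
  set b := stdOrthonormalBasis ℝ E
  obtain ⟨C₀, hC₀⟩ := hdec (fun _ => 1) contDiff_const
  have hac (i : Fin (finrank ℝ E)) : ContDiff ℝ ∞ fun y : E => (⟪y, b i⟫_ℝ : ℂ) :=
    Complex.ofRealCLM.contDiff.comp (contDiff_id.inner ℝ contDiff_const)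
  choose C hC using fun i => hdec _ (hac i)
  set J : Fin (finrank ℝ E) → E → ℂ := fun i ξ =>
    ∫ y, (⟪y, b i⟫_ℝ : ℂ) * (Real.fourierChar (-⟪y, ξ⟫_ℝ) : Circle) ∂μ with hJ
  have hC0 (i) : 0 ≤ C i := le_trans (by positivity) (hC i 0)
  have hC₀0 : 0 ≤ C₀ := le_trans (by positivity) (hC₀ 0)
  set N : ℝ := (finrank ℝ E : ℝ)
  have hN : 0 ≤ N := Nat.cast_nonneg _
  have hsumC : 0 ≤ ∑ i, C i := Finset.sum_nonneg fun i _ => hC0 i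
  refine ⟨(c : ℝ) ^ 2 * C₀ + (c * (2 * Real.pi)) ^ 2 * (N * ∑ i, C i), fun ξ => ?_, fun ξ => ?_⟩
  · have h1 : dilatedTransform (c • μ) 1 ξ =
        c * ∫ y, 1 * ((Real.fourierChar (-⟪y, ξ⟫_ℝ) : Circle) : ℂ) ∂μ := by
      rw [dilatedTransform, integral_smul_nnreal_measure, NNReal.smul_def, Complex.real_smul]
      simp only [one_mul]
    rw [h1, norm_mul, mul_pow, mul_assoc, Complex.norm_real, NNReal.norm_eq]
    have h2 := mul_le_mul_of_nonneg_left (hC₀ ξ) (sq_nonneg (c : ℝ))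
    refine h2.trans (le_add_of_nonneg_right (by positivity))
  · have hint (i) : Integrable (fun y => (⟪y, b i⟫_ℝ : ℂ) *
        ((Real.fourierChar (-⟪y, ξ⟫_ℝ) : Circle) : ℂ)) μ := by
      have hcont : Continuous fun y => (⟪y, b i⟫_ℝ : ℂ) *
          ((Real.fourierChar (-⟪y, ξ⟫_ℝ) : Circle) : ℂ) := by
        refine (hac i).continuous.mul
          (continuous_subtype_val.comp (Real.continuous_fourierChar.comp ?_))
        fun_prop
      obtain ⟨M, hM⟩ := hS.exists_bound_of_continuousOn hcont.continuousOn
      exact Integrable.of_bound hcont.aestronglyMeasurable M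
        (ae_restrict_of_forall_mem hS.isClosed.measurableSet hM)
    have h1 : dilatedTransformDeriv (c • μ) 1 ξ =
        (c * (-(2 * Real.pi) * Complex.I)) * ∑ i, (⟪b i, ξ⟫_ℝ : ℂ) * J i ξ := by
      rw [dilatedTransformDeriv, integral_smul_nnreal_measure, NNReal.smul_def, Complex.real_smul,
        mul_assoc]
      congr 1
      simp_rw [hJ, ← integral_const_mul]
      rw [← integral_finsetSum _ fun i _ => (hint i).const_mul _, ← integral_const_mul]
      congr 1
      ext y
      have h3 : (⟪y, ξ⟫_ℝ : ℂ) = ∑ i, (⟪y, b i⟫_ℝ : ℂ) * (⟪b i, ξ⟫_ℝ : ℂ) := by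
        rw [← b.sum_inner_mul_inner y ξ]
        push_cast
        rfl
      simp only [one_mul]
      have h4 : ∑ i, (⟪b i, ξ⟫_ℝ : ℂ) * ((⟪y, b i⟫_ℝ : ℂ) *
          ((Real.fourierChar (-⟪y, ξ⟫_ℝ) : Circle) : ℂ)) =
          (⟪y, ξ⟫_ℝ : ℂ) * ((Real.fourierChar (-⟪y, ξ⟫_ℝ) : Circle) : ℂ) := by
        rw [h3, Finset.sum_mul]
        exact Finset.sum_congr rfl fun i _ => by ring
      rw [h4]
      push_cast
      ring
    have h2 : ‖∑ i, (⟪b i, ξ⟫_ℝ : ℂ) * J i ξ‖ ^ 2 ≤ ‖ξ‖ ^ 2 * (N * ∑ i, ‖J i ξ‖ ^ 2) := by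
      have h3 : ‖∑ i, (⟪b i, ξ⟫_ℝ : ℂ) * J i ξ‖ ≤ ‖ξ‖ * ∑ i, ‖J i ξ‖ := by
        rw [Finset.mul_sum]
        refine norm_sum_le_of_le _ fun i _ => ?_
        rw [norm_mul, Complex.norm_real]
        refine mul_le_mul_of_nonneg_right ?_ (norm_nonneg _)
        exact (norm_inner_le_norm _ _).trans_eq (by rw [b.norm_eq_one, one_mul])
      refine (pow_le_pow_left₀ (norm_nonneg _) h3 2).trans ?_
      rw [mul_pow]
      refine mul_le_mul_of_nonneg_left ?_ (by positivity)
      refine sq_sum_le_card_mul_sum_sq.trans_eq ?_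
      simp [N]
    have h5 : (∑ i, ‖J i ξ‖ ^ 2) * ‖ξ‖ ^ k ≤ ∑ i, C i := by
      rw [Finset.sum_mul]
      exact Finset.sum_le_sum fun i _ => hC i ξ
    have h6 : ‖(c * (-(2 * Real.pi) * Complex.I) : ℂ)‖ = c * (2 * Real.pi) := by
      simp [abs_of_pos Real.pi_pos]
    rw [h1, norm_mul, h6, mul_pow]
    calc (c * (2 * Real.pi)) ^ 2 * ‖∑ i, (⟪b i, ξ⟫_ℝ : ℂ) * J i ξ‖ ^ 2 * ‖ξ‖ ^ k
        ≤ (c * (2 * Real.pi)) ^ 2 * (‖ξ‖ ^ 2 * (N * ∑ i, ‖J i ξ‖ ^ 2)) * ‖ξ‖ ^ k :=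
          mul_le_mul_of_nonneg_right (mul_le_mul_of_nonneg_left h2 (by positivity)) (by positivity)
      _ = (c * (2 * Real.pi)) ^ 2 * ‖ξ‖ ^ 2 * N * ((∑ i, ‖J i ξ‖ ^ 2) * ‖ξ‖ ^ k) := by ring
      _ ≤ (c * (2 * Real.pi)) ^ 2 * ‖ξ‖ ^ 2 * N * ∑ i, C i :=
          mul_le_mul_of_nonneg_left h5 (by positivity)
      _ = (c * (2 * Real.pi)) ^ 2 * (N * ∑ i, C i) * ‖ξ‖ ^ 2 := by ring
      _ ≤ _ := mul_le_mul_of_nonneg_right (le_add_of_nonneg_left (by positivity)) (by positivity)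

/-- A finite constant exists in every case: when the total mass is zero its inverse is `∞`, but the
restricted measure vanishes. -/
theorem exists_normalizedSurfaceMeasure_eq {m d : ℕ} (S : Set (BlockSpace m d)) :
    ∃ c : ℝ≥0, normalizedSurfaceMeasure S = c • (μHE[m * d - 1]).restrict S := by
  by_cases h0 : μHE[m * d - 1] S = 0
  · refine ⟨0, ?_⟩
    rw [normalizedSurfaceMeasure, Measure.restrict_eq_zero.2 h0, smul_zero, smul_zero]
  · refine ⟨(μHE[m * d - 1] S)⁻¹.toNNReal, ?_⟩
    rw [normalizedSurfaceMeasure]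
    conv_lhs => rw [← ENNReal.coe_toNNReal (ENNReal.inv_ne_top.2 h0)]
    rfl

theorem diagonal_injective {m d : ℕ} (hm : 0 < m) : Function.Injective (diagonal m d) := by
  intro x y h
  exact congrArg (fun z : BlockSpace m d => z ⟨0, hm⟩) h

theorem finrank_blockSpace (m d : ℕ) : finrank ℝ (BlockSpace m d) = m * d := by
  rw [(WithLp.linearEquiv 2 ℝ (Fin m → EuclideanSpace ℝ (Fin d))).finrank_eq, finrank_pi_fintype]
  simp

theorem isFiniteMeasure_normalizedSurfaceMeasure {m d k : ℕ} {S : Set (BlockSpace m d)}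
    (hS : IsCompact S) (hSh : IsSmoothHypersurface S)
    (hcurv : HasNonvanishingPrincipalCurvatures S k) :
    IsFiniteMeasure (normalizedSurfaceMeasure S) := by
  obtain ⟨-, hfin, -⟩ := exists_surface_decay hS hSh hcurv
  obtain ⟨c, hc⟩ := exists_normalizedSurfaceMeasure_eq S
  rw [finrank_blockSpace] at hfin
  have : IsFiniteMeasure ((μHE[m * d - 1]).restrict S) :=
    ⟨by rwa [Measure.restrict_apply_univ]⟩
  rw [hc]
  infer_instance

theorem exists_hasMaximalBound {m d b : ℕ} (hm : 2 ≤ m) {S : Set (BlockSpace m d)}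
    (hS : IsCompact S) (hSn : S.Nonempty) (hSh : IsSmoothHypersurface S)
    (hcurv : HasNonvanishingPrincipalCurvatures S ((m - 1) * d + 1 + b)) {r : ℝ} (hr1 : 1 < r)
    (hr2 : r < 2) (hrb : 1 < (b + 1) * (r - 1)) :
    ∃ C, HasMaximalBound (diagonal m d) (normalizedSurfaceMeasure S) r C := by
  obtain ⟨⟨B, hB⟩, hfin, -⟩ := exists_surface_decay hS hSh hcurv
  have hrank : finrank ℝ (BlockSpace m d) = m * d := finrank_blockSpace m d
  -- A point of the surface carries a nonzero gradient, so the ambient space is nontrivial.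
  have hV : 1 ≤ finrank ℝ (BlockSpace m d) := by
    obtain ⟨q, hq⟩ := hSn
    obtain ⟨U, ρ, hqU, h⟩ := hSh q hq
    have : Nontrivial (BlockSpace m d) := ⟨_, _, h.gradient_ne_zero q hqU⟩
    exact finrank_pos
  obtain ⟨c, hc⟩ := exists_normalizedSurfaceMeasure_eq S
  rw [← finrank_blockSpace] at hc
  rw [hc]
  obtain ⟨A, h0, h1⟩ := exists_dilatedTransform_decay hS hSh hcurv c
  obtain ⟨R, hR⟩ := hS.isBounded.exists_norm_le
  have : IsFiniteMeasure ((μHE[finrank ℝ (BlockSpace m d) - 1]).restrict S) :=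
    ⟨by rwa [Measure.restrict_apply_univ]⟩
  have hD : finrank ℝ (EuclideanSpace ℝ (Fin d)) + (m - 1) * d = finrank ℝ (BlockSpace m d) := by
    rw [hrank, finrank_euclideanSpace_fin]
    obtain ⟨n, rfl⟩ := Nat.exists_eq_add_of_le' (by omega : 1 ≤ m)
    simp [add_mul, add_comm]
  refine exists_lintegral_maximal_le_of_continuous (B := c * B) (R := R) (A := A)
    (D := (m - 1) * d) (b := b) (diagonal m d) (diagonal_injective (by omega)) hD hV ?_ ?_ h0 h1
    hr1 hr2 hrb
  · refine Measure.ae_smul_measure ?_ c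
    exact ae_restrict_of_forall_mem hS.isClosed.measurableSet hR
  · intro u r hr
    rw [Measure.smul_apply, Measure.restrict_apply Metric.isOpen_ball.measurableSet, Set.inter_comm,
      ENNReal.smul_def, smul_eq_mul, ENNReal.coe_mul, mul_assoc]
    exact mul_le_mul_right (hB u r hr) _

end SurfaceTransform

end MultilinearMaximal

/-! ### Conclusion: choice of the exponent -/

open MultilinearMaximal
theorem corollary1p5 (m d k : ℕ) (hm : 2 ≤ m) (hk : ((m : ℝ) - 1) * d + 1 < k)
    (S : Set (BlockSpace m d)) (hS_compact : IsCompact S) (hS_nonempty : S.Nonempty)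
    (hS : IsSmoothHypersurface S) (hcurv : HasNonvanishingPrincipalCurvatures S k)
    (p : ℝ≥0∞)
    (hp : ENNReal.ofReal (((k : ℝ) - ((m : ℝ) - 1) * d + 1) / ((k : ℝ) - ((m : ℝ) - 1) * d)) < p) :
    ∃ C : ℝ≥0, ∀ f : Fin m → EuclideanSpace ℝ (Fin d) → ℂ, (∀ i, MemLp (f i) p volume) →
      (∀ᵐ x, ∀ t ∈ Set.Ioo (1 : ℝ) 2,
        Integrable (fun y : BlockSpace m d => ∏ i, f i (x - t • y i))
          (normalizedSurfaceMeasure S)) ∧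
      MemLp (localMaximal (normalizedSurfaceMeasure S) f) (p / m) volume ∧
      eLpNorm (localMaximal (normalizedSurfaceMeasure S) f) (p / m) volume ≤
        C * ∏ i, eLpNorm (f i) p volume := by
  have hD : ((m : ℝ) - 1) * d = ((m - 1) * d : ℕ) := by
    rw [Nat.cast_mul, Nat.cast_sub (by omega : 1 ≤ m), Nat.cast_one]
  rw [hD] at hk hp
  have hk' : (m - 1) * d + 1 < k := by exact_mod_cast hk
  -- `b` is the decay left after the codimension and the supremum are paid for; the threshold
  -- becomes `(b + 2) / (b + 1)`, which is below `2` since `b ≥ 1`.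
  obtain ⟨b, rfl⟩ := Nat.exists_eq_add_of_le hk'.le
  have hb : 1 ≤ b := by omega
  have hb' : (1 : ℝ) ≤ b := by exact_mod_cast hb
  have hκ : (((m - 1) * d + 1 + b : ℕ) : ℝ) - ((m - 1) * d : ℕ) = b + 1 := by
    push_cast; ring
  rw [hκ] at hp
  have hx2 : ((b : ℝ) + 1 + 1) / (b + 1) < 2 := by
    rw [div_lt_iff₀ (by positivity)]; linarith
  -- The linear bound is proved at an auxiliary `r` with `r < 2`, as interpolation requires; this
  -- also ensures `r ≤ m`. Jensen's inequality, or the L^∞ bound, then reaches `p`.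
  obtain ⟨r, hr1, hr2, hrp⟩ : ∃ r : ℝ, ((b : ℝ) + 1 + 1) / (b + 1) < r ∧ r < 2 ∧
      ENNReal.ofReal r ≤ p := by
    obtain ⟨q, hq0, hq1, hq2⟩ := ENNReal.lt_iff_exists_real_btwn.1 hp
    have hq3 := (ENNReal.ofReal_lt_ofReal_iff_of_nonneg (by positivity)).1 hq1
    obtain ⟨s, hs1, hs2⟩ := exists_between (lt_min hq3 hx2)
    exact ⟨s, hs1, hs2.trans_le (min_le_right _ _),
      (ENNReal.ofReal_le_ofReal (hs2.le.trans (min_le_left _ _))).trans hq2.le⟩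
  rw [div_lt_iff₀ (by positivity)] at hr1
  have hr0 : 1 < r := by
    by_contra h
    nlinarith
  obtain ⟨C, hC⟩ := exists_hasMaximalBound hm hS_compact hS_nonempty hS hcurv hr0 hr2
    (by linarith)
  obtain ⟨R, hR⟩ := hS_compact.isBounded.exists_norm_le
  have := isFiniteMeasure_normalizedSurfaceMeasure hS_compact hS hcurv
  have hm' : (2 : ℝ) ≤ m := by exact_mod_cast hm
  refine exists_localMaximal_bound hC hr0.le (hr2.le.trans hm') (R := R) ?_ hrp
  refine Measure.ae_smul_measure ?_ _
  exact ae_restrict_of_forall_mem hS_compact.isClosed.measurableSet hR
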